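/- Let $0\le m<n$ be integers, let $A,B\in\mathbb N$ and let $L\in\mathbb R$. There are constants $C\in\mathbb N$ and $V_0\in\mathbb R$, depending only on $m,n,A,B,L$, such that the following holds for every real $V\ge V_0$. Put $$R=V^{\frac1{n-m}}\,(\log V)^{\,n+1}.$$ Let $X$ be a finite simplicial complex (realized linearly in some real vector space) of dimension at most $m$, such that every vertex of $X$ lies in at most $A$ simplices and $X$ has at most $B\,V$ simplices in total. (For example, $V$ may be the number of all simplices of $X$, with $B=1$; or, if every simplex of $X$ is a face of an $m$-simplex, $V$ may be the number of $m$-simplices of $X$, with $B=2^{m+1}$.) Then there are a finite linear subdivision $X'$ of $X$ and a map $I$ from the underlying space of $X'$ to the closed ball $B^n(R)$ of radius $R$ about the origin in $\mathbb R^n$ such that: 1. every vertex of $X'$ lies in at most $C$ simplices of $X'$; 2. for every $0\le m'\le m$, each $m'$-simplex of $X$ is cut into a number $N$ of $m'$-simplices of $X'$ with $C^{-1}R^{m'}\le N\le C R^{m'}$; 3. $I$ is $C$-coarse: for every triangulation $T$ of $\mathbb R^n$ by $n$-simplices each of which (as a subset of Euclidean space) is $L$-bilipschitz, via the affine identification of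 its vertices, to the standard $n$-simplex of side length $1$, and the same for their faces, the image $I(\sigma)$ of each simplex $\sigma$ of $X'$ intersects at most $C$ simplices of $T$, and the preimage $I^{-1}(\tau)$ of each simplex $\tau$ of $T$ intersects at most $C$ simplices of $X'$; 4. for each $m'$-simplex $\sigma$ of $X'$, $0\le m'\le m$, the restriction $I|_\sigma$ is $C$-bilipschitz onto $I(\sigma)\subset\mathbb R^n$ (with the Euclidean metric), when $\sigma$ is identified through barycentric coordinates with the standard Euclidean $m'$-simplex of side length $1$. Here a map $f$ between metric spaces is $L$-bilipschitz if $d(f(p),f(q))\le L\,d(p,q)$ and $d(p,q)\le L\,d(f(p),f(q))$ for all $p,q$. -/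

import Mathlib

open Geometry

namespace ThickEmbedding

variable {E F : Type*} [AddCommGroup E] [Module ℝ E] [AddCommGroup F] [Module ℝ F]

/-- `K` has dimension at most `m`: each simplex has at most `m + 1` vertices. -/
def DimLE (K : SimplicialComplex ℝ E) (m : ℕ) : Prop :=
  ∀ s ∈ K.faces, s.card ≤ m + 1

/-- `K` has degree at most `A`: each vertex belongs to at most `A` simplices. -/
def DegreeLE (K : SimplicialComplex ℝ E) (A : ℕ) : Prop :=
  ∀ v ∈ K.vertices, {s ∈ K.faces | v ∈ s}.encard ≤ A

/-- `K'` is a (linear) subdivision of `K`: both have the same underlying space, and each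
(closed) simplex of `K'` lies in a simplex of `K`. -/
def IsSubdivision (K' K : SimplicialComplex ℝ E) : Prop :=
  K'.space = K.space ∧
    ∀ t ∈ K'.faces, ∃ s ∈ K.faces, convexHull ℝ (t : Set E) ⊆ convexHull ℝ (s : Set E)

/-- For a simplex `s` of `K` of dimension `d`, the set of `d`-simplices of a subdivision `K'`
of `K` into which `s` is cut. -/
def pieces (K' : SimplicialComplex ℝ E) (s : Finset E) : Set (Finset E) :=
  {t ∈ K'.faces | t.card = s.card ∧ convexHull ℝ (t : Set E) ⊆ convexHull ℝ (s : Set E)}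

/-- `N S`: the set of all (closed) simplices of `K` that intersect the set `S`. -/
def meeting (K : SimplicialComplex ℝ E) (S : Set E) : Set (Finset E) :=
  {s ∈ K.faces | (convexHull ℝ (s : Set E) ∩ S).Nonempty}

/-- `f` is an `A`-coarse map from (the space of) `K` to (the space of) `T`: the image of each
simplex of `K` intersects at most `A` simplices of `T`, and the preimage of each simplex of `T`
intersects at most `A` simplices of `K`. -/
def IsCoarse (A : ℕ) (K : SimplicialComplex ℝ E) (T : SimplicialComplex ℝ F)
    (f : E → F) : Prop :=
  Set.MapsTo f K.space T.space ∧
    (∀ s ∈ K.faces, (meeting T (f '' convexHull ℝ (s : Set E))).encard ≤ A) ∧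
    ∀ t ∈ T.faces, (meeting K {x ∈ K.space | f x ∈ convexHull ℝ (t : Set F)}).encard ≤ A

/-- `w` is a system of barycentric coordinates on the simplex with vertex set `s`. -/
def IsBarycentric (s : Finset E) (w : E → ℝ) : Prop :=
  (∀ v ∈ s, 0 ≤ w v) ∧ ∑ v ∈ s, w v = 1

/-- The distance, in the standard (regular Euclidean) simplex of side length `1` with vertices
labelled by `s`, between the points with barycentric coordinates `w` and `w'`. -/
noncomputable def unitSimplexDist (s : Finset E) (w w' : E → ℝ) : ℝ :=
  Real.sqrt ((∑ v ∈ s, (w v - w' v) ^ 2) / 2)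

/-- The map `f` is `L`-bilipschitz on the simplex with vertex set `s`, where that simplex is
given the metric of the standard simplex of side length `1`. -/
def BilipschitzOnSimplex {P : Type*} [PseudoMetricSpace P] (L : ℝ) (f : E → P)
    (s : Finset E) : Prop :=
  ∀ w w' : E → ℝ, IsBarycentric s w → IsBarycentric s w' →
    dist (f (∑ v ∈ s, w v • v)) (f (∑ v ∈ s, w' v • v)) ≤ L * unitSimplexDist s w w' ∧
    unitSimplexDist s w w' ≤ L * dist (f (∑ v ∈ s, w v • v)) (f (∑ v ∈ s, w' v • v))

/-- `T` is a triangulation of `ℝⁿ` by `n`-simplices (together with their faces), each of which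
is, in the Euclidean metric, `L`-bilipschitz to the standard simplex of side length `1`. -/
structure IsUnitTriangulation (n : ℕ) (L : ℝ)
    (T : SimplicialComplex ℝ (EuclideanSpace ℝ (Fin n))) : Prop where
  space_eq : T.space = Set.univ
  pure : ∀ s ∈ T.faces, ∃ t ∈ T.faces, s ⊆ t ∧ t.card = n + 1
  bilipschitz : ∀ s ∈ T.faces, BilipschitzOnSimplex L id s

/-- The radius `R = V ^ (1 / (n - m)) * (log V) ^ (n + 1)`. -/
noncomputable def radius (m n : ℕ) (V : ℝ) : ℝ :=
  V ^ (1 / ((n : ℝ) - (m : ℝ))) * Real.log V ^ (n + 1)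

end ThickEmbedding

/-!
The map is constructed at two scales, by random choice at each. Put `R₁ = V ^ (1 / (n - m))` and
`s = (log V) ^ (n + 1)`, so that the ball in question has radius `R₁ * s`.

*Subdivision.* After an enumeration of the vertices of `X`, a point of `X` with barycentric
coordinates `a i` is encoded by the monotone function `i ↦ D * ∑ j < i, a j` (a *path* of
height `D`). Integral paths which are pairwise comparable and differ by at most `1` are the vertices of a
simplex of Kuhn's triangulation (`IsKuhn`, `VertexEnum.subdivision`). It has bounded degree, cuts a
simplex of dimension `d` into about `D ^ d` pieces, and for height `D₁ * D₂` it refines the one for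
height `D₁`, with linear estimates in both directions (`IsKuhn.exists_coarsening`). The subdivision
`X'` is obtained for `D₁` about `R₁` and `D₂` about `s`.

*Large scale.* The vertices of `X` are coloured so that those of a simplex have different colours.
Each vertex is placed at a random point near `R₁` times a point assigned to its colour, where the
points of all colours are in general position. This makes all simplices thick. A simplex meets a
given unit ball with probability `O(R₁ ^ (m - n)) = O(1 / V)`, and these events are independent for
disjoint simplices; as there are `O(V)` simplices, some choice lets each unit ball meet only
`O(log V)` of them (`exists_large_scale_placement`).

*Small scale.* The lattice points of height `D₁` in `X` now have at most `O(log V)` others within a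
given distance, and can be coloured by `O(log V)` colours such that nearby ones differ
(`exists_coloring_near`). The picture is magnified by `s`, and the lattice points are moved by
random vectors of length about `s` which depend only on the colour. Up to translation, there are
only `O((log V) ^ (m + 1))` coloured simplices near a given ball, and each meets it with probability
`O(s ^ (m - n))`, that is, `O((log V) ^ (- n - 1))`. As `m + 1 ≤ n`, some choice lets each unit ball
meet at most `n * (n + 1)` pairwise disjoint coarse simplices, hence a bounded number of them
(`exists_small_scale_placement`, `exists_thick_placement`).

The required map is the linear extension over the simplices of height `D₁`. These have size about
`s` and are thick, so the map is bilipschitz on the simplices of height `D₁ * D₂`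
(`VertexEnum.bilipschitzOnSimplex_extend`), and a bounded number of the latter meet the preimage of
a unit ball (`VertexEnum.exists_preimage_bound`). Coarseness with respect to a triangulation
follows, since a ball meets boundedly many of its simplices (`exists_meeting_bound`).
-/

namespace ThickEmbedding

/-! ### Lattice paths and Kuhn simplices -/

/-- A *path* of length `M` and height `D`: a monotone function `ℕ → R` which starts at `0` and is
constant equal to `D` from `M` on. The increments of a path of height `D` are `D` times a system of
barycentric coordinates with respect to `M` points. -/
structure IsPath {R : Type*} [Zero R] [Preorder R] (M : ℕ) (D : R) (Y : ℕ → R) : Prop where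
  mono : Monotone Y
  zero : Y 0 = 0
  top : ∀ i, M ≤ i → Y i = D

/-- The indices at which a path jumps: the support of its barycentric coordinates. -/
noncomputable def steps {R : Type*} (M : ℕ) (Y : ℕ → R) : Finset ℕ := by
  classical exact (Finset.range M).filter fun i => Y i ≠ Y (i + 1)

theorem mem_steps {R : Type*} {M : ℕ} {Y : ℕ → R} {i : ℕ} :
    i ∈ steps M Y ↔ i < M ∧ Y i ≠ Y (i + 1) := by
  simp [steps]

/-- Pairwise comparable integer functions, any two of which differ by at most `1` everywhere. The
vertex sets of the simplices of Kuhn's (or Freudenthal's) triangulation are of this form. -/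
def IsChainOne (τ : Set (ℕ → ℤ)) : Prop :=
  ∀ p ∈ τ, ∀ q ∈ τ, (p ≤ q ∨ q ≤ p) ∧ ∀ i, q i ≤ p i + 1

theorem IsChainOne.mono {τ τ' : Set (ℕ → ℤ)} (h : IsChainOne τ) (hs : τ' ⊆ τ) : IsChainOne τ' :=
  fun p hp q hq => h p (hs hp) q (hs hq)

open Classical in
/-- In a Kuhn simplex, the sum of the coefficients over the upper part starting at a vertex is,
up to a multiple of the total, one of the coordinates of the combination. -/
theorem IsChainOne.abs_sum_upper_le {τ : Finset (ℕ → ℤ)} (hτ : IsChainOne (τ : Set (ℕ → ℤ)))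
    {h : (ℕ → ℤ) → ℝ} (h0 : ∑ p ∈ τ, h p = 0) {b : ℝ} (hb : 0 ≤ b)
    (hle : ∀ i, |∑ p ∈ τ, h p * (p i : ℝ)| ≤ b) {p : ℕ → ℤ} (hp : p ∈ τ) :
    |∑ q ∈ τ with p ≤ q, h q| ≤ b := by
  by_cases hne : (τ.filter fun q => q < p).Nonempty
  · obtain ⟨r, hr⟩ := (τ.filter fun q => q < p).exists_maximal hne
    have hrm := hr.1
    simp only [Finset.mem_filter] at hrm
    have hlt : ∃ a, r a < p a := by
      by_contra! hcon
      exact absurd hrm.2 (not_lt_of_ge hcon)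
    obtain ⟨a, ha⟩ := hlt
    have key : ∀ q ∈ τ, h q * (q a : ℝ) = (p a - 1 : ℝ) * h q + if p ≤ q then h q else 0 := by
      intro q hq
      have h1 := (hτ r hrm.1 q hq).2 a
      have h2 := (hτ q hq p hp).2 a
      split_ifs with hpq
      · have : q a = p a := by have : p a ≤ q a := hpq a; omega
        rw [this]; ring
      · have hqp : q ≤ p := ((hτ p hp q hq).1).resolve_left hpq
        have hqlt : q < p := lt_of_le_of_ne hqp fun he => hpq he.ge
        have hqr : q ≤ r := by
          rcases (hτ q hq r hrm.1).1 with h' | h'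
          · exact h'
          · exact hr.2 (Finset.mem_filter.2 ⟨hq, hqlt⟩) h'
        have : q a = p a - 1 := by have : q a ≤ r a := hqr a; omega
        rw [this]; push_cast; ring
    have := hle a
    rw [Finset.sum_congr rfl key, Finset.sum_add_distrib, ← Finset.mul_sum, h0, mul_zero,
      zero_add, ← Finset.sum_filter] at this
    exact this
  · have : (τ.filter fun q => p ≤ q) = τ := by
      apply Finset.filter_true_of_mem
      intro q hq
      rcases (hτ p hp q hq).1 with h' | h'
      · exact h'
      · by_contra hcon
        exact hne ⟨q, Finset.mem_filter.2 ⟨hq, lt_of_le_of_ne h' fun he => hcon he.ge⟩⟩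
    rw [this, h0]
    simpa using hb

/-- The coefficients of a combination of total zero of the vertices of a Kuhn simplex are controlled
by the coordinates of that combination. -/
theorem IsChainOne.abs_coeff_le {τ : Finset (ℕ → ℤ)} (hτ : IsChainOne (τ : Set (ℕ → ℤ)))
    {h : (ℕ → ℤ) → ℝ} (h0 : ∑ p ∈ τ, h p = 0) {b : ℝ} (hb : 0 ≤ b)
    (hle : ∀ i, |∑ p ∈ τ, h p * (p i : ℝ)| ≤ b) {p : ℕ → ℤ} (hp : p ∈ τ) :
    |h p| ≤ 2 * b := by
  classical
  have h1 := hτ.abs_sum_upper_le h0 hb hle hp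
  have hsplit : (τ.filter fun q => p ≤ q) = insert p (τ.filter fun q => p < q) := by
    ext q
    simp only [Finset.mem_filter, Finset.mem_insert]
    constructor
    · rintro ⟨hq, hpq⟩
      rcases eq_or_lt_of_le hpq with rfl | h'
      · exact Or.inl rfl
      · exact Or.inr ⟨hq, h'⟩
    · rintro (rfl | ⟨hq, hpq⟩)
      · exact ⟨hp, le_rfl⟩
      · exact ⟨hq, hpq.le⟩
  have h2 : |∑ q ∈ τ with p < q, h q| ≤ b := by
    by_cases hne : (τ.filter fun q => p < q).Nonempty
    · obtain ⟨r, hr⟩ := (τ.filter fun q => p < q).exists_minimal hne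
      have hrm := hr.1
      simp only [Finset.mem_filter] at hrm
      have : (τ.filter fun q => p < q) = τ.filter fun q => r ≤ q := by
        ext q
        simp only [Finset.mem_filter]
        constructor
        · rintro ⟨hq, hpq⟩
          refine ⟨hq, ?_⟩
          rcases (hτ r hrm.1 q hq).1 with h' | h'
          · exact h'
          · exact hr.2 (Finset.mem_filter.2 ⟨hq, hpq⟩) h'
        · rintro ⟨hq, hpq⟩
          exact ⟨hq, lt_of_lt_of_le hrm.2 hpq⟩
      rw [this]
      exact hτ.abs_sum_upper_le h0 hb hle hrm.1
    · rw [Finset.not_nonempty_iff_eq_empty.1 hne]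
      simpa using hb
  rw [hsplit, Finset.sum_insert (by simp)] at h1
  rw [abs_le] at h1 h2 ⊢
  constructor <;> linarith [h1.1, h1.2, h2.1, h2.2]

/-- A combination of total zero of the vertices of a Kuhn simplex has coordinates bounded by the sum
of the absolute values of its coefficients. -/
theorem IsChainOne.abs_sum_le {τ : Finset (ℕ → ℤ)} (hτ : IsChainOne (τ : Set (ℕ → ℤ)))
    {h : (ℕ → ℤ) → ℝ} (h0 : ∑ p ∈ τ, h p = 0) (i : ℕ) :
    |∑ p ∈ τ, h p * (p i : ℝ)| ≤ ∑ p ∈ τ, |h p| := by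
  rcases τ.eq_empty_or_nonempty with rfl | ⟨p₀, hp₀⟩
  · simp
  have : ∑ p ∈ τ, h p * (p i : ℝ) = ∑ p ∈ τ, h p * ((p i : ℝ) - p₀ i) := by
    simp only [mul_sub, Finset.sum_sub_distrib, ← Finset.sum_mul, h0, zero_mul, sub_zero]
  rw [this]
  refine (Finset.abs_sum_le_sum_abs _ _).trans (Finset.sum_le_sum fun p hp => ?_)
  rw [abs_mul]
  refine mul_le_of_le_one_right (abs_nonneg _) ?_
  have h1 := (hτ p hp p₀ hp₀).2 i
  have h2 := (hτ p₀ hp₀ p hp).2 i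
  have h1' : (p₀ i : ℝ) ≤ p i + 1 := by exact_mod_cast h1
  have h2' : (p i : ℝ) ≤ p₀ i + 1 := by exact_mod_cast h2
  rw [abs_le]
  constructor <;> linarith

/-- The integer function `i ↦ ⌊Y i + θ⌋`. For `0 ≤ θ < 1` these are the vertices of the smallest
Kuhn simplex containing `Y`. -/
noncomputable def floorShift (Y : ℕ → ℝ) (θ : ℝ) : ℕ → ℤ := fun i => ⌊Y i + θ⌋

theorem isChainOne_floorShift (Y : ℕ → ℝ) :
    IsChainOne {p | ∃ θ : ℝ, 0 ≤ θ ∧ θ < 1 ∧ p = floorShift Y θ} := by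
  rintro p ⟨θ, h0, h1, rfl⟩ q ⟨θ', h0', h1', rfl⟩
  refine ⟨?_, fun i => ?_⟩
  · rcases le_total θ θ' with h | h
    · exact Or.inl fun i => Int.floor_le_floor (by linarith)
    · exact Or.inr fun i => Int.floor_le_floor (by linarith)
  · unfold floorShift
    rw [← Int.floor_add_one]
    exact Int.floor_le_floor (by linarith)

theorem isPath_floorShift {M : ℕ} {D : ℤ} {Y : ℕ → ℝ} (hY : IsPath M (D : ℝ) Y) {θ : ℝ}
    (h0 : 0 ≤ θ) (h1 : θ < 1) : IsPath M D (floorShift Y θ) := by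
  refine ⟨fun i j hij => Int.floor_le_floor (by linarith [hY.mono hij]), ?_, fun i hi => ?_⟩
  · simp [floorShift, hY.zero, Int.floor_eq_zero_iff, h0, h1]
  · simp [floorShift, hY.top i hi, Int.floor_eq_zero_iff, h0, h1]

theorem steps_floorShift_subset (M : ℕ) (Y : ℕ → ℝ) (θ : ℝ) :
    steps M (floorShift Y θ) ⊆ steps M Y := by
  intro i hi
  rw [mem_steps] at hi ⊢
  exact ⟨hi.1, fun h => hi.2 (by simp [floorShift, h])⟩

/-- A vertex which occurs with positive weight in a convex combination `Y` of the vertices of a Kuhn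
simplex can be recovered from `Y` by rounding. -/
theorem IsChainOne.eq_floorShift {τ : Finset (ℕ → ℤ)} (hτ : IsChainOne (τ : Set (ℕ → ℤ)))
    {w : (ℕ → ℤ) → ℝ} (hw : ∀ p ∈ τ, 0 ≤ w p) (hw1 : ∑ p ∈ τ, w p = 1) {Y : ℕ → ℝ}
    (hY : ∀ i, Y i = ∑ p ∈ τ, w p * (p i : ℝ)) {p : ℕ → ℤ} (hp : p ∈ τ) (hpos : 0 < w p) :
    ∃ θ : ℝ, 0 ≤ θ ∧ θ < 1 ∧ p = floorShift Y θ := by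
  classical
  have hsplit : ∑ q ∈ τ with p ≤ q, w q + ∑ q ∈ τ with ¬ p ≤ q, w q = 1 := by
    rw [Finset.sum_filter_add_sum_filter_not, hw1]
  have hle : w p ≤ ∑ q ∈ τ with p ≤ q, w q :=
    Finset.single_le_sum (f := w) (fun q hq => hw q (Finset.mem_filter.1 hq).1)
      (Finset.mem_filter.2 ⟨hp, le_rfl⟩)
  have hnn : 0 ≤ ∑ q ∈ τ with ¬ p ≤ q, w q :=
    Finset.sum_nonneg fun q hq => hw q (Finset.mem_filter.1 hq).1
  refine ⟨∑ q ∈ τ with ¬ p ≤ q, w q, hnn, by linarith, ?_⟩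
  funext a
  have hval : Y a + ∑ q ∈ τ with ¬ p ≤ q, w q
      = ∑ q ∈ τ, w q * ((q a : ℝ) + if p ≤ q then 0 else 1) := by
    rw [hY, Finset.sum_filter, ← Finset.sum_add_distrib]
    refine Finset.sum_congr rfl fun q _ => ?_
    by_cases h : p ≤ q <;> simp [h, mul_add]
  have hpa : (p a : ℝ) = ∑ q ∈ τ, w q * (p a : ℝ) := by rw [← Finset.sum_mul, hw1, one_mul]
  have hpa1 : (p a : ℝ) + 1 = ∑ q ∈ τ, w q * ((p a : ℝ) + 1) := by
    rw [← Finset.sum_mul, hw1, one_mul]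
  symm
  unfold floorShift
  rw [Int.floor_eq_iff, hval]
  constructor
  · rw [hpa]
    refine Finset.sum_le_sum fun q hq => mul_le_mul_of_nonneg_left ?_ (hw q hq)
    split_ifs with h
    · have := h a
      have : (p a : ℝ) ≤ q a := by exact_mod_cast this
      linarith
    · have := (hτ q hq p hp).2 a
      exact_mod_cast this
  · rw [hpa1]
    refine Finset.sum_lt_sum (fun q hq => mul_le_mul_of_nonneg_left ?_ (hw q hq)) ⟨p, hp, ?_⟩
    · split_ifs with h
      · have := (hτ p hp q hq).2 a
        have : (q a : ℝ) ≤ p a + 1 := by exact_mod_cast this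
        linarith
      · have := ((hτ p hp q hq).1.resolve_left h) a
        have : (q a : ℝ) ≤ p a := by exact_mod_cast this
        linarith
    · refine mul_lt_mul_of_pos_left ?_ hpos
      simp

/-- A convex combination of the vertices of a Kuhn simplex determines its coefficients, and even the
Kuhn simplex, up to vertices of weight zero. -/
theorem IsChainOne.weights_unique {τ τ' : Finset (ℕ → ℤ)} (hτ : IsChainOne (τ : Set (ℕ → ℤ)))
    (hτ' : IsChainOne (τ' : Set (ℕ → ℤ))) {w w' : (ℕ → ℤ) → ℝ} (hw : ∀ p ∈ τ, 0 ≤ w p)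
    (hw' : ∀ p ∈ τ', 0 ≤ w' p) (hw1 : ∑ p ∈ τ, w p = 1) (hw1' : ∑ p ∈ τ', w' p = 1)
    (hs : ∀ p ∉ τ, w p = 0) (hs' : ∀ p ∉ τ', w' p = 0)
    (heq : ∀ i, ∑ p ∈ τ, w p * (p i : ℝ) = ∑ p ∈ τ', w' p * (p i : ℝ)) : w = w' := by
  classical
  set υ := (τ ∪ τ').filter fun p => w p ≠ 0 ∨ w' p ≠ 0 with hυ
  have hchain : IsChainOne (υ : Set (ℕ → ℤ)) := by
    refine (isChainOne_floorShift fun i => ∑ p ∈ τ, w p * (p i : ℝ)).mono fun p hp => ?_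
    have hp' := (Finset.mem_filter.1 (Finset.mem_coe.1 hp)).2
    rcases hp' with h | h
    · have hpτ : p ∈ τ := by by_contra hc; exact h (hs p hc)
      exact hτ.eq_floorShift hw hw1 (fun _ => rfl) hpτ (lt_of_le_of_ne (hw p hpτ) (Ne.symm h))
    · have hpτ : p ∈ τ' := by by_contra hc; exact h (hs' p hc)
      exact hτ'.eq_floorShift hw' hw1' heq hpτ (lt_of_le_of_ne (hw' p hpτ) (Ne.symm h))
  have hsub : ∀ F : (ℕ → ℤ) → ℝ, ∑ p ∈ υ, w p * F p = ∑ p ∈ τ, w p * F p := by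
    intro F
    trans ∑ p ∈ υ ∪ τ, w p * F p
    · refine Finset.sum_subset Finset.subset_union_left fun p hp hpn => ?_
      have : w p = 0 := by
        by_contra hc
        refine hpn (Finset.mem_filter.2 ⟨?_, Or.inl hc⟩)
        by_contra h2
        exact hc (hs p fun h3 => h2 (Finset.mem_union_left _ h3))
      rw [this, zero_mul]
    · refine (Finset.sum_subset Finset.subset_union_right fun p hp hpn => ?_).symm
      rw [hs p hpn, zero_mul]
  have hsub' : ∀ F : (ℕ → ℤ) → ℝ, ∑ p ∈ υ, w' p * F p = ∑ p ∈ τ', w' p * F p := by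
    intro F
    trans ∑ p ∈ υ ∪ τ', w' p * F p
    · refine Finset.sum_subset Finset.subset_union_left fun p hp hpn => ?_
      have : w' p = 0 := by
        by_contra hc
        refine hpn (Finset.mem_filter.2 ⟨?_, Or.inr hc⟩)
        by_contra h2
        exact hc (hs' p fun h3 => h2 (Finset.mem_union_right _ h3))
      rw [this, zero_mul]
    · refine (Finset.sum_subset Finset.subset_union_right fun p hp hpn => ?_).symm
      rw [hs' p hpn, zero_mul]
  have h0 : ∑ p ∈ υ, (w p - w' p) = 0 := by
    have e1 := hsub fun _ => 1
    have e2 := hsub' fun _ => 1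
    simp only [mul_one] at e1 e2
    rw [Finset.sum_sub_distrib, e1, e2, hw1, hw1', sub_self]
  have hz := fun p (hp : p ∈ υ) => hchain.abs_coeff_le (h := fun p => w p - w' p) h0 le_rfl
    (fun i => by
      simp only [sub_mul, Finset.sum_sub_distrib]
      rw [hsub fun p => (p i : ℝ), hsub' fun p => (p i : ℝ), heq i, sub_self, abs_zero]) hp
  funext p
  by_cases hp : p ∈ υ
  · have := hz p hp
    rw [mul_zero] at this
    exact sub_eq_zero.1 (abs_eq_zero.1 (le_antisymm this (abs_nonneg _)))
  · by_cases hpτ : p ∈ τ ∪ τ'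
    · have : ¬ (w p ≠ 0 ∨ w' p ≠ 0) := fun hc => hp (Finset.mem_filter.2 ⟨hpτ, hc⟩)
      push Not at this
      rw [this.1, this.2]
    · rw [Finset.mem_union, not_or] at hpτ
      rw [hs p hpτ.1, hs' p hpτ.2]

/-- Every path is a convex combination of its roundings `⌊Y + θ⌋`, `0 ≤ θ < 1`. The weight of a
rounding is the length of the set of the parameters `θ` which produce it. -/
theorem IsPath.exists_convex_combination {M : ℕ} {D : ℤ} {Y : ℕ → ℝ} (hY : IsPath M (D : ℝ) Y) :
    ∃ (τ : Finset (ℕ → ℤ)) (w : (ℕ → ℤ) → ℝ),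
      (∀ p ∈ τ, ∃ θ : ℝ, 0 ≤ θ ∧ θ < 1 ∧ p = floorShift Y θ) ∧
      (∀ p, 0 ≤ w p) ∧ (∀ p ∉ τ, w p = 0) ∧ ∑ p ∈ τ, w p = 1 ∧
      ∀ i, ∑ p ∈ τ, w p * (p i : ℝ) = Y i := by
  classical
  have hval : ∀ θ : ℝ, 0 ≤ θ → θ < 1 → ∀ i, floorShift Y θ i = ⌊Y i⌋ ∨
      floorShift Y θ i = ⌊Y i⌋ + 1 := by
    intro θ h0 h1 i
    have h2 : ⌊Y i⌋ ≤ floorShift Y θ i := Int.floor_le_floor (by linarith)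
    have h3 : floorShift Y θ i ≤ ⌊Y i⌋ + 1 := by
      unfold floorShift
      rw [← Int.floor_add_one]
      exact Int.floor_le_floor (by linarith)
    omega
  have hfin : {p | ∃ θ : ℝ, 0 ≤ θ ∧ θ < 1 ∧ p = floorShift Y θ}.Finite := by
    refine ((Finset.range M).powerset.finite_toSet.image
      fun S i => ⌊Y i⌋ + if i ∈ S then 1 else 0).subset ?_
    rintro p ⟨θ, h0, h1, rfl⟩
    refine ⟨(Finset.range M).filter fun i => floorShift Y θ i = ⌊Y i⌋ + 1,
      Finset.mem_coe.2 (Finset.mem_powerset.2 (Finset.filter_subset _ _)), ?_⟩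
    funext i
    simp only [Finset.mem_filter, Finset.mem_range]
    by_cases hi : i < M
    · rcases hval θ h0 h1 i with h | h <;> simp [h, hi]
    · simp only [hi, false_and, if_false, add_zero]
      rw [(isPath_floorShift hY h0 h1).top i (not_lt.1 hi), hY.top i (not_lt.1 hi),
        Int.floor_intCast]
  set S : (ℕ → ℤ) → Set ℝ := fun p => {θ | θ ∈ Set.Ico (0 : ℝ) 1 ∧ floorShift Y θ = p} with hS
  have hmeas : ∀ p, MeasurableSet (S p) := by
    intro p
    have : S p = Set.Ico (0 : ℝ) 1 ∩ ⋂ i, {θ : ℝ | ⌊Y i + θ⌋ = p i} := by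
      ext θ
      simp only [hS, Set.mem_ofPred_eq, Set.mem_inter_iff, Set.mem_iInter, funext_iff, floorShift]
    rw [this]
    refine measurableSet_Ico.inter (MeasurableSet.iInter fun i => ?_)
    exact (Int.measurable_floor.comp (measurable_const.add measurable_id))
      (measurableSet_singleton (p i))
  have hSfin : ∀ p, MeasureTheory.volume (S p) ≠ ⊤ := fun p =>
    ((MeasureTheory.measure_mono (fun θ hθ => hθ.1)).trans_lt
      (measure_Ico_lt_top (a := (0 : ℝ)) (b := 1))).ne
  set w : (ℕ → ℤ) → ℝ := fun p => MeasureTheory.volume.real (S p) with hw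
  have hsum : ∀ (Q : (ℕ → ℤ) → Prop) [DecidablePred Q], ∑ p ∈ hfin.toFinset with Q p, w p =
      MeasureTheory.volume.real {θ | θ ∈ Set.Ico (0 : ℝ) 1 ∧ Q (floorShift Y θ)} := by
    intro Q _
    rw [hw, ← MeasureTheory.measureReal_biUnion_finset (fun p _ q _ hpq => ?_)
      (fun p _ => hmeas p) (fun p _ => hSfin p)]
    · congr 1
      ext θ
      simp only [hS, Finset.mem_filter, Set.Finite.mem_toFinset, Set.mem_ofPred_eq, Set.mem_iUnion,
        exists_prop]
      constructor
      · rintro ⟨p, ⟨_, hQ⟩, hθ, rfl⟩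
        exact ⟨hθ, hQ⟩
      · rintro ⟨hθ, hQ⟩
        exact ⟨_, ⟨⟨θ, hθ.1, hθ.2, rfl⟩, hQ⟩, hθ, rfl⟩
    · refine Set.disjoint_left.2 fun θ h1 h2 => hpq ?_
      rw [← h1.2, ← h2.2]
  have hone : ∑ p ∈ hfin.toFinset, w p = 1 := by
    have := hsum fun _ => True
    rw [Finset.filter_true] at this
    rw [this]
    simp only [and_true]
    exact (Real.volume_real_Ico_of_le zero_le_one).trans (sub_zero 1)
  refine ⟨hfin.toFinset, w, fun p hp => (Set.Finite.mem_toFinset hfin).1 hp, fun p =>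
    MeasureTheory.measureReal_nonneg, fun p hp => ?_, hone, fun i => ?_⟩
  · have : S p = ∅ := by
      rw [Set.eq_empty_iff_forall_notMem]
      rintro θ ⟨hθ, rfl⟩
      exact hp ((Set.Finite.mem_toFinset hfin).2 ⟨θ, hθ.1, hθ.2, rfl⟩)
    simp [hw, this]
  · have hterm : ∀ p ∈ hfin.toFinset, w p * (p i : ℝ) =
        w p * (⌊Y i⌋ : ℝ) + if p i = ⌊Y i⌋ + 1 then w p else 0 := by
      intro p hp
      obtain ⟨θ, h0, h1, rfl⟩ := (Set.Finite.mem_toFinset hfin).1 hp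
      rcases hval θ h0 h1 i with h | h
      · simp [h]
      · rw [h, if_pos rfl]; push_cast; ring
    rw [Finset.sum_congr rfl hterm, Finset.sum_add_distrib, ← Finset.sum_mul, hone, one_mul,
      ← Finset.sum_filter, hsum fun p => p i = ⌊Y i⌋ + 1]
    have : {θ | θ ∈ Set.Ico (0 : ℝ) 1 ∧ floorShift Y θ i = ⌊Y i⌋ + 1}
        = Set.Ico (1 - Int.fract (Y i)) 1 := by
      ext θ
      simp only [floorShift, Set.mem_ofPred_eq, Set.mem_Ico, Int.floor_eq_iff]
      have hf := Int.floor_add_fract (Y i)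
      have hf0 := Int.fract_nonneg (Y i)
      have hf1 := Int.fract_lt_one (Y i)
      push_cast
      constructor
      · rintro ⟨⟨h0, h1⟩, h2, h3⟩
        exact ⟨by linarith, h1⟩
      · rintro ⟨h0, h1⟩
        exact ⟨⟨by linarith, h1⟩, by linarith, by linarith⟩
    rw [this, Real.volume_real_Ico]
    have hf0 := Int.fract_nonneg (Y i)
    rw [max_eq_left (by linarith)]
    linarith [Int.floor_add_fract (Y i)]

/-- Kuhn's triangulation at scale `D₁ * D₂` refines the one at scale `D₁`. The functions
`⌊p / D₂ + θ⌋`, where `p` runs over the vertices of a simplex `τ` and `0 ≤ θ < 1`, are ordered by `θ` first and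
by `p` second, so that all of them together form a single Kuhn simplex. -/
theorem IsChainOne.exists_refinement {M : ℕ} {D₁ : ℤ} {D₂ : ℕ} (hD₂ : 0 < D₂)
    {τ : Finset (ℕ → ℤ)} (hτ : IsChainOne (τ : Set (ℕ → ℤ))) (hne : τ.Nonempty)
    (hpath : ∀ p ∈ τ, IsPath M (D₁ * D₂) p) {σ : Finset ℕ} (hσ : ∀ p ∈ τ, steps M p ⊆ σ) :
    ∃ υ : Finset (ℕ → ℤ), υ.Nonempty ∧ IsChainOne (υ : Set (ℕ → ℤ)) ∧
      (∀ P ∈ υ, IsPath M D₁ P ∧ steps M P ⊆ σ) ∧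
      ∃ w : (ℕ → ℤ) → (ℕ → ℤ) → ℝ, ∀ p ∈ τ, (∀ P, 0 ≤ w p P) ∧ (∀ P ∉ υ, w p P = 0) ∧
        ∑ P ∈ υ, w p P = 1 ∧ ∀ i, D₂ * ∑ P ∈ υ, w p P * (P i : ℝ) = p i := by
  classical
  have hD : (0 : ℤ) < D₂ := by exact_mod_cast hD₂
  have hDR : (0 : ℝ) < D₂ := by exact_mod_cast hD₂
  set υ : Finset (ℕ → ℤ) := (τ ×ˢ Finset.range D₂).image
    fun x => fun i => (x.1 i + (x.2 : ℤ)) / (D₂ : ℤ) with hυ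
  have hY : ∀ p ∈ τ, IsPath M ((D₁ : ℤ) : ℝ) (fun i => (p i : ℝ) / D₂) := by
    intro p hp
    refine ⟨fun i j hij => ?_, ?_, fun i hi => ?_⟩
    · have : (p i : ℝ) ≤ p j := by exact_mod_cast (hpath p hp).mono hij
      exact div_le_div_of_nonneg_right this hDR.le
    · simp [(hpath p hp).zero]
    · rw [(hpath p hp).top i hi]
      push_cast
      field_simp
  have hfl : ∀ p ∈ τ, ∀ θ : ℝ, 0 ≤ θ → θ < 1 →
      floorShift (fun i => (p i : ℝ) / D₂) θ ∈ υ := by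
    intro p hp θ h0 h1
    refine Finset.mem_image.2 ⟨(p, ⌊D₂ * θ⌋₊), ?_, ?_⟩
    · simp only [Finset.mem_product, Finset.mem_range]
      exact ⟨hp, (Nat.floor_lt (by positivity)).2 (by nlinarith)⟩
    · funext i
      simp only [floorShift]
      have hcast : ((⌊D₂ * θ⌋₊ : ℕ) : ℤ) = ⌊(D₂ : ℝ) * θ⌋ :=
        Int.natCast_floor_eq_floor (by positivity)
      rw [hcast, ← Int.floor_intCast_add]
      have : (p i : ℝ) / D₂ + θ = (p i + D₂ * θ) / D₂ := by field_simp
      rw [this, Int.floor_div_natCast]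
  refine ⟨υ, ?_, ?_, ?_, ?_⟩
  · obtain ⟨p, hp⟩ := hne
    exact ⟨_, hfl p hp 0 le_rfl one_pos⟩
  -- `(p + j) / D₂ ≤ (q + k) / D₂` if `j < k`, since `p ≤ q + 1`
  · intro P hP Q hQ
    obtain ⟨⟨p, j⟩, hpj, rfl⟩ := Finset.mem_image.1 (Finset.mem_coe.1 hP)
    obtain ⟨⟨q, k⟩, hqk, rfl⟩ := Finset.mem_image.1 (Finset.mem_coe.1 hQ)
    simp only [Finset.mem_product, Finset.mem_range] at hpj hqk
    refine ⟨?_, fun i => ?_⟩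
    · rcases lt_trichotomy j k with h | h | h
      · left
        intro i
        have := (hτ q hqk.1 p hpj.1).2 i
        exact Int.ediv_le_ediv hD (by dsimp only; omega)
      · subst h
        rcases (hτ p hpj.1 q hqk.1).1 with h' | h'
        · left
          intro i
          have : p i ≤ q i := h' i
          exact Int.ediv_le_ediv hD (by dsimp only; omega)
        · right
          intro i
          have : q i ≤ p i := h' i
          exact Int.ediv_le_ediv hD (by dsimp only; omega)
      · right
        intro i
        have := (hτ p hpj.1 q hqk.1).2 i
        exact Int.ediv_le_ediv hD (by dsimp only; omega)
    · have := (hτ p hpj.1 q hqk.1).2 i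
      have h2 : (p i + (j : ℤ)) / (D₂ : ℤ) + 1 = (p i + j + D₂ * 1) / D₂ := by
        rw [Int.add_mul_ediv_left _ _ hD.ne']
      dsimp only
      rw [h2]
      exact Int.ediv_le_ediv hD (by omega)
  · intro P hP
    obtain ⟨⟨p, j⟩, hpj, rfl⟩ := Finset.mem_image.1 hP
    simp only [Finset.mem_product, Finset.mem_range] at hpj
    have hp := hpath p hpj.1
    refine ⟨⟨fun a b hab => Int.ediv_le_ediv hD (by have := hp.mono hab; dsimp only; omega), ?_,
      ?_⟩, ?_⟩
    · simp only [hp.zero, zero_add]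
      exact Int.ediv_eq_zero_of_lt (by omega) (by omega)
    · intro i hi
      simp only [hp.top i hi]
      rw [add_comm, Int.add_mul_ediv_right _ _ hD.ne',
        Int.ediv_eq_zero_of_lt (by omega) (by omega), zero_add]
    · refine Finset.Subset.trans (fun i hi => ?_) (hσ p hpj.1)
      rw [mem_steps] at hi ⊢
      exact ⟨hi.1, fun h => hi.2 (by simp [h])⟩
  · have hex : ∀ p ∈ τ, ∃ w : (ℕ → ℤ) → ℝ, (∀ P, 0 ≤ w P) ∧ (∀ P ∉ υ, w P = 0) ∧
        ∑ P ∈ υ, w P = 1 ∧ ∀ i, D₂ * ∑ P ∈ υ, w P * (P i : ℝ) = p i := by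
      intro p hp
      obtain ⟨τ', w, h1, h2, h3, h4, h5⟩ := (hY p hp).exists_convex_combination
      have hsub : τ' ⊆ υ := by
        intro P hP
        obtain ⟨θ, h0, h1, rfl⟩ := h1 P hP
        exact hfl p hp θ h0 h1
      refine ⟨w, h2, fun P hP => h3 P fun h => hP (hsub h), ?_, fun i => ?_⟩
      · rw [← h4]
        exact (Finset.sum_subset hsub fun P _ hP => h3 P hP).symm
      · rw [← Finset.sum_subset hsub fun P _ hP => by rw [h3 P hP, zero_mul], h5 i]
        field_simp
    choose! w hw using hex
    exact ⟨w, hw⟩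

/-! ### Barycentric coordinates in a simplicial complex -/

/-- A system of barycentric coordinates on `s`, extended by zero. -/
structure IsWeight {α : Type*} (s : Finset α) (w : α → ℝ) : Prop where
  nonneg : ∀ a, 0 ≤ w a
  eq_zero : ∀ a ∉ s, w a = 0
  sum_eq_one : ∑ a ∈ s, w a = 1

theorem IsWeight.le_one {α : Type*} {s : Finset α} {w : α → ℝ} (h : IsWeight s w) (a : α) :
    w a ≤ 1 := by
  classical
  by_cases ha : a ∈ s
  · rw [← h.sum_eq_one]
    exact Finset.single_le_sum (fun b _ => h.nonneg b) ha
  · rw [h.eq_zero a ha]; exact zero_le_one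

theorem IsWeight.nonempty {α : Type*} {s : Finset α} {w : α → ℝ} (h : IsWeight s w) :
    s.Nonempty := by
  rw [Finset.nonempty_iff_ne_empty]
  rintro rfl
  simpa using h.sum_eq_one

theorem isWeight_of_mem_convexHull {E : Type*} [AddCommGroup E] [Module ℝ E] {s : Finset E} {x : E}
    (hx : x ∈ convexHull ℝ (s : Set E)) : ∃ w, IsWeight s w ∧ ∑ v ∈ s, w v • v = x := by
  classical
  obtain ⟨w, h0, h1, h2⟩ := Finset.mem_convexHull'.1 hx
  refine ⟨fun v => if v ∈ s then w v else 0, ⟨fun a => ?_, fun a ha => by simp [ha], ?_⟩, ?_⟩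
  · split_ifs with h
    · exact h0 a h
    · exact le_rfl
  · rw [← h1]
    exact Finset.sum_congr rfl fun v hv => by simp [hv]
  · rw [← h2]
    exact Finset.sum_congr rfl fun v hv => by simp [hv]

theorem IsWeight.sum_smul_mem_convexHull {α E : Type*} [AddCommGroup E] [Module ℝ E]
    {s : Finset α} {w : α → ℝ} (h : IsWeight s w) {f : α → E} {S : Set E}
    (hf : ∀ a ∈ s, f a ∈ convexHull ℝ S) : ∑ a ∈ s, w a • f a ∈ convexHull ℝ S :=
  (convex_convexHull ℝ S).sum_mem (fun a _ => h.nonneg a) h.sum_eq_one hf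

section
variable {E : Type*} [AddCommGroup E] [Module ℝ E]

/-- A point of a simplicial complex determines its barycentric coordinates, since two faces
intersect in the hull of their common vertices. -/
theorem weights_unique {X : SimplicialComplex ℝ E} {s t : Finset E} (hs : s ∈ X.faces)
    (ht : t ∈ X.faces) {w w' : E → ℝ} (hw : IsWeight s w) (hw' : IsWeight t w')
    (heq : ∑ v ∈ s, w v • v = ∑ v ∈ t, w' v • v) : w = w' := by
  classical
  have hmem : ∑ v ∈ s, w v • v ∈ convexHull ℝ (((s ∩ t : Finset E)) : Set E) := by
    rw [Finset.coe_inter]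
    refine X.inter_subset_convexHull hs ht ⟨?_, ?_⟩
    · exact hw.sum_smul_mem_convexHull fun a ha => subset_convexHull ℝ _ ha
    · rw [heq]
      exact hw'.sum_smul_mem_convexHull fun a ha => subset_convexHull ℝ _ ha
  obtain ⟨u, hu, hux⟩ := isWeight_of_mem_convexHull hmem
  have key : ∀ {r : Finset E} {z : E → ℝ}, r ∈ X.faces → s ∩ t ⊆ r → IsWeight r z →
      ∑ v ∈ r, z v • v = ∑ v ∈ s, w v • v → z = u := by
    intro r z hr hsub hz he
    have h1 : ∑ v ∈ r, u v = 1 := by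
      rw [← hu.sum_eq_one]
      exact (Finset.sum_subset hsub fun v _ hv => hu.eq_zero v hv).symm
    have h2 : ∑ v ∈ r, u v • v = ∑ v ∈ s, w v • v := by
      rw [← hux]
      exact (Finset.sum_subset hsub fun v _ hv => by rw [hu.eq_zero v hv, zero_smul]).symm
    have := (X.indep hr).eq_of_sum_eq_sum_subtype (hz.sum_eq_one.trans h1.symm)
      (he.trans h2.symm)
    funext v
    by_cases hv : v ∈ r
    · exact this v hv
    · rw [hz.eq_zero v hv, hu.eq_zero v fun h => hv (hsub h)]
  rw [key hs Finset.inter_subset_left hw rfl, key ht Finset.inter_subset_right hw' heq.symm]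

/-- An enumeration of the vertices of a simplicial complex by natural numbers. -/
structure VertexEnum (X : SimplicialComplex ℝ E) where
  /-- the number of indices in use -/
  M : ℕ
  /-- the vertex with a given index; only the values below `M` matter -/
  v : ℕ → E
  inj : Set.InjOn v (Set.Iio M)
  exists_vertex : ∀ s ∈ X.faces, ∀ x ∈ s, ∃ i < M, v i = x

theorem exists_vertexEnum {X : SimplicialComplex ℝ E} (hX : X.faces.Finite) :
    Nonempty (VertexEnum X) := by
  classical
  set S : Finset E := hX.toFinset.biUnion id with hS
  let e := S.equivFin
  refine ⟨⟨S.card, fun i => if h : i < S.card then (e.symm ⟨i, h⟩ : E) else 0, ?_, ?_⟩⟩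
  · intro i hi j hj hij
    simp only [Set.mem_Iio] at hi hj
    simp only [hi, hj, dif_pos] at hij
    simpa using e.symm.injective (Subtype.ext hij)
  · intro s hs x hx
    have hxS : x ∈ S := Finset.mem_biUnion.2 ⟨s, hX.mem_toFinset.2 hs, hx⟩
    refine ⟨e ⟨x, hxS⟩, (e ⟨x, hxS⟩).2, ?_⟩
    simp

namespace VertexEnum
variable {X : SimplicialComplex ℝ E} (e : VertexEnum X)

open Classical in
/-- The faces of the complex, as sets of indices. -/
def faces : Set (Finset ℕ) := {σ | σ ⊆ Finset.range e.M ∧ σ.image e.v ∈ X.faces}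

variable {e}

theorem lt_of_mem {σ : Finset ℕ} (hσ : σ ∈ e.faces) {i : ℕ} (hi : i ∈ σ) : i < e.M :=
  Finset.mem_range.1 (hσ.1 hi)

theorem injOn_face {σ : Finset ℕ} (hσ : σ ∈ e.faces) : Set.InjOn e.v (σ : Set ℕ) :=
  e.inj.mono fun _ hi => lt_of_mem hσ hi

open Classical in
theorem image_mem {σ : Finset ℕ} (hσ : σ ∈ e.faces) : σ.image e.v ∈ X.faces := hσ.2

open Classical in
theorem card_image {σ : Finset ℕ} (hσ : σ ∈ e.faces) : (σ.image e.v).card = σ.card :=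
  Finset.card_image_of_injOn (injOn_face hσ)

open Classical in
theorem exists_face {s : Finset E} (hs : s ∈ X.faces) : ∃ σ ∈ e.faces, σ.image e.v = s := by
  refine ⟨(Finset.range e.M).filter fun i => e.v i ∈ s, ?_⟩
  have : ((Finset.range e.M).filter fun i => e.v i ∈ s).image e.v = s := by
    ext x
    simp only [Finset.mem_image, Finset.mem_filter, Finset.mem_range]
    constructor
    · rintro ⟨i, ⟨_, h⟩, rfl⟩; exact h
    · intro hx
      obtain ⟨i, hi, rfl⟩ := e.exists_vertex s hs x hx
      exact ⟨i, ⟨hi, hx⟩, rfl⟩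
  exact ⟨⟨Finset.filter_subset _ _, by rw [this]; exact hs⟩, this⟩

theorem down_closed {σ σ' : Finset ℕ} (hσ : σ ∈ e.faces) (h : σ' ⊆ σ) (hne : σ'.Nonempty) :
    σ' ∈ e.faces := by
  classical
  exact ⟨h.trans hσ.1, X.down_closed hσ.2 (Finset.image_subset_image h) (hne.image _)⟩

theorem face_nonempty {σ : Finset ℕ} (hσ : σ ∈ e.faces) : σ.Nonempty := by
  classical
  exact Finset.image_nonempty.1 (SimplicialComplex.nonempty_of_mem_faces hσ.2)

theorem faces_finite : e.faces.Finite :=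
  (Finset.range e.M).powerset.finite_toSet.subset fun _ hσ =>
    Finset.mem_coe.2 (Finset.mem_powerset.2 hσ.1)

theorem index_weights_unique {σ σ' : Finset ℕ} (hσ : σ ∈ e.faces) (hσ' : σ' ∈ e.faces)
    {a a' : ℕ → ℝ} (ha : IsWeight σ a) (ha' : IsWeight σ' a')
    (heq : ∑ i ∈ σ, a i • e.v i = ∑ i ∈ σ', a' i • e.v i) : a = a' := by
  classical
  have hinv : ∀ i < e.M, Function.invFunOn e.v (Set.Iio e.M) (e.v i) = i := fun i hi =>
    e.inj.leftInvOn_invFunOn hi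
  set T : Finset ℕ → (ℕ → ℝ) → E → ℝ := fun ρ b x =>
    if x ∈ ρ.image e.v then b (Function.invFunOn e.v (Set.Iio e.M) x) else 0 with hT
  have hTv : ∀ {ρ : Finset ℕ} {b : ℕ → ℝ}, ρ ∈ e.faces → ∀ i ∈ ρ, T ρ b (e.v i) = b i := by
    intro ρ b hρ i hi
    simp only [hT, Finset.mem_image_of_mem e.v hi, if_true, hinv i (lt_of_mem hρ hi)]
  have hTw : ∀ {ρ : Finset ℕ} {b : ℕ → ℝ}, ρ ∈ e.faces → IsWeight ρ b →
      IsWeight (ρ.image e.v) (T ρ b) := by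
    intro ρ b hρ hb
    refine ⟨fun x => ?_, fun x hx => by simp only [hT, hx, if_false], ?_⟩
    · simp only [hT]
      split_ifs
      · exact hb.nonneg _
      · exact le_rfl
    · rw [Finset.sum_image (injOn_face hρ), ← hb.sum_eq_one]
      exact Finset.sum_congr rfl fun i hi => hTv hρ i hi
  have hTs : ∀ {ρ : Finset ℕ} {b : ℕ → ℝ}, ρ ∈ e.faces →
      ∑ x ∈ ρ.image e.v, T ρ b x • x = ∑ i ∈ ρ, b i • e.v i := by
    intro ρ b hρ
    rw [Finset.sum_image (injOn_face hρ)]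
    exact Finset.sum_congr rfl fun i hi => by rw [hTv hρ i hi]
  have hTT : T σ a = T σ' a' :=
    weights_unique hσ.2 hσ'.2 (hTw hσ ha) (hTw hσ' ha') (by rw [hTs hσ, hTs hσ', heq])
  have hval : ∀ {ρ : Finset ℕ} {b : ℕ → ℝ}, ρ ∈ e.faces → IsWeight ρ b → ∀ i < e.M,
      T ρ b (e.v i) = b i := by
    intro ρ b hρ hb i hi
    by_cases hiρ : i ∈ ρ
    · exact hTv hρ i hiρ
    · have : e.v i ∉ ρ.image e.v := by
        rw [Finset.mem_image]
        rintro ⟨j, hj, hji⟩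
        exact hiρ (e.inj (lt_of_mem hρ hj) hi hji ▸ hj)
      simp only [hT, this, if_false, hb.eq_zero i hiρ]
  funext i
  by_cases hi : i < e.M
  · rw [← hval hσ ha i hi, ← hval hσ' ha' i hi, hTT]
  · rw [ha.eq_zero i fun h => hi (lt_of_mem hσ h), ha'.eq_zero i fun h => hi (lt_of_mem hσ' h)]

end VertexEnum

/-! ### Points described by paths -/

/-- The point with barycentric coordinates `(Y (i + 1) - Y i) / D` with respect to the points
`v i`, `i < M`. -/
noncomputable def pathPoint (M : ℕ) (v : ℕ → E) (D : ℝ) (Y : ℕ → ℝ) : E :=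
  ∑ i ∈ Finset.range M, ((Y (i + 1) - Y i) / D) • v i

theorem pathPoint_sum {α : Type*} (M : ℕ) (v : ℕ → E) (D : ℝ) (s : Finset α) (k : α → ℝ)
    (Y : α → ℕ → ℝ) :
    pathPoint M v D (fun i => ∑ a ∈ s, k a * Y a i) = ∑ a ∈ s, k a • pathPoint M v D (Y a) := by
  simp only [pathPoint, Finset.smul_sum]
  rw [Finset.sum_comm]
  refine Finset.sum_congr rfl fun i _ => ?_
  simp only [smul_smul]
  rw [← Finset.sum_smul, ← Finset.sum_sub_distrib, Finset.sum_div]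
  congr 1
  refine Finset.sum_congr rfl fun a _ => by ring

theorem pathPoint_mul (M : ℕ) (v : ℕ → E) (D : ℝ) {c : ℝ} (hc : c ≠ 0) (Y : ℕ → ℝ) :
    pathPoint M v (D * c) (fun i => c * Y i) = pathPoint M v D Y := by
  unfold pathPoint
  refine Finset.sum_congr rfl fun i _ => ?_
  rw [← mul_sub, mul_comm D c, mul_div_mul_left _ _ hc]

theorem pathPoint_eq_sum {M : ℕ} {v : ℕ → E} {D : ℝ} {Y : ℕ → ℝ} {σ : Finset ℕ}
    (hσ : σ ⊆ Finset.range M) (hY : ∀ i < M, i ∉ σ → Y i = Y (i + 1)) :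
    pathPoint M v D Y = ∑ i ∈ σ, ((Y (i + 1) - Y i) / D) • v i := by
  refine (Finset.sum_subset hσ fun i hi hiσ => ?_).symm
  rw [hY i (Finset.mem_range.1 hi) hiσ, sub_self, zero_div, zero_smul]

theorem eq_of_notMem_steps {R : Type*} {M : ℕ} {Y : ℕ → R} {σ : Finset ℕ} (h : steps M Y ⊆ σ) :
    ∀ i < M, i ∉ σ → Y i = Y (i + 1) := fun i hi hiσ => by
  by_contra hne
  exact hiσ (h (mem_steps.2 ⟨hi, hne⟩))

theorem IsPath.cast {M : ℕ} {D : ℤ} {p : ℕ → ℤ} (hp : IsPath M D p) :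
    IsPath M (D : ℝ) (fun i => (p i : ℝ)) :=
  ⟨fun i j hij => by exact_mod_cast hp.mono hij, by simp [hp.zero], fun i hi => by
    simp [hp.top i hi]⟩

theorem steps_cast (M : ℕ) (p : ℕ → ℤ) : steps M (fun i => (p i : ℝ)) = steps M p := by
  ext i; simp [mem_steps]

theorem sum_increments {M : ℕ} {Y : ℕ → ℝ} {σ : Finset ℕ} (hσ : σ ⊆ Finset.range M)
    (h : ∀ i < M, i ∉ σ → Y i = Y (i + 1)) : ∑ i ∈ σ, (Y (i + 1) - Y i) = Y M - Y 0 := by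
  rw [← Finset.sum_range_sub]
  refine Finset.sum_subset hσ fun i hi hiσ => ?_
  rw [h i (Finset.mem_range.1 hi) hiσ, sub_self]

theorem IsPath.isWeight {M : ℕ} {D : ℝ} (hD : 0 < D) {Y : ℕ → ℝ} (hY : IsPath M D Y)
    {σ : Finset ℕ} (hσ : σ ⊆ Finset.range M) (hs : steps M Y ⊆ σ) :
    IsWeight σ (fun i => (Y (i + 1) - Y i) / D) := by
  refine ⟨fun i => div_nonneg (sub_nonneg.2 (hY.mono (Nat.le_succ i))) hD.le, fun i hi => ?_, ?_⟩
  · by_cases hiM : i < M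
    · rw [eq_of_notMem_steps hs i hiM hi, sub_self, zero_div]
    · rw [hY.top i (not_lt.1 hiM), hY.top (i + 1) (by omega), sub_self, zero_div]
  · rw [← Finset.sum_div, sum_increments hσ (eq_of_notMem_steps hs), hY.top M le_rfl, hY.zero,
      sub_zero, div_self hD.ne']

/-- A point of the complex determines the path which describes it. -/
theorem VertexEnum.path_unique {X : SimplicialComplex ℝ E} {e : VertexEnum X} {D : ℝ} (hD : 0 < D)
    {Y Z : ℕ → ℝ} (hY : IsPath e.M D Y) (hZ : IsPath e.M D Z) {σ σ' : Finset ℕ}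
    (hσ : σ ∈ e.faces) (hσ' : σ' ∈ e.faces) (hYσ : steps e.M Y ⊆ σ) (hZσ : steps e.M Z ⊆ σ')
    (heq : pathPoint e.M e.v D Y = pathPoint e.M e.v D Z) : Y = Z := by
  rw [pathPoint_eq_sum hσ.1 (eq_of_notMem_steps hYσ),
    pathPoint_eq_sum hσ'.1 (eq_of_notMem_steps hZσ)] at heq
  have := VertexEnum.index_weights_unique hσ hσ' (hY.isWeight hD hσ.1 hYσ)
    (hZ.isWeight hD hσ'.1 hZσ) heq
  have hinc : ∀ i, Y (i + 1) - Y i = Z (i + 1) - Z i := fun i => by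
    have := congr_fun this i
    field_simp at this
    exact this
  funext i
  induction i with
  | zero => rw [hY.zero, hZ.zero]
  | succ i ih => have := hinc i; rw [ih] at this; linarith

end

/-! ### The Kuhn subdivision of a simplicial complex -/

/-- `τ` is the vertex set of a simplex of Kuhn's triangulation, at scale `D`, of the simplex with
vertex indices `σ`. Points are encoded by their lattice paths. -/
structure IsKuhn (M D : ℕ) (σ : Finset ℕ) (τ : Finset (ℕ → ℤ)) : Prop where
  nonempty : τ.Nonempty
  isPath : ∀ p ∈ τ, IsPath M (D : ℤ) p
  chain : IsChainOne (τ : Set (ℕ → ℤ))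
  steps_subset : ∀ p ∈ τ, steps M p ⊆ σ

theorem IsKuhn.subset {M D : ℕ} {σ : Finset ℕ} {τ τ' : Finset (ℕ → ℤ)} (h : IsKuhn M D σ τ)
    (hs : τ' ⊆ τ) (hne : τ'.Nonempty) : IsKuhn M D σ τ' :=
  ⟨hne, fun p hp => h.isPath p (hs hp), h.chain.mono (Finset.coe_subset.2 hs),
    fun p hp => h.steps_subset p (hs hp)⟩

theorem IsKuhn.isPath_sum {M D : ℕ} {σ : Finset ℕ} {τ : Finset (ℕ → ℤ)} (h : IsKuhn M D σ τ)
    {w : (ℕ → ℤ) → ℝ} (hw : IsWeight τ w) :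
    IsPath M (D : ℝ) (fun i => ∑ p ∈ τ, w p * (p i : ℝ)) := by
  refine ⟨fun i j hij => Finset.sum_le_sum fun p hp => ?_, ?_, fun i hi => ?_⟩
  · refine mul_le_mul_of_nonneg_left ?_ (hw.nonneg p)
    exact_mod_cast (h.isPath p hp).mono hij
  · refine Finset.sum_eq_zero fun p hp => by simp [(h.isPath p hp).zero]
  · rw [Finset.sum_congr rfl fun p hp => by rw [(h.isPath p hp).top i hi], ← Finset.sum_mul,
      hw.sum_eq_one, one_mul]
    simp

theorem IsKuhn.sum_eq_of_notMem {M D : ℕ} {σ : Finset ℕ} {τ : Finset (ℕ → ℤ)}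
    (h : IsKuhn M D σ τ) (k : (ℕ → ℤ) → ℝ) :
    ∀ i < M, i ∉ σ → ∑ p ∈ τ, k p * (p i : ℝ) = ∑ p ∈ τ, k p * (p (i + 1) : ℝ) :=
  fun i hi hiσ => Finset.sum_congr rfl fun p hp => by
    rw [eq_of_notMem_steps (h.steps_subset p hp) i hi hiσ]

theorem IsKuhn.steps_sum_subset {M D : ℕ} {σ : Finset ℕ} {τ : Finset (ℕ → ℤ)}
    (h : IsKuhn M D σ τ) (k : (ℕ → ℤ) → ℝ) :
    steps M (fun i => ∑ p ∈ τ, k p * (p i : ℝ)) ⊆ σ := fun i hi => by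
  by_contra hiσ
  exact (mem_steps.1 hi).2 (h.sum_eq_of_notMem k i (mem_steps.1 hi).1 hiσ)

namespace VertexEnum
variable {E : Type*} [AddCommGroup E] [Module ℝ E] {X : SimplicialComplex ℝ E} {e : VertexEnum X}

variable (e) in
/-- The point of the complex which corresponds to a lattice path of height `D`. -/
noncomputable def point (D : ℕ) (p : ℕ → ℤ) : E := pathPoint e.M e.v D (fun i => (p i : ℝ))

theorem sum_smul_point (D : ℕ) (τ : Finset (ℕ → ℤ)) (k : (ℕ → ℤ) → ℝ) :
    ∑ p ∈ τ, k p • e.point D p = pathPoint e.M e.v D (fun i => ∑ p ∈ τ, k p * (p i : ℝ)) :=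
  (pathPoint_sum e.M e.v D τ k fun p i => (p i : ℝ)).symm

theorem point_injective {D : ℕ} (hD : 0 < D) {p q : ℕ → ℤ} (hp : IsPath e.M (D : ℤ) p)
    (hq : IsPath e.M (D : ℤ) q) {σ σ' : Finset ℕ} (hσ : σ ∈ e.faces) (hσ' : σ' ∈ e.faces)
    (hpσ : steps e.M p ⊆ σ) (hqσ : steps e.M q ⊆ σ') (h : e.point D p = e.point D q) : p = q := by
  have := path_unique (e := e) (D := (D : ℝ)) (by exact_mod_cast hD) (by simpa using hp.cast)
    (by simpa using hq.cast) hσ hσ' (by rw [steps_cast]; exact hpσ) (by rw [steps_cast]; exact hqσ)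
    h
  funext i
  exact_mod_cast congr_fun this i

theorem injOn_point {D : ℕ} (hD : 0 < D) {σ : Finset ℕ} (hσ : σ ∈ e.faces)
    {τ : Finset (ℕ → ℤ)} (h : IsKuhn e.M D σ τ) : Set.InjOn (e.point D) (τ : Set (ℕ → ℤ)) :=
  fun _ hp _ hq hpq => point_injective hD (h.isPath _ hp) (h.isPath _ hq) hσ hσ
    (h.steps_subset _ hp) (h.steps_subset _ hq) hpq

/-- A point of the complex determines its barycentric coordinates in the Kuhn subdivision. So Kuhn
simplices meet in common faces, and linear extension over the simplices is well defined. -/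
theorem kuhn_weights_unique {D : ℕ} (hD : 0 < D) {σ σ' : Finset ℕ} (hσ : σ ∈ e.faces)
    (hσ' : σ' ∈ e.faces) {τ τ' : Finset (ℕ → ℤ)} (h : IsKuhn e.M D σ τ) (h' : IsKuhn e.M D σ' τ')
    {w w' : (ℕ → ℤ) → ℝ} (hw : IsWeight τ w) (hw' : IsWeight τ' w')
    (heq : ∑ p ∈ τ, w p • e.point D p = ∑ p ∈ τ', w' p • e.point D p) : w = w' := by
  rw [sum_smul_point, sum_smul_point] at heq
  have := path_unique (by exact_mod_cast hD) (h.isPath_sum hw) (h'.isPath_sum hw') hσ hσ'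
    (h.steps_sum_subset w) (h'.steps_sum_subset w') heq
  exact h.chain.weights_unique h'.chain (fun p _ => hw.nonneg p) (fun p _ => hw'.nonneg p)
    hw.sum_eq_one hw'.sum_eq_one hw.eq_zero hw'.eq_zero fun i => congr_fun this i

open Classical in
theorem mem_convexHull_image_point {D : ℕ} (hD : 0 < D) {σ : Finset ℕ} (hσ : σ ∈ e.faces)
    {τ : Finset (ℕ → ℤ)} (h : IsKuhn e.M D σ τ) {x : E} :
    x ∈ convexHull ℝ ((τ.image (e.point D) : Finset E) : Set E) ↔
      ∃ w, IsWeight τ w ∧ ∑ p ∈ τ, w p • e.point D p = x := by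
  constructor
  · intro hx
    obtain ⟨u, hu, rfl⟩ := isWeight_of_mem_convexHull hx
    refine ⟨fun p => if p ∈ τ then u (e.point D p) else 0, ⟨fun p => ?_, fun p hp => by simp [hp],
      ?_⟩, ?_⟩
    · split_ifs
      · exact hu.nonneg _
      · exact le_rfl
    · rw [← hu.sum_eq_one, Finset.sum_image (injOn_point hD hσ h)]
      exact Finset.sum_congr rfl fun p hp => by simp [hp]
    · rw [Finset.sum_image (injOn_point hD hσ h)]
      exact Finset.sum_congr rfl fun p hp => by simp [hp]
  · rintro ⟨w, hw, rfl⟩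
    exact hw.sum_smul_mem_convexHull fun p hp => subset_convexHull ℝ _
      (Finset.mem_coe.2 (Finset.mem_image_of_mem _ hp))

theorem affine_coeff_eq_zero {σ : Finset ℕ} (hσ : σ ∈ e.faces) {a : ℕ → ℝ}
    (h0 : ∑ i ∈ σ, a i = 0) (h1 : ∑ i ∈ σ, a i • e.v i = 0) : ∀ i ∈ σ, a i = 0 := by
  classical
  have hind := X.indep (image_mem hσ)
  have hinv : ∀ i ∈ σ, a (Function.invFunOn e.v (Set.Iio e.M) (e.v i)) = a i := fun i hi => by
    rw [e.inj.leftInvOn_invFunOn (lt_of_mem hσ hi)]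
  have := hind.eq_of_sum_eq_sum_subtype
    (w₁ := fun x => a (Function.invFunOn e.v (Set.Iio e.M) x)) (w₂ := fun _ => 0)
    (by rw [Finset.sum_image (injOn_face hσ), Finset.sum_congr rfl hinv, h0]; simp)
    (by rw [Finset.sum_image (injOn_face hσ),
          Finset.sum_congr rfl fun i hi => by rw [hinv i hi], h1]; simp)
  intro i hi
  rw [← hinv i hi]
  exact this _ (Finset.mem_image_of_mem _ hi)

open Classical in
theorem affineIndependent_image_point {D : ℕ} (hD : 0 < D) {σ : Finset ℕ} (hσ : σ ∈ e.faces)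
    {τ : Finset (ℕ → ℤ)} (h : IsKuhn e.M D σ τ) :
    AffineIndependent ℝ ((↑) : (τ.image (e.point D) : Finset E) → E) := by
  have hDR : (0 : ℝ) < D := by exact_mod_cast hD
  have key : ∀ u : E → ℝ, ∑ x ∈ τ.image (e.point D), u x = 0 →
      ∑ x ∈ τ.image (e.point D), u x • x = 0 → ∀ x ∈ τ.image (e.point D), u x = 0 := by
    intro u h0 h1
    rw [Finset.sum_image (injOn_point hD hσ h)] at h0 h1
    set k : (ℕ → ℤ) → ℝ := fun p => u (e.point D p) with hk
    set x : ℕ → ℝ := fun i => ∑ p ∈ τ, k p * (p i : ℝ) with hx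
    have h1' : pathPoint e.M e.v D x = 0 := by rw [← sum_smul_point]; exact h1
    have hxσ : ∀ i < e.M, i ∉ σ → x i = x (i + 1) := h.sum_eq_of_notMem k
    rw [pathPoint_eq_sum hσ.1 hxσ] at h1'
    have hx0 : x 0 = 0 := Finset.sum_eq_zero fun p hp => by simp [(h.isPath p hp).zero]
    have hxtop : ∀ i, e.M ≤ i → x i = 0 := by
      intro i hi
      rw [hx]
      dsimp only
      rw [Finset.sum_congr rfl fun p hp => by rw [(h.isPath p hp).top i hi], ← Finset.sum_mul, h0,
        zero_mul]
    have hz := affine_coeff_eq_zero hσ (a := fun i => (x (i + 1) - x i) / D)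
      (by rw [← Finset.sum_div, sum_increments hσ.1 hxσ, hxtop _ le_rfl, hx0]; simp) h1'
    have hstep : ∀ i, x (i + 1) = x i := by
      intro i
      by_cases hi : i < e.M
      · by_cases hiσ : i ∈ σ
        · have := hz i hiσ
          rw [div_eq_zero_iff] at this
          exact sub_eq_zero.1 (this.resolve_right hDR.ne')
        · exact (hxσ i hi hiσ).symm
      · rw [hxtop i (not_lt.1 hi), hxtop (i + 1) (by omega)]
    -- the combination has coordinates zero, hence coefficients zero
    have hxz : ∀ i, x i = 0 := fun i => by
      induction i with
      | zero => exact hx0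
      | succ i ih => rw [hstep, ih]
    intro y hy
    obtain ⟨p, hp, rfl⟩ := Finset.mem_image.1 hy
    have := h.chain.abs_coeff_le (h := k) h0 le_rfl (fun i => by
      have := hxz i
      rw [hx] at this
      dsimp only at this
      rw [this, abs_zero]) hp
    rw [mul_zero] at this
    exact abs_eq_zero.1 (le_antisymm this (abs_nonneg _))
  rw [affineIndependent_iff]
  intro s w h0 h1 i hi
  set u : E → ℝ := fun x => if hx : x ∈ τ.image (e.point D) then
    (if (⟨x, hx⟩ : (τ.image (e.point D) : Finset E)) ∈ s then w ⟨x, hx⟩ else 0) else 0 with hu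
  have hui : ∀ j : (τ.image (e.point D) : Finset E), u j = if j ∈ s then w j else 0 := fun j => by
    simp only [hu, Subtype.coe_eta, Finset.coe_mem, dif_pos]
  have := key u (by
    rw [← Finset.sum_coe_sort, Finset.sum_congr rfl fun j _ => hui j, ← Finset.sum_filter,
      Finset.filter_mem_eq_inter, Finset.univ_inter]
    exact h0) (by
    rw [← Finset.sum_coe_sort, Finset.sum_congr rfl fun j _ => by rw [hui j, ite_smul, zero_smul],
      ← Finset.sum_filter, Finset.filter_mem_eq_inter, Finset.univ_inter]
    exact h1) i i.2
  rw [hui, if_pos hi] at this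
  exact this

variable (e) in
open Classical in
/-- Kuhn's subdivision of `X`, which cuts each edge into `D` edges. The enumeration of the vertices
orders the vertices of each face, which makes the subdivisions of the faces fit together. -/
noncomputable def subdivision (D : ℕ) (hD : 0 < D) : SimplicialComplex ℝ E where
  faces := {t | ∃ σ ∈ e.faces, ∃ τ, IsKuhn e.M D σ τ ∧ τ.image (e.point D) = t}
  isRelLowerSet_faces := by
    rintro t ⟨σ, hσ, τ, h, rfl⟩
    refine ⟨h.nonempty.image _, fun t' hsub hne => ?_⟩
    obtain ⟨τ', hτ', rfl⟩ := Finset.subset_image_iff.1 hsub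
    exact ⟨σ, hσ, τ', h.subset hτ' (Finset.image_nonempty.1 hne), rfl⟩
  indep := by
    rintro t ⟨σ, hσ, τ, h, rfl⟩
    exact affineIndependent_image_point hD hσ h
  inter_subset_convexHull := by
    rintro s t ⟨σ, hσ, τ, h, rfl⟩ ⟨σ', hσ', τ', h', rfl⟩ x ⟨hx, hx'⟩
    obtain ⟨w, hw, hwx⟩ := (mem_convexHull_image_point hD hσ h).1 hx
    obtain ⟨w', hw', hwx'⟩ := (mem_convexHull_image_point hD hσ' h').1 hx'
    obtain rfl := kuhn_weights_unique hD hσ hσ' h h' hw hw' (hwx.trans hwx'.symm)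
    have hw2 : IsWeight (τ ∩ τ') w := by
      refine ⟨hw.nonneg, fun p hp => ?_, ?_⟩
      · rw [Finset.mem_inter, not_and_or] at hp
        exact hp.elim (hw.eq_zero p) (hw'.eq_zero p)
      · rw [← hw.sum_eq_one]
        refine Finset.sum_subset Finset.inter_subset_left fun p hp hpn => hw'.eq_zero p fun hp' =>
          hpn (Finset.mem_inter.2 ⟨hp, hp'⟩)
    rw [← hwx, ← Finset.sum_subset (Finset.inter_subset_left (s₂ := τ')) fun p hp hpn => by
      rw [hw'.eq_zero p fun hp' => hpn (Finset.mem_inter.2 ⟨hp, hp'⟩), zero_smul]]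
    refine hw2.sum_smul_mem_convexHull fun p hp => subset_convexHull ℝ _ ⟨?_, ?_⟩
    · exact Finset.mem_coe.2 (Finset.mem_image_of_mem _ (Finset.mem_inter.1 hp).1)
    · exact Finset.mem_coe.2 (Finset.mem_image_of_mem _ (Finset.mem_inter.1 hp).2)

open Classical in
theorem mem_subdivision_faces {D : ℕ} {hD : 0 < D} {t : Finset E} :
    t ∈ (e.subdivision D hD).faces ↔
      ∃ σ ∈ e.faces, ∃ τ, IsKuhn e.M D σ τ ∧ τ.image (e.point D) = t := Iff.rfl

open Classical in
theorem point_mem_convexHull {D : ℕ} (hD : 0 < D) {σ : Finset ℕ} (hσ : σ ∈ e.faces) {p : ℕ → ℤ}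
    (hp : IsPath e.M (D : ℤ) p) (hs : steps e.M p ⊆ σ) :
    e.point D p ∈ convexHull ℝ ((σ.image e.v : Finset E) : Set E) := by
  have hw := IsPath.isWeight (D := (D : ℝ)) (by exact_mod_cast hD) (by simpa using hp.cast) hσ.1
    (by rw [steps_cast]; exact hs)
  rw [point, pathPoint_eq_sum hσ.1 (eq_of_notMem_steps (by rw [steps_cast]; exact hs))]
  exact hw.sum_smul_mem_convexHull fun i hi => subset_convexHull ℝ _
    (Finset.mem_coe.2 (Finset.mem_image_of_mem _ hi))

open Classical in
theorem convexHull_image_point_subset {D : ℕ} (hD : 0 < D) {σ : Finset ℕ} (hσ : σ ∈ e.faces)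
    {τ : Finset (ℕ → ℤ)} (h : IsKuhn e.M D σ τ) :
    convexHull ℝ ((τ.image (e.point D) : Finset E) : Set E) ⊆
      convexHull ℝ ((σ.image e.v : Finset E) : Set E) := by
  refine convexHull_min ?_ (convex_convexHull ℝ _)
  intro x hx
  obtain ⟨p, hp, rfl⟩ := Finset.mem_image.1 (Finset.mem_coe.1 hx)
  exact point_mem_convexHull hD hσ (h.isPath p hp) (h.steps_subset p hp)

open Classical in
/-- Every point of a face of `X` is given by a path of any prescribed height. -/
theorem exists_path {D : ℕ} (hD : 0 < D) {σ : Finset ℕ} (hσ : σ ∈ e.faces) {x : E}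
    (hx : x ∈ convexHull ℝ ((σ.image e.v : Finset E) : Set E)) :
    ∃ Y : ℕ → ℝ, IsPath e.M (D : ℝ) Y ∧ steps e.M Y ⊆ σ ∧ pathPoint e.M e.v D Y = x := by
  have hDR : (0 : ℝ) < D := by exact_mod_cast hD
  obtain ⟨w, hw, rfl⟩ := isWeight_of_mem_convexHull hx
  set a : ℕ → ℝ := fun i => if i ∈ σ then w (e.v i) else 0 with ha
  have ha0 : ∀ i, 0 ≤ a i := fun i => by
    simp only [ha]; split_ifs
    · exact hw.nonneg _
    · exact le_rfl
  have hinc : ∀ i, (D * ∑ j ∈ Finset.range (i + 1), a j) - D * ∑ j ∈ Finset.range i, a j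
      = D * a i := fun i => by rw [Finset.sum_range_succ]; ring
  have hsum : ∀ i, e.M ≤ i → ∑ j ∈ Finset.range i, a j = 1 := by
    intro i hi
    rw [← hw.sum_eq_one, Finset.sum_image (injOn_face hσ),
      ← Finset.sum_subset (hσ.1.trans (Finset.range_subset_range.2 hi)) fun j _ hj => by
        simp [ha, hj]]
    exact Finset.sum_congr rfl fun j hj => by simp [ha, hj]
  have hst : steps e.M (fun i => (D : ℝ) * ∑ j ∈ Finset.range i, a j) ⊆ σ := by
    intro i hi
    by_contra hiσ
    refine (mem_steps.1 hi).2 ?_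
    rw [Finset.sum_range_succ]
    simp [ha, hiσ]
  refine ⟨fun i => D * ∑ j ∈ Finset.range i, a j, ⟨?_, by simp, fun i hi => by
    rw [hsum i hi, mul_one]⟩, hst, ?_⟩
  · exact monotone_nat_of_le_succ fun i => by
      have := hinc i
      have := mul_nonneg hDR.le (ha0 i)
      linarith
  · rw [pathPoint_eq_sum hσ.1 (eq_of_notMem_steps hst), Finset.sum_image (injOn_face hσ)]
    refine Finset.sum_congr rfl fun i hi => ?_
    rw [hinc i, mul_div_cancel_left₀ _ hDR.ne']
    simp [ha, hi]

open Classical in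
theorem isSubdivision_subdivision {D : ℕ} (hD : 0 < D) : IsSubdivision (e.subdivision D hD) X := by
  have hsub : ∀ t ∈ (e.subdivision D hD).faces, ∃ s ∈ X.faces,
      convexHull ℝ (t : Set E) ⊆ convexHull ℝ (s : Set E) := by
    rintro t ⟨σ, hσ, τ, h, rfl⟩
    exact ⟨_, hσ.2, convexHull_image_point_subset hD hσ h⟩
  refine ⟨Set.Subset.antisymm ?_ ?_, hsub⟩
  · intro x hx
    obtain ⟨t, ht, hxt⟩ := SimplicialComplex.mem_space_iff.1 hx
    obtain ⟨s, hs, hts⟩ := hsub t ht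
    exact SimplicialComplex.mem_space_iff.2 ⟨s, hs, hts hxt⟩
  · intro x hx
    obtain ⟨s, hs, hxs⟩ := SimplicialComplex.mem_space_iff.1 hx
    obtain ⟨σ, hσ, rfl⟩ := e.exists_face hs
    obtain ⟨Y, hY, hst, rfl⟩ := exists_path hD hσ hxs
    obtain ⟨τ, w, h1, h2, h3, h4, h5⟩ :=
      IsPath.exists_convex_combination (D := (D : ℤ)) (by simpa using hY)
    have hw : IsWeight τ w := ⟨h2, h3, h4⟩
    have hK : IsKuhn e.M D σ τ := by
      refine ⟨hw.nonempty, fun p hp => ?_, (isChainOne_floorShift Y).mono fun p hp => h1 p hp,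
        fun p hp => ?_⟩
      · obtain ⟨θ, h0, h1, rfl⟩ := h1 p hp
        exact isPath_floorShift (by simpa using hY) h0 h1
      · obtain ⟨θ, h0, h1, rfl⟩ := h1 p hp
        exact (steps_floorShift_subset _ _ _).trans hst
    refine SimplicialComplex.mem_space_iff.2 ⟨_, ⟨σ, hσ, τ, hK, rfl⟩, ?_⟩
    rw [mem_convexHull_image_point hD hσ hK]
    refine ⟨w, hw, ?_⟩
    rw [sum_smul_point]
    congr 1
    funext i
    exact h5 i

end VertexEnum

/-! ### Counting simplices of the Kuhn subdivision -/

theorem exists_finset_of_injOn {α β : Type*} {A : Set α} {f : α → β} {T : Finset β}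
    (hmaps : ∀ a ∈ A, f a ∈ T) (hinj : Set.InjOn f A) :
    ∃ S : Finset α, (∀ a, a ∈ S ↔ a ∈ A) ∧ S.card ≤ T.card := by
  have hfin : A.Finite := Set.Finite.of_injOn hmaps hinj T.finite_toSet
  refine ⟨hfin.toFinset, fun a => hfin.mem_toFinset, ?_⟩
  exact Finset.card_le_card_of_injOn f (fun a ha => hmaps a (hfin.mem_toFinset.1 ha))
    fun a ha b hb h => hinj (hfin.mem_toFinset.1 ha) (hfin.mem_toFinset.1 hb) h

/-- A path of given height is determined by all but one of its increments. -/
theorem path_ext {M : ℕ} {D : ℤ} {p q : ℕ → ℤ} (hp : IsPath M D p) (hq : IsPath M D q)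
    {σ : Finset ℕ} (hpσ : steps M p ⊆ σ) (hqσ : steps M q ⊆ σ) {i₀ : ℕ}
    (h : ∀ i ∈ σ, i ≠ i₀ → p (i + 1) - p i = q (i + 1) - q i) : p = q := by
  have hinc : ∀ i, i ≠ i₀ → p (i + 1) - p i = q (i + 1) - q i := by
    intro i hi
    by_cases hiσ : i ∈ σ
    · exact h i hiσ hi
    · by_cases hiM : i < M
      · rw [eq_of_notMem_steps hpσ i hiM hiσ, eq_of_notMem_steps hqσ i hiM hiσ, sub_self, sub_self]
      · rw [hp.top i (not_lt.1 hiM), hp.top (i + 1) (by omega), hq.top i (not_lt.1 hiM),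
          hq.top (i + 1) (by omega)]
  have hle : ∀ i ≤ i₀, p i = q i := by
    intro i hi
    induction i with
    | zero => rw [hp.zero, hq.zero]
    | succ i ih => have := hinc i (by omega); have := ih (by omega); omega
  have hgt : ∀ k i, i₀ < i → i + k = max M (i₀ + 1) → p i = q i := by
    intro k
    induction k with
    | zero => intro i hi hik; rw [hp.top i (by omega), hq.top i (by omega)]
    | succ k ih =>
      intro i hi hik
      have := hinc i (by omega)
      have := ih (i + 1) (by omega) (by omega)
      omega
  funext i
  by_cases h1 : i ≤ i₀
  · exact hle i h1
  · by_cases h2 : M ≤ i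
    · rw [hp.top i h2, hq.top i h2]
    · exact hgt (max M (i₀ + 1) - i) i (by omega) (by omega)

/-- The lattice points of a simplex at scale `D`. -/
theorem exists_finset_paths (M D : ℕ) {σ : Finset ℕ} (hσ : σ.Nonempty) :
    ∃ S : Finset (ℕ → ℤ), (∀ p, p ∈ S ↔ IsPath M (D : ℤ) p ∧ steps M p ⊆ σ) ∧
      S.card ≤ (D + 1) ^ (σ.card - 1) := by
  classical
  obtain ⟨i₀, hi₀⟩ := hσ
  obtain ⟨S, hS, hcard⟩ := exists_finset_of_injOn
    (A := {p : ℕ → ℤ | IsPath M (D : ℤ) p ∧ steps M p ⊆ σ})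
    (f := fun p (i : (σ.erase i₀ : Finset ℕ)) => p (i + 1) - p i)
    (T := Fintype.piFinset fun _ : (σ.erase i₀ : Finset ℕ) => Finset.Icc (0 : ℤ) D) (by
      rintro p ⟨hp, -⟩
      rw [Fintype.mem_piFinset]
      intro i
      rw [Finset.mem_Icc]
      have h1 := hp.mono (Nat.le_succ (i : ℕ))
      have h2 := hp.mono (Nat.zero_le (i : ℕ))
      have h3 := hp.mono (le_max_left ((i : ℕ) + 1) M)
      rw [hp.top _ (le_max_right _ _)] at h3
      rw [hp.zero] at h2
      simp only [Nat.succ_eq_add_one] at h1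
      constructor <;> linarith) (by
      rintro p ⟨hp, hps⟩ q ⟨hq, hqs⟩ h
      refine path_ext hp hq hps hqs (i₀ := i₀) fun i hi hne => ?_
      exact congr_fun h ⟨i, Finset.mem_erase.2 ⟨hne, hi⟩⟩)
  refine ⟨S, hS, hcard.trans ?_⟩
  rw [Fintype.card_piFinset]
  simp [Finset.card_erase_of_mem hi₀]

/-- The lattice points of a simplex which are close to a given one. -/
theorem exists_finset_neighbors (M : ℕ) (D : ℤ) (σ : Finset ℕ) (p : ℕ → ℤ) :
    ∃ S : Finset (ℕ → ℤ), (∀ q, IsPath M D q → steps M q ⊆ σ → (∀ i, q i ≤ p i + 1) →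
      (∀ i, p i ≤ q i + 1) → q ∈ S) ∧ S.card ≤ 5 ^ σ.card := by
  classical
  obtain ⟨S, hS, hcard⟩ := exists_finset_of_injOn
    (A := {q : ℕ → ℤ | (IsPath M D q ∧ steps M q ⊆ σ) ∧ (∀ i, q i ≤ p i + 1) ∧
      (∀ i, p i ≤ q i + 1)})
    (f := fun q (i : σ) => (q (i + 1) - q i) - (p (i + 1) - p i))
    (T := Fintype.piFinset fun _ : σ => Finset.Icc (-2 : ℤ) 2) (by
      rintro q ⟨-, h1, h2⟩
      rw [Fintype.mem_piFinset]
      intro i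
      rw [Finset.mem_Icc]
      have := h1 i; have := h1 (i + 1); have := h2 i; have := h2 (i + 1)
      constructor <;> linarith) (by
      rintro q ⟨⟨hq, hqs⟩, -⟩ r ⟨⟨hr, hrs⟩, -⟩ h
      refine path_ext hq hr hqs hrs (i₀ := M) fun i hi _ => ?_
      have := congr_fun h ⟨i, hi⟩
      simpa using this)
  refine ⟨S, fun q h1 h2 h3 h4 => (hS q).2 ⟨⟨h1, h2⟩, h3, h4⟩, hcard.trans ?_⟩
  rw [Fintype.card_piFinset]
  simp

/-- The simplices of Kuhn's triangulation of a given simplex which contain a given vertex. -/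
theorem exists_finset_isKuhn_mem (M D : ℕ) (σ : Finset ℕ) (p : ℕ → ℤ) :
    ∃ S : Finset (Finset (ℕ → ℤ)), (∀ τ, IsKuhn M D σ τ → p ∈ τ → τ ∈ S) ∧
      S.card ≤ 2 ^ 5 ^ σ.card := by
  obtain ⟨S, hS, hcard⟩ := exists_finset_neighbors M D σ p
  refine ⟨S.powerset, fun τ hτ hp => Finset.mem_powerset.2 fun q hq => ?_, ?_⟩
  · exact hS q (hτ.isPath q hq) (hτ.steps_subset q hq) (hτ.chain p hp q hq).2
      (hτ.chain q hq p hp).2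
  · rw [Finset.card_powerset]
    exact Nat.pow_le_pow_right (by norm_num) hcard

theorem exists_finset_isKuhn (M D : ℕ) {σ : Finset ℕ} (hσ : σ.Nonempty) :
    ∃ S : Finset (Finset (ℕ → ℤ)), (∀ τ, IsKuhn M D σ τ → τ ∈ S) ∧
      S.card ≤ (D + 1) ^ (σ.card - 1) * 2 ^ 5 ^ σ.card := by
  classical
  obtain ⟨A, hA, hAc⟩ := exists_finset_paths M D hσ
  choose S hS hSc using exists_finset_isKuhn_mem M D σ
  refine ⟨A.biUnion S, fun τ hτ => ?_, ?_⟩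
  · obtain ⟨p, hp⟩ := hτ.nonempty
    exact Finset.mem_biUnion.2 ⟨p, (hA p).2 ⟨hτ.isPath p hp, hτ.steps_subset p hp⟩, hS p τ hτ hp⟩
  · exact (Finset.card_biUnion_le_card_mul A S _ fun p _ => hSc p).trans
      (Nat.mul_le_mul_right _ hAc)

/-- The path `b` raised by one unit behind the index `i`. -/
def raise (b : ℕ → ℤ) (i : ℕ) : ℕ → ℤ := fun x => b x + if i < x then 1 else 0

theorem raise_injective (b : ℕ → ℤ) : Function.Injective (raise b) := by
  intro i j h
  by_contra hne
  rcases lt_or_gt_of_ne hne with hlt | hlt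
  · have := congr_fun h j
    simp [raise, hlt] at this
  · have := congr_fun h i
    simp [raise, hlt] at this

open Classical in
/-- The top-dimensional Kuhn simplex obtained from a lattice path of height one less, by giving the
remaining unit of weight to each vertex in turn. -/
theorem isKuhn_image_raise {M D : ℕ} (hD : 0 < D) {σ : Finset ℕ} (hσ : σ ⊆ Finset.range M)
    (hne : σ.Nonempty) {b : ℕ → ℤ} (hb : IsPath M ((D - 1 : ℕ) : ℤ) b) (hbσ : steps M b ⊆ σ) :
    IsKuhn M D σ (σ.image (raise b)) := by
  refine ⟨hne.image _, fun p hp => ?_, fun p hp q hq => ?_, fun p hp => ?_⟩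
  · obtain ⟨i, hi, rfl⟩ := Finset.mem_image.1 hp
    refine ⟨fun x y hxy => ?_, by simp [raise, hb.zero], fun x hx => ?_⟩
    · have := hb.mono hxy
      unfold raise
      split_ifs <;> omega
    · have := Finset.mem_range.1 (hσ hi)
      simp only [raise, hb.top x hx]
      split_ifs <;> omega
  · obtain ⟨i, hi, rfl⟩ := Finset.mem_image.1 (Finset.mem_coe.1 hp)
    obtain ⟨j, hj, rfl⟩ := Finset.mem_image.1 (Finset.mem_coe.1 hq)
    refine ⟨?_, fun x => by unfold raise; split_ifs <;> omega⟩
    rcases le_total i j with h | h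
    · right
      intro x
      change raise b j x ≤ raise b i x
      unfold raise
      split_ifs <;> omega
    · left
      intro x
      change raise b i x ≤ raise b j x
      unfold raise
      split_ifs <;> omega
  · obtain ⟨i, hi, rfl⟩ := Finset.mem_image.1 hp
    intro x hx
    rw [mem_steps] at hx
    by_cases hxi : x = i
    · rw [hxi]; exact hi
    · refine hbσ (mem_steps.2 ⟨hx.1, fun h => hx.2 ?_⟩)
      unfold raise
      split_ifs <;> omega

open Classical in
theorem image_raise_injective {σ : Finset ℕ} (hne : σ.Nonempty) {b b' : ℕ → ℤ}
    (h : σ.image (raise b) = σ.image (raise b')) : b = b' := by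
  have hs : ∀ (c : ℕ → ℤ) (x : ℕ), ∑ p ∈ σ.image (raise c), p x =
      σ.card * c x + ∑ i ∈ σ, if i < x then 1 else 0 := by
    intro c x
    rw [Finset.sum_image fun i _ j _ hij => raise_injective c hij]
    simp only [raise, Finset.sum_add_distrib, Finset.sum_const, nsmul_eq_mul]
  funext x
  have h1 := hs b x
  rw [h, hs b' x] at h1
  have hc : (σ.card : ℤ) ≠ 0 := by exact_mod_cast hne.card_pos.ne'
  have : (σ.card : ℤ) * b' x = σ.card * b x := by linarith
  exact (mul_left_cancel₀ hc this).symm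

/-- Many lattice points: all increments but one can be prescribed freely in `[0, k)`. -/
theorem exists_injective_paths {M D k : ℕ} (hk : 0 < k) {σ : Finset ℕ}
    (hσ : σ ⊆ Finset.range M) {i₀ : ℕ} (hi₀ : i₀ ∈ σ) (hkD : k * σ.card ≤ D + 1) :
    ∃ b : (↥(σ.erase i₀) → Fin k) → ℕ → ℤ, Function.Injective b ∧
      ∀ a, IsPath M (D : ℤ) (b a) ∧ steps M (b a) ⊆ σ := by
  classical
  set c : (↥(σ.erase i₀) → Fin k) → ℕ → ℤ := fun a i =>
    if h : i ∈ σ.erase i₀ then (a ⟨i, h⟩ : ℤ) else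
      if i = i₀ then (D : ℤ) - ∑ j, (a j : ℤ) else 0 with hc
  have hsum : ∀ a, ∑ j, ((a : ↥(σ.erase i₀) → Fin k) j : ℤ) ≤ D := by
    intro a
    have h1 : ∑ j, ((a : ↥(σ.erase i₀) → Fin k) j : ℤ) ≤ ∑ _j : (σ.erase i₀ : Finset ℕ),
        (k : ℤ) := Finset.sum_le_sum fun j _ => by exact_mod_cast (a j).2.le
    have h2 : (Finset.univ : Finset (σ.erase i₀ : Finset ℕ)).card + 1 = σ.card := by
      rw [Finset.card_univ, Fintype.card_coe, Finset.card_erase_add_one hi₀]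
    rw [Finset.sum_const, nsmul_eq_mul] at h1
    have h3 : ((k * σ.card : ℕ) : ℤ) ≤ D + 1 := by exact_mod_cast hkD
    rw [← h2] at h3
    push_cast at h3 h1 ⊢
    have hk' : (1 : ℤ) ≤ k := by exact_mod_cast hk
    nlinarith
  have hc0 : ∀ a i, 0 ≤ c a i := by
    intro a i
    simp only [hc]
    split_ifs
    · positivity
    · linarith [hsum a]
    · exact le_rfl
  have hcσ : ∀ a i, i ∉ σ → c a i = 0 := by
    intro a i hi
    have h1 : i ∉ σ.erase i₀ := fun h => hi (Finset.mem_of_mem_erase h)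
    have h2 : i ≠ i₀ := by rintro rfl; exact hi hi₀
    simp only [hc, h1, h2, dif_neg, if_neg, not_false_eq_true]
  have hinc : ∀ a i, ∑ j ∈ Finset.range (i + 1), c a j - ∑ j ∈ Finset.range i, c a j = c a i :=
    fun a i => by rw [Finset.sum_range_succ]; ring
  refine ⟨fun a i => ∑ j ∈ Finset.range i, c a j, fun a a' h => ?_,
    fun a => ⟨⟨?_, by simp, ?_⟩, ?_⟩⟩
  · funext j
    have h1 := hinc a j
    have h2 := hinc a' j
    have e1 := congr_fun h j
    have e2 := congr_fun h (j + 1)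
    dsimp only at e1 e2
    rw [e1, e2, h2] at h1
    simp only [hc, j.2, dif_pos] at h1
    exact Fin.ext (by exact_mod_cast h1.symm)
  · exact monotone_nat_of_le_succ fun i => by
      have := hinc a i
      have := hc0 a i
      linarith
  · intro i hi
    have : ∑ j ∈ Finset.range i, c a j = ∑ j ∈ σ, c a j :=
      (Finset.sum_subset (hσ.trans (Finset.range_subset_range.2 hi)) fun j _ hj => hcσ a j hj).symm
    change ∑ j ∈ Finset.range i, c a j = (D : ℤ)
    rw [this, ← Finset.add_sum_erase σ _ hi₀, ← Finset.sum_coe_sort (σ.erase i₀)]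
    have h1 : c a i₀ = (D : ℤ) - ∑ j, (a j : ℤ) := by simp [hc]
    have h2 : ∀ j : (σ.erase i₀ : Finset ℕ), c a j = (a j : ℤ) := fun j => by
      simp only [hc, j.2, dif_pos]
    rw [h1, Finset.sum_congr rfl fun j _ => h2 j]
    ring
  · intro i hi
    by_contra hiσ
    refine (mem_steps.1 hi).2 ?_
    dsimp only
    rw [Finset.sum_range_succ, hcσ a i hiσ, add_zero]

namespace VertexEnum
variable {E : Type*} [AddCommGroup E] [Module ℝ E] {X : SimplicialComplex ℝ E} {e : VertexEnum X}

/-- A Kuhn simplex consists of affinely independent points of a face, and has at most as many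
vertices as the face. -/
theorem card_le_of_isKuhn {D : ℕ} (hD : 0 < D) {σ : Finset ℕ} (hσ : σ ∈ e.faces)
    {τ : Finset (ℕ → ℤ)} (h : IsKuhn e.M D σ τ) : τ.card ≤ σ.card := by
  classical
  rw [← Finset.card_image_of_injOn (injOn_point hD hσ h), ← card_image hσ]
  refine (affineIndependent_image_point hD hσ h).card_le_card_of_subset_affineSpan ?_
  exact (subset_convexHull ℝ _).trans ((convexHull_image_point_subset hD hσ h).trans
    (convexHull_subset_affineSpan _))

theorem card_le_of_dimLE {m : ℕ} (hm : DimLE X m) {σ : Finset ℕ} (hσ : σ ∈ e.faces) :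
    σ.card ≤ m + 1 := by
  classical
  rw [← card_image hσ]
  exact hm _ (image_mem hσ)

/-- In a complex of degree at most `A`, each index belongs to at most `A` faces. -/
theorem exists_finset_faces_mem {A : ℕ} (hA : DegreeLE X A) {i : ℕ} :
    ∃ S : Finset (Finset ℕ), (∀ σ, σ ∈ S ↔ σ ∈ e.faces ∧ i ∈ σ) ∧ S.card ≤ A := by
  classical
  have hfin : {σ | σ ∈ e.faces ∧ i ∈ σ}.Finite := faces_finite.subset fun σ h => h.1
  refine ⟨hfin.toFinset, fun σ => hfin.mem_toFinset, ?_⟩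
  rcases hfin.toFinset.eq_empty_or_nonempty with h | ⟨σ₀, hσ₀⟩
  · rw [h]; simp
  obtain ⟨hσ₀, hi⟩ := hfin.mem_toFinset.1 hσ₀
  have hv : e.v i ∈ X.vertices := by
    have := image_mem (down_closed hσ₀ (Finset.singleton_subset_iff.2 hi) (by simp))
    rw [SimplicialComplex.mem_vertices]
    simpa using this
  have hle := hA _ hv
  have h1 : ((hfin.toFinset.image fun σ => σ.image e.v : Finset (Finset E)) :
      Set (Finset E)) ⊆ {s ∈ X.faces | e.v i ∈ s} := by
    intro s hs
    obtain ⟨σ, hσ, rfl⟩ := Finset.mem_image.1 (Finset.mem_coe.1 hs)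
    obtain ⟨hσ, hiσ⟩ := hfin.mem_toFinset.1 hσ
    exact ⟨image_mem hσ, Finset.mem_image_of_mem _ hiσ⟩
  have h2 := (Set.encard_le_encard h1).trans hle
  rw [Set.encard_coe_eq_coe_finsetCard, Finset.card_image_of_injOn] at h2
  · exact_mod_cast h2
  · intro σ hσ σ' hσ' h
    have h1 := (hfin.mem_toFinset.1 (Finset.mem_coe.1 hσ)).1
    have h2 := (hfin.mem_toFinset.1 (Finset.mem_coe.1 hσ')).1
    ext j
    constructor
    · intro hj
      have : e.v j ∈ σ'.image e.v := by
        rw [← show σ.image e.v = σ'.image e.v from h]; exact Finset.mem_image_of_mem _ hj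
      obtain ⟨k, hk, hkj⟩ := Finset.mem_image.1 this
      exact e.inj (lt_of_mem h2 hk) (lt_of_mem h1 hj) hkj ▸ hk
    · intro hj
      have : e.v j ∈ σ.image e.v := by
        rw [show σ.image e.v = σ'.image e.v from h]; exact Finset.mem_image_of_mem _ hj
      obtain ⟨k, hk, hkj⟩ := Finset.mem_image.1 this
      exact e.inj (lt_of_mem h1 hk) (lt_of_mem h2 hj) hkj ▸ hk

theorem steps_mem_faces {D : ℕ} (hD : 0 < D) {σ : Finset ℕ} (hσ : σ ∈ e.faces) {p : ℕ → ℤ}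
    (hp : IsPath e.M (D : ℤ) p) (hs : steps e.M p ⊆ σ) : steps e.M p ∈ e.faces := by
  refine down_closed hσ hs ?_
  rw [Finset.nonempty_iff_ne_empty]
  intro h
  have h1 : ∀ i < e.M, i ∉ (∅ : Finset ℕ) → (p i : ℝ) = p (i + 1) := fun i hi hn => by
    rw [eq_of_notMem_steps h.le i hi hn]
  have := sum_increments (Y := fun i => (p i : ℝ)) (Finset.empty_subset _) h1
  rw [hp.top e.M le_rfl, hp.zero, Finset.sum_empty] at this
  push_cast at this
  have : (0 : ℝ) < D := by exact_mod_cast hD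
  linarith

/-- A lattice point lies in a bounded number of Kuhn simplices: the faces which carry them contain a
common vertex. -/
theorem exists_finset_isKuhn_mem_face {m A D : ℕ} (hD : 0 < D) (hm : DimLE X m) (hA : DegreeLE X A)
    (p : ℕ → ℤ) :
    ∃ S : Finset (Finset (ℕ → ℤ)), (∀ σ ∈ e.faces, ∀ τ, IsKuhn e.M D σ τ → p ∈ τ → τ ∈ S) ∧
      S.card ≤ A * 2 ^ 5 ^ (m + 1) := by
  classical
  by_cases hp : ∃ σ ∈ e.faces, IsPath e.M (D : ℤ) p ∧ steps e.M p ⊆ σ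
  · obtain ⟨σ, hσ, hp, hs⟩ := hp
    obtain ⟨i, hi⟩ := face_nonempty (steps_mem_faces hD hσ hp hs)
    obtain ⟨F, hF, hFc⟩ := exists_finset_faces_mem (e := e) hA (i := i)
    choose S hS hSc using fun σ => exists_finset_isKuhn_mem e.M D σ p
    refine ⟨F.biUnion S, fun σ' hσ' τ hτ hpτ => Finset.mem_biUnion.2 ⟨σ', ?_, hS σ' τ hτ hpτ⟩, ?_⟩
    · exact (hF σ').2 ⟨hσ', hτ.steps_subset p hpτ hi⟩
    · refine (Finset.card_biUnion_le_card_mul F S (2 ^ 5 ^ (m + 1)) fun σ' hσ' => ?_).trans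
        (Nat.mul_le_mul_right _ hFc)
      refine (hSc σ').trans (Nat.pow_le_pow_right (by norm_num)
        (Nat.pow_le_pow_right (by norm_num) ?_))
      exact card_le_of_dimLE hm ((hF σ').1 hσ').1
  · refine ⟨∅, fun σ hσ τ hτ hpτ => ?_, by simp⟩
    exact absurd ⟨σ, hσ, hτ.isPath p hpτ, hτ.steps_subset p hpτ⟩ hp

theorem subdivision_faces_finite {D : ℕ} (hD : 0 < D) : (e.subdivision D hD).faces.Finite := by
  classical
  have h : ∀ σ : Finset ℕ, σ ∈ e.faces → {τ | IsKuhn e.M D σ τ}.Finite := fun σ hσ => by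
    obtain ⟨S, hS, -⟩ := exists_finset_isKuhn e.M D (face_nonempty hσ)
    exact S.finite_toSet.subset fun τ hτ => hS τ hτ
  refine ((e.faces_finite.biUnion h).image fun τ => τ.image (e.point D)).subset ?_
  rintro t ⟨σ, hσ, τ, hτ, rfl⟩
  exact ⟨τ, Set.mem_biUnion hσ hτ, rfl⟩

theorem degreeLE_subdivision {m A D : ℕ} (hD : 0 < D) (hm : DimLE X m) (hA : DegreeLE X A) :
    DegreeLE (e.subdivision D hD) (A * 2 ^ 5 ^ (m + 1)) := by
  classical
  rintro x ⟨σ, hσ, τ, hτ, hx⟩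
  obtain ⟨p, hp⟩ := hτ.nonempty
  have hpx : e.point D p = x := by
    have : e.point D p ∈ τ.image (e.point D) := Finset.mem_image_of_mem _ hp
    rw [hx] at this
    simpa using this
  obtain ⟨S, hS, hSc⟩ := exists_finset_isKuhn_mem_face (e := e) hD hm hA p
  have hsub : {s ∈ (e.subdivision D hD).faces | x ∈ s} ⊆
      ((S.image fun τ => τ.image (e.point D) : Finset (Finset E)) : Set (Finset E)) := by
    rintro s ⟨⟨σ', hσ', τ', hτ', rfl⟩, hxs⟩
    obtain ⟨q, hq, hqx⟩ := Finset.mem_image.1 hxs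
    obtain rfl := point_injective hD (hτ'.isPath q hq) (hτ.isPath p hp) hσ' hσ
      (hτ'.steps_subset q hq) (hτ.steps_subset p hp) (hqx.trans hpx.symm)
    exact Finset.mem_coe.2 (Finset.mem_image_of_mem _ (hS σ' hσ' τ' hτ' hq))
  refine (Set.encard_le_encard hsub).trans ?_
  rw [Set.encard_coe_eq_coe_finsetCard]
  exact_mod_cast Finset.card_image_le.trans hSc

open Classical in
/-- A lattice point which lies in a face geometrically is carried by that face. -/
theorem steps_subset_of_point_mem {D : ℕ} (hD : 0 < D) {σ σ' : Finset ℕ} (hσ : σ ∈ e.faces)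
    (hσ' : σ' ∈ e.faces) {p : ℕ → ℤ} (hp : IsPath e.M (D : ℤ) p) (hs : steps e.M p ⊆ σ')
    (hmem : e.point D p ∈ convexHull ℝ ((σ.image e.v : Finset E) : Set E)) :
    steps e.M p ⊆ σ := by
  obtain ⟨Y, hY, hYσ, hYp⟩ := exists_path hD hσ hmem
  have := path_unique (e := e) (D := (D : ℝ)) (by exact_mod_cast hD) hY (by simpa using hp.cast)
    hσ hσ' hYσ (by rw [steps_cast]; exact hs) hYp
  rw [← steps_cast, ← this]
  exact hYσ

open Classical in
theorem ncard_pieces_le {D : ℕ} (hD : 0 < D) {σ : Finset ℕ} (hσ : σ ∈ e.faces) :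
    (pieces (e.subdivision D hD) (σ.image e.v)).ncard ≤
      (D + 1) ^ (σ.card - 1) * 2 ^ 5 ^ σ.card := by
  obtain ⟨S, hS, hSc⟩ := exists_finset_isKuhn e.M D (face_nonempty hσ)
  have hsub : pieces (e.subdivision D hD) (σ.image e.v) ⊆
      ((S.image fun τ => τ.image (e.point D) : Finset (Finset E)) : Set (Finset E)) := by
    rintro t ⟨⟨σ', hσ', τ, hτ, rfl⟩, -, hsub⟩
    refine Finset.mem_coe.2 (Finset.mem_image_of_mem _ (hS τ ⟨hτ.nonempty, hτ.isPath, hτ.chain,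
      fun p hp => ?_⟩))
    exact steps_subset_of_point_mem hD hσ hσ' (hτ.isPath p hp) (hτ.steps_subset p hp)
      (hsub (subset_convexHull ℝ _ (Finset.mem_coe.2 (Finset.mem_image_of_mem _ hp))))
  refine (Set.ncard_le_ncard hsub (Finset.finite_toSet _)).trans ?_
  rw [Set.ncard_coe_finset]
  exact Finset.card_image_le.trans hSc

open Classical in
theorem le_ncard_pieces {D k : ℕ} (hD : 0 < D) (hk : 0 < k) {σ : Finset ℕ} (hσ : σ ∈ e.faces)
    (hkD : k * σ.card ≤ D) :
    k ^ (σ.card - 1) ≤ (pieces (e.subdivision D hD) (σ.image e.v)).ncard := by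
  obtain ⟨i₀, hi₀⟩ := face_nonempty hσ
  obtain ⟨b, hbinj, hb⟩ := exists_injective_paths (M := e.M) (D := D - 1) hk hσ.1 hi₀ (by omega)
  have hK : ∀ a, IsKuhn e.M D σ (σ.image (raise (b a))) := fun a =>
    isKuhn_image_raise hD hσ.1 ⟨i₀, hi₀⟩ (hb a).1 (hb a).2
  set f : (↥(σ.erase i₀) → Fin k) → Finset E := fun a =>
    (σ.image (raise (b a))).image (e.point D) with hf
  have hfinj : Function.Injective f := by
    intro a a' h
    refine hbinj (image_raise_injective ⟨i₀, hi₀⟩ ?_)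
    have hsub : ∀ {a a'}, f a = f a' → σ.image (raise (b a)) ⊆ σ.image (raise (b a')) := by
      intro a a' h p hp
      have : e.point D p ∈ f a' := by rw [← h]; exact Finset.mem_image_of_mem _ hp
      obtain ⟨q, hq, hqp⟩ := Finset.mem_image.1 this
      obtain rfl := point_injective hD ((hK a').isPath q hq) ((hK a).isPath p hp) hσ hσ
        ((hK a').steps_subset q hq) ((hK a).steps_subset p hp) hqp
      exact hq
    exact Finset.Subset.antisymm (hsub h) (hsub h.symm)
  have hmem : ∀ a, f a ∈ pieces (e.subdivision D hD) (σ.image e.v) := by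
    intro a
    refine ⟨⟨σ, hσ, _, hK a, rfl⟩, ?_, convexHull_image_point_subset hD hσ (hK a)⟩
    rw [hf, Finset.card_image_of_injOn (injOn_point hD hσ (hK a)),
      Finset.card_image_of_injective _ (raise_injective _), card_image hσ]
  have hcard := Set.ncard_le_ncard_of_injOn (s := Set.univ) f (fun a _ => hmem a)
    hfinj.injOn ((subdivision_faces_finite hD).subset fun t ht => ht.1)
  rw [Set.ncard_univ, Nat.card_eq_fintype_card] at hcard
  simpa [Finset.card_erase_of_mem hi₀] using hcard

end VertexEnum

/-! ### Packing and unit triangulations of Euclidean space -/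

theorem encard_le_of_forall_finset {α : Type*} {A : Set α} {N : ℕ}
    (h : ∀ S : Finset α, (S : Set α) ⊆ A → S.card ≤ N) : A.encard ≤ N := by
  by_contra! hcon
  obtain ⟨t, ht, hc⟩ := Set.exists_subset_encard_eq (k := ((N + 1 : ℕ) : ℕ∞)) (s := A)
    (by push_cast; exact Order.add_one_le_of_lt hcon)
  have hfin : t.Finite := Set.finite_of_encard_eq_coe hc
  have := h hfin.toFinset (by simpa using ht)
  rw [hfin.encard_eq_coe_toFinset_card] at hc
  have hc' : hfin.toFinset.card = N + 1 := by exact_mod_cast hc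
  omega

/-- A ball contains boundedly many points at mutual distances at least `c`. -/
theorem exists_packing_bound (n : ℕ) (ρ : ℝ) {c : ℝ} (hc : 0 < c) :
    ∃ N : ℕ, ∀ {α : Type*} (S : Finset α) (f : α → EuclideanSpace ℝ (Fin n))
      (b : EuclideanSpace ℝ (Fin n)), (∀ x ∈ S, dist (f x) b ≤ ρ) →
      (∀ x ∈ S, ∀ y ∈ S, x ≠ y → c ≤ dist (f x) (f y)) → S.card ≤ N := by
  classical
  obtain ⟨t, ht, hcov⟩ := Metric.totallyBounded_iff.1
    (isCompact_closedBall (0 : EuclideanSpace ℝ (Fin n)) ρ).totallyBounded (c / 2) (half_pos hc)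
  refine ⟨ht.toFinset.card, fun S f b hb hsep => ?_⟩
  have hex : ∀ x ∈ S, ∃ y ∈ t, dist (f x - b) y < c / 2 := by
    intro x hx
    have : f x - b ∈ Metric.closedBall (0 : EuclideanSpace ℝ (Fin n)) ρ := by
      rw [mem_closedBall_zero_iff, ← dist_eq_norm]
      exact hb x hx
    have := hcov this
    simp only [Set.mem_iUnion, Metric.mem_ball, exists_prop] at this
    exact this
  choose! g hg using hex
  refine Finset.card_le_card_of_injOn g (fun x hx => ht.mem_toFinset.2 (hg x hx).1) ?_
  intro x hx y hy hxy
  by_contra hne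
  have h1 := (hg x hx).2
  have h2 := (hg y hy).2
  have h3 := hsep x hx y hy hne
  have h4 : dist (f x - b) (f y - b) < c := by
    calc _ ≤ dist (f x - b) (g x) + dist (f y - b) (g x) := dist_triangle_right _ _ _
      _ < c := by rw [hxy] at h1 ⊢; linarith
  rw [dist_sub_right] at h4
  linarith

theorem unitSimplexDist_nonneg {E : Type*} (s : Finset E) (w w' : E → ℝ) :
    0 ≤ unitSimplexDist s w w' := Real.sqrt_nonneg _

theorem unitSimplexDist_le_one {E : Type*} {s : Finset E} {w w' : E → ℝ}
    (hw : IsBarycentric s w) (hw' : IsBarycentric s w') : unitSimplexDist s w w' ≤ 1 := by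
  unfold unitSimplexDist
  rw [Real.sqrt_le_left zero_le_one, one_pow]
  have : ∑ v ∈ s, (w v - w' v) ^ 2 ≤ ∑ v ∈ s, (w v + w' v) := by
    refine Finset.sum_le_sum fun v hv => ?_
    have h1 : w v ≤ 1 := by
      rw [← hw.2]; exact Finset.single_le_sum hw.1 hv
    have h2 : w' v ≤ 1 := by
      rw [← hw'.2]; exact Finset.single_le_sum hw'.1 hv
    nlinarith [hw.1 v hv, hw'.1 v hv, mul_nonneg (hw.1 v hv) (hw'.1 v hv)]
  rw [Finset.sum_add_distrib, hw.2, hw'.2] at this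
  linarith

theorem BilipschitzOnSimplex.mono {E P : Type*} [AddCommGroup E] [Module ℝ E] [PseudoMetricSpace P]
    {L L' : ℝ} {f : E → P} {s : Finset E} (h : BilipschitzOnSimplex L f s) (hL : L ≤ L') :
    BilipschitzOnSimplex L' f s := fun w w' hw hw' =>
  ⟨(h w w' hw hw').1.trans (mul_le_mul_of_nonneg_right hL (unitSimplexDist_nonneg _ _ _)),
    (h w w' hw hw').2.trans (mul_le_mul_of_nonneg_right hL dist_nonneg)⟩

theorem BilipschitzOnSimplex.dist_le {E P : Type*} [AddCommGroup E] [Module ℝ E]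
    [PseudoMetricSpace P] {L : ℝ} (hL : 0 ≤ L) {f : E → P} {s : Finset E}
    (h : BilipschitzOnSimplex L f s) {x y : E} (hx : x ∈ convexHull ℝ (s : Set E))
    (hy : y ∈ convexHull ℝ (s : Set E)) : dist (f x) (f y) ≤ L := by
  obtain ⟨w, hw, rfl⟩ := isWeight_of_mem_convexHull hx
  obtain ⟨w', hw', rfl⟩ := isWeight_of_mem_convexHull hy
  have h1 : IsBarycentric s w := ⟨fun v _ => hw.nonneg v, hw.sum_eq_one⟩
  have h2 : IsBarycentric s w' := ⟨fun v _ => hw'.nonneg v, hw'.sum_eq_one⟩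
  exact (h w w' h1 h2).1.trans (mul_le_of_le_one_right hL (unitSimplexDist_le_one h1 h2))

/-- On a bilipschitz simplex in a normed space, linear combinations of the vertices of total zero
control their coefficients. -/
theorem BilipschitzOnSimplex.sqrt_sum_le {F : Type*} [NormedAddCommGroup F] [NormedSpace ℝ F]
    {L : ℝ} {s : Finset F} (hs : s.Nonempty) (hb : BilipschitzOnSimplex L id s) {h : F → ℝ}
    (h0 : ∑ v ∈ s, h v = 0) : √((∑ v ∈ s, h v ^ 2) / 2) ≤ L * ‖∑ v ∈ s, h v • v‖ := by
  have hc : (0 : ℝ) < s.card := by exact_mod_cast hs.card_pos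
  set S : ℝ := 1 + ∑ v ∈ s, |h v| with hS
  have hSpos : 0 < S := by
    have : 0 ≤ ∑ v ∈ s, |h v| := Finset.sum_nonneg fun v _ => abs_nonneg _
    linarith
  set t : ℝ := 1 / (s.card * S) with ht
  have htpos : 0 < t := by positivity
  have hbound : ∀ v ∈ s, |t * h v| ≤ 1 / s.card := by
    intro v hv
    have : |h v| ≤ S := by
      have := Finset.single_le_sum (f := fun v => |h v|) (fun v _ => abs_nonneg _) hv
      linarith
    rw [abs_mul, abs_of_pos htpos, ht]
    calc 1 / (s.card * S) * |h v| ≤ 1 / (s.card * S) * S := by gcongr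
      _ = 1 / s.card := by field_simp
  have hc1 : ∑ _v ∈ s, (1 / (s.card : ℝ)) = 1 := by
    rw [Finset.sum_const, nsmul_eq_mul]; field_simp
  have h1 : IsBarycentric s (fun _ => 1 / (s.card : ℝ)) := ⟨fun v _ => by positivity, hc1⟩
  have h2 : IsBarycentric s (fun v => 1 / (s.card : ℝ) + t * h v) := by
    refine ⟨fun v hv => ?_, ?_⟩
    · have := (abs_le.1 (hbound v hv)).1
      linarith
    · rw [Finset.sum_add_distrib, hc1, ← Finset.mul_sum, h0, mul_zero, add_zero]
  have key := (hb _ _ h2 h1).2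
  have e1 : unitSimplexDist s (fun v => 1 / (s.card : ℝ) + t * h v) (fun _ => 1 / (s.card : ℝ)) =
      t * √((∑ v ∈ s, h v ^ 2) / 2) := by
    unfold unitSimplexDist
    have : (∑ v ∈ s, (1 / (s.card : ℝ) + t * h v - 1 / s.card) ^ 2) / 2 =
        t ^ 2 * ((∑ v ∈ s, h v ^ 2) / 2) := by
      rw [mul_div_assoc', Finset.mul_sum]
      congr 1
      exact Finset.sum_congr rfl fun v _ => by ring
    rw [this, Real.sqrt_mul (by positivity), Real.sqrt_sq htpos.le]
  have e2 : dist (id (∑ v ∈ s, (1 / (s.card : ℝ) + t * h v) • v))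
      (id (∑ v ∈ s, (1 / (s.card : ℝ)) • v)) = t * ‖∑ v ∈ s, h v • v‖ := by
    rw [dist_eq_norm, id, id, ← Finset.sum_sub_distrib]
    have : ∑ v ∈ s, ((1 / (s.card : ℝ) + t * h v) • v - (1 / (s.card : ℝ)) • v) =
        t • ∑ v ∈ s, h v • v := by
      rw [Finset.smul_sum]
      exact Finset.sum_congr rfl fun v _ => by rw [add_smul, add_sub_cancel_left, mul_smul]
    rw [this, norm_smul, Real.norm_of_nonneg htpos.le]
  rw [e1, e2] at key
  have : t * √((∑ v ∈ s, h v ^ 2) / 2) ≤ t * (L * ‖∑ v ∈ s, h v • v‖) := by linarith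
  exact le_of_mul_le_mul_left this htpos

/-- The barycentre of a finite set of points. -/
noncomputable def bary {F : Type*} [AddCommGroup F] [Module ℝ F] (s : Finset F) : F :=
  ∑ v ∈ s, (1 / (s.card : ℝ)) • v

open Classical in
theorem isWeight_bary {F : Type*} {s : Finset F} (hs : s.Nonempty) :
    IsWeight s (fun v => if v ∈ s then 1 / (s.card : ℝ) else 0) := by
  have hc : (0 : ℝ) < s.card := by exact_mod_cast hs.card_pos
  refine ⟨fun v => ?_, fun v hv => by simp [hv], ?_⟩
  · split_ifs <;> positivity
  · rw [Finset.sum_congr rfl fun v hv => if_pos hv, Finset.sum_const, nsmul_eq_mul]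
    field_simp

open Classical in
theorem sum_weight_bary {F : Type*} [AddCommGroup F] [Module ℝ F] (s : Finset F) :
    ∑ v ∈ s, (if v ∈ s then 1 / (s.card : ℝ) else 0) • v = bary s :=
  Finset.sum_congr rfl fun v hv => by rw [if_pos hv]

theorem bary_mem_convexHull {F : Type*} [AddCommGroup F] [Module ℝ F] {s : Finset F}
    (hs : s.Nonempty) : bary s ∈ convexHull ℝ (s : Set F) := by
  classical
  rw [← sum_weight_bary]
  exact (isWeight_bary hs).sum_smul_mem_convexHull fun v hv => subset_convexHull ℝ _ hv

/-- In a triangulation by uniformly thick simplices, the barycentres of the top-dimensional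
simplices are uniformly separated: a ball of definite radius about the barycentre of a simplex lies
in its interior. -/
theorem eq_of_dist_bary_lt {n : ℕ} {L : ℝ} (hL : 1 ≤ L)
    {T : SimplicialComplex ℝ (EuclideanSpace ℝ (Fin n))} {s t : Finset (EuclideanSpace ℝ (Fin n))}
    (hs : s ∈ T.faces) (ht : t ∈ T.faces) (hsc : s.card = n + 1) (htc : t.card = n + 1)
    (hb : BilipschitzOnSimplex L id s)
    (hd : dist (bary s) (bary t) < 1 / (2 * L * (n + 1))) : s = t := by
  classical
  have hsne := SimplicialComplex.nonempty_of_mem_faces hs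
  have htne := SimplicialComplex.nonempty_of_mem_faces ht
  have hn : (0 : ℝ) < n + 1 := by positivity
  have hspan : affineSpan ℝ (Set.range ((↑) : s → EuclideanSpace ℝ (Fin n))) = ⊤ := by
    rw [(T.indep hs).affineSpan_eq_top_iff_card_eq_finrank_add_one]
    simp [hsc]
  have hmem : bary t ∈ affineSpan ℝ (Set.range ((↑) : s → EuclideanSpace ℝ (Fin n))) := by
    rw [hspan]; trivial
  obtain ⟨w, hw1, hw⟩ := eq_affineCombination_of_mem_affineSpan_of_fintype hmem
  rw [Finset.affineCombination_eq_linear_combination _ _ _ hw1] at hw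
  set u : EuclideanSpace ℝ (Fin n) → ℝ := fun v => if hv : v ∈ s then w ⟨v, hv⟩ else 0 with hu
  have hu1 : ∑ v ∈ s, u v = 1 := by
    rw [← hw1, ← Finset.sum_coe_sort s]
    exact Finset.sum_congr rfl fun v _ => by simp [hu]
  have hux : ∑ v ∈ s, u v • v = bary t := by
    rw [hw, ← Finset.sum_coe_sort s]
    exact Finset.sum_congr rfl fun v _ => by simp [hu]
  have hc : (s.card : ℝ) = n + 1 := by rw [hsc]; push_cast; ring
  have hkey := hb.sqrt_sum_le hsne (h := fun v => 1 / (s.card : ℝ) - u v) (by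
    rw [Finset.sum_sub_distrib, hu1, Finset.sum_const, nsmul_eq_mul, hc]
    field_simp
    ring)
  have hnorm : ∑ v ∈ s, (1 / (s.card : ℝ) - u v) • v = bary s - bary t := by
    simp only [sub_smul, Finset.sum_sub_distrib]
    rw [hux]
    rfl
  rw [hnorm, ← dist_eq_norm] at hkey
  have hpos : ∀ v ∈ s, 0 < u v := by
    intro v hv
    have h1 : (1 / (s.card : ℝ) - u v) ^ 2 ≤ ∑ v ∈ s, (1 / (s.card : ℝ) - u v) ^ 2 :=
      Finset.single_le_sum (f := fun v => (1 / (s.card : ℝ) - u v) ^ 2)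
        (fun v _ => sq_nonneg _) hv
    have h2 : L * dist (bary s) (bary t) < 1 / (2 * (n + 1)) := by
      calc L * dist (bary s) (bary t) < L * (1 / (2 * L * (n + 1))) := by gcongr
        _ = 1 / (2 * (n + 1)) := by field_simp
    have h3 := hkey.trans_lt h2
    rw [Real.sqrt_lt' (by positivity)] at h3
    have h4 : (1 / (s.card : ℝ) - u v) ^ 2 < (1 / (n + 1)) ^ 2 := by
      calc (1 / (s.card : ℝ) - u v) ^ 2 < 2 * (1 / (2 * (n + 1))) ^ 2 := by linarith
        _ ≤ (1 / ((n : ℝ) + 1)) ^ 2 := by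
          have e : (1 / (2 * ((n : ℝ) + 1))) = (1 / (n + 1)) / 2 := by field_simp
          rw [e]
          nlinarith [sq_nonneg (1 / ((n : ℝ) + 1))]
    have h5 := abs_lt_of_sq_lt_sq h4 (by positivity)
    rw [hc] at h5
    linarith [(abs_lt.1 h5).2]
  have hU : IsWeight s u := ⟨fun v => by
    by_cases hv : v ∈ s
    · exact (hpos v hv).le
    · simp [hu, hv], fun v hv => by simp [hu, hv], hu1⟩
  have := weights_unique hs ht hU (isWeight_bary htne) (hux.trans (sum_weight_bary t).symm)
  refine Finset.eq_of_subset_of_card_le (fun v hv => ?_) (by omega)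
  by_contra hvt
  have h1 := congr_fun this v
  rw [(isWeight_bary htne).eq_zero v hvt] at h1
  exact (hpos v hv).ne' h1

/-- A ball meets a bounded number of simplices of a unit triangulation. -/
theorem exists_meeting_bound (n : ℕ) (L ρ : ℝ) :
    ∃ N : ℕ, ∀ T : SimplicialComplex ℝ (EuclideanSpace ℝ (Fin n)), IsUnitTriangulation n L T →
      ∀ (b : EuclideanSpace ℝ (Fin n)) (S : Set (EuclideanSpace ℝ (Fin n))),
        S ⊆ Metric.closedBall b ρ → (meeting T S).encard ≤ N := by
  classical
  set K := max L 1 with hK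
  have hK1 : 1 ≤ K := le_max_right _ _
  have hcpos : (0 : ℝ) < 1 / (2 * K * (n + 1)) := by positivity
  obtain ⟨N, hN⟩ := exists_packing_bound n (ρ + K) hcpos
  refine ⟨N * 2 ^ (n + 1), fun T hT b S hS => ?_⟩
  set A : Set (Finset (EuclideanSpace ℝ (Fin n))) :=
    {t | t ∈ T.faces ∧ t.card = n + 1 ∧ dist (bary t) b ≤ ρ + K} with hA
  have hAcard : A.encard ≤ N := by
    refine encard_le_of_forall_finset fun F hF => hN F bary b (fun t ht => (hF ht).2.2) ?_
    intro s hs t ht hne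
    by_contra! hlt
    exact hne (eq_of_dist_bary_lt hK1 (hF hs).1 (hF ht).1 (hF hs).2.1 (hF ht).2.1
      ((hT.bilipschitz s (hF hs).1).mono (le_max_left _ _)) hlt)
  have hAfin : A.Finite := Set.finite_of_encard_le_coe hAcard
  have hsub : meeting T S ⊆ ((hAfin.toFinset.biUnion Finset.powerset :
      Finset (Finset (EuclideanSpace ℝ (Fin n)))) : Set (Finset (EuclideanSpace ℝ (Fin n)))) := by
    rintro s ⟨hs, y, hys, hyS⟩
    obtain ⟨t, ht, hst, htc⟩ := hT.pure s hs
    refine Finset.mem_coe.2 (Finset.mem_biUnion.2 ⟨t, hAfin.mem_toFinset.2 ⟨ht, htc, ?_⟩,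
      Finset.mem_powerset.2 hst⟩)
    have h1 : dist (bary t) y ≤ K :=
      ((hT.bilipschitz t ht).mono (le_max_left L 1)).dist_le (by linarith)
        (bary_mem_convexHull (SimplicialComplex.nonempty_of_mem_faces ht))
        (convexHull_mono (Finset.coe_subset.2 hst) hys)
    have h2 : dist y b ≤ ρ := hS hyS
    linarith [dist_triangle (bary t) y b]
  refine (Set.encard_le_encard hsub).trans ?_
  rw [Set.encard_coe_eq_coe_finsetCard]
  have h1 : (hAfin.toFinset.biUnion Finset.powerset).card ≤ hAfin.toFinset.card * 2 ^ (n + 1) :=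
    Finset.card_biUnion_le_card_mul _ _ _ fun t ht => by
      rw [Finset.card_powerset, (hAfin.mem_toFinset.1 ht).2.1]
  have h2 : hAfin.toFinset.card ≤ N := by
    rw [hAfin.encard_eq_coe_toFinset_card] at hAcard
    exact_mod_cast hAcard
  exact_mod_cast h1.trans (Nat.mul_le_mul_right _ h2)

/-- A simplex of a unit triangulation lies in a ball whose radius depends only on the bilipschitz
constant. -/
theorem IsUnitTriangulation.convexHull_subset_closedBall {n : ℕ} {L : ℝ}
    {T : SimplicialComplex ℝ (EuclideanSpace ℝ (Fin n))} (hT : IsUnitTriangulation n L T)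
    {t : Finset (EuclideanSpace ℝ (Fin n))} (ht : t ∈ T.faces) :
    ∃ b, convexHull ℝ (t : Set (EuclideanSpace ℝ (Fin n))) ⊆ Metric.closedBall b (max L 1) := by
  refine ⟨bary t, fun x hx => ?_⟩
  exact ((hT.bilipschitz t ht).mono (le_max_left L 1)).dist_le (by positivity) hx
    (bary_mem_convexHull (SimplicialComplex.nonempty_of_mem_faces ht))

/-! ### Random placement of points in a grid -/

/-- The point of Euclidean space with given natural coordinates below `k`. -/
noncomputable def gridPoint {n k : ℕ} (x : Fin n → Fin k) : EuclideanSpace ℝ (Fin n) :=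
  WithLp.toLp 2 fun j => ((x j : ℕ) : ℝ)

theorem norm_le_of_forall_abs_le {n : ℕ} {y : EuclideanSpace ℝ (Fin n)} {c : ℝ} (hc : 0 ≤ c)
    (h : ∀ j, |y j| ≤ c) : ‖y‖ ≤ n * c := by
  rw [EuclideanSpace.norm_eq, Real.sqrt_le_left (by positivity)]
  have h1 : ∑ j, ‖y j‖ ^ 2 ≤ ∑ _j : Fin n, c ^ 2 := Finset.sum_le_sum fun j _ => by
    rw [Real.norm_eq_abs]
    exact pow_le_pow_left₀ (abs_nonneg _) (h j) 2
  rw [Finset.sum_const, Finset.card_univ, Fintype.card_fin, nsmul_eq_mul] at h1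
  refine h1.trans ?_
  rw [mul_pow]
  refine mul_le_mul_of_nonneg_right ?_ (sq_nonneg c)
  rcases Nat.eq_zero_or_pos n with rfl | hn
  · simp
  · have : (1 : ℝ) ≤ n := by exact_mod_cast hn
    nlinarith

theorem abs_apply_le_norm {n : ℕ} (y : EuclideanSpace ℝ (Fin n)) (j : Fin n) : |y j| ≤ ‖y‖ := by
  rw [← Real.norm_eq_abs]
  exact PiLp.norm_apply_le y j

theorem norm_gridPoint_le {n k : ℕ} (x : Fin n → Fin k) : ‖gridPoint x‖ ≤ n * k :=
  norm_le_of_forall_abs_le (Nat.cast_nonneg k) fun j => by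
    simp only [gridPoint, Nat.abs_cast]
    exact_mod_cast (x j).2.le

theorem one_le_dist_gridPoint {n k : ℕ} {x y : Fin n → Fin k} (h : x ≠ y) :
    1 ≤ dist (gridPoint x) (gridPoint y) := by
  obtain ⟨j, hj⟩ := Function.ne_iff.1 h
  rw [dist_eq_norm]
  refine le_trans ?_ (abs_apply_le_norm _ j)
  have hne : ((x j : ℕ) : ℤ) - ((y j : ℕ) : ℤ) ≠ 0 := by
    intro h0
    exact hj (Fin.ext (by omega))
  have := Int.one_le_abs hne
  simp only [gridPoint, PiLp.sub_apply]
  exact_mod_cast this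

/-- The simplex spanned by the points `y a` meets the closed ball of radius `ρ` about `b`. -/
def Hits {n : ℕ} {α : Type*} (s : Finset α) (ρ : ℝ) (b : EuclideanSpace ℝ (Fin n))
    (y : α → EuclideanSpace ℝ (Fin n)) : Prop :=
  ∃ w : α → ℝ, IsWeight s w ∧ dist (∑ a ∈ s, w a • y a) b ≤ ρ

open Classical in
/-- If all vertices of a simplex but one are fixed, and the remaining one is chosen in the grid,
then at most `O(k ^ m)` choices make the simplex meet a given ball at a point where the barycentric
coordinate of the chosen vertex is not small. Indeed the position of this vertex is determined, up
to a bounded error, by the barycentric coordinates of such a point rounded to multiples of `1 / k`.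
The vertex `g i` may occur several times among the `g a`. -/
theorem exists_fiber_bound (n m : ℕ) (κ ρ : ℝ) :
    ∃ C : ℕ, ∀ (k : ℕ), 0 < k → ∀ {ι : Type} (g : Fin (m + 1) → ι)
      (z : Fin (m + 1) → EuclideanSpace ℝ (Fin n)), (∀ a, ‖z a‖ ≤ κ * k) →
      ∀ (b : EuclideanSpace ℝ (Fin n)) (f : ι → Fin n → Fin k) (i : Fin (m + 1)),
        (Finset.univ.filter fun x : Fin n → Fin k => ∃ w : Fin (m + 1) → ℝ,
          IsWeight Finset.univ w ∧ 1 / ((m : ℝ) + 1) ≤ w i ∧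
          dist (∑ a, w a • (z a + gridPoint (Function.update f (g i) x (g a)))) b ≤ ρ).card
        ≤ C * k ^ m := by
  obtain ⟨N, hN⟩ := exists_packing_bound n
    (((m : ℝ) + 1) * (2 * ρ + (m + 1) * ((m + 1) * (κ + n)))) one_pos
  refine ⟨N * 2 ^ m, fun k hk ι g z hz b f i => ?_⟩
  have hkR : (0 : ℝ) < k := by exact_mod_cast hk
  set A := Finset.univ.filter fun x : Fin n → Fin k => ∃ w : Fin (m + 1) → ℝ,
          IsWeight Finset.univ w ∧ 1 / ((m : ℝ) + 1) ≤ w i ∧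
          dist (∑ a, w a • (z a + gridPoint (Function.update f (g i) x (g a)))) b ≤ ρ with hA
  have hex : ∀ x : Fin n → Fin k, ∃ w : Fin (m + 1) → ℝ, x ∈ A →
      IsWeight Finset.univ w ∧ 1 / ((m : ℝ) + 1) ≤ w i ∧
          dist (∑ a, w a • (z a + gridPoint (Function.update f (g i) x (g a)))) b ≤ ρ := by
    intro x
    by_cases hx : x ∈ A
    · obtain ⟨w, hw⟩ := (Finset.mem_filter.1 hx).2
      exact ⟨w, fun _ => hw⟩
    · exact ⟨0, fun h => absurd h hx⟩
  choose w hw using hex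
  set φ : (Fin n → Fin k) → Fin m → ℕ := fun x a => ⌊(k : ℝ) * w x a.castSucc⌋₊ with hφ
  have hcard : A.card ≤ N * (Fintype.piFinset fun _ : Fin m => Finset.range (k + 1)).card := by
    refine Finset.card_le_mul_card_image_of_maps_to (f := φ) (fun x hx => ?_) N fun c _ => ?_
    · rw [Fintype.mem_piFinset]
      intro a
      rw [Finset.mem_range, Nat.lt_succ_iff, hφ]
      refine Nat.floor_le_of_le ?_
      exact mul_le_of_le_one_right hkR.le ((hw x hx).1.le_one _)
    · rcases (A.filter fun x => φ x = c).eq_empty_or_nonempty with h0 | ⟨x₀, hx₀⟩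
      · rw [h0]; simp
      obtain ⟨hx₀A, hx₀c⟩ := Finset.mem_filter.1 hx₀
      refine hN _ gridPoint (gridPoint x₀) (fun x hx => ?_) fun x _ y _ h =>
        one_le_dist_gridPoint h
      obtain ⟨hxA, hxc⟩ := Finset.mem_filter.1 hx
      obtain ⟨hw1, hw2, hw3⟩ := hw x hxA
      obtain ⟨hu1, hu2, hu3⟩ := hw x₀ hx₀A
      set u := w x₀
      set v := w x
      have hsmall : ∀ a : Fin m, |v a.castSucc - u a.castSucc| ≤ 1 / k := by
        intro a
        have h1 : ⌊(k : ℝ) * v a.castSucc⌋₊ = ⌊(k : ℝ) * u a.castSucc⌋₊ :=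
          congr_fun (hxc.trans hx₀c.symm) a
        have h2 := Nat.floor_le (mul_nonneg hkR.le (hw1.nonneg a.castSucc))
        have h3 := Nat.lt_floor_add_one ((k : ℝ) * v a.castSucc)
        have h4 := Nat.floor_le (mul_nonneg hkR.le (hu1.nonneg a.castSucc))
        have h5 := Nat.lt_floor_add_one ((k : ℝ) * u a.castSucc)
        rw [h1] at h2 h3
        have h6 : |v a.castSucc - u a.castSucc| * k = |(v a.castSucc - u a.castSucc) * k| := by
          rw [abs_mul, abs_of_pos hkR]
        rw [le_div_iff₀ hkR, h6, abs_le]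
        constructor <;> nlinarith
      have hdiff : ∀ a, |v a - u a| ≤ (m + 1) / k := by
        intro a
        refine Fin.lastCases ?_ (fun a => ?_) a
        · have h1 := hw1.sum_eq_one
          have h2 := hu1.sum_eq_one
          rw [Fin.sum_univ_castSucc] at h1 h2
          have h3 : v (Fin.last m) - u (Fin.last m) =
              -∑ a : Fin m, (v a.castSucc - u a.castSucc) := by
            rw [Finset.sum_sub_distrib]; linarith
          rw [h3, abs_neg]
          refine (Finset.abs_sum_le_sum_abs _ _).trans ((Finset.sum_le_sum fun a _ =>
            hsmall a).trans ?_)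
          rw [Finset.sum_const, Finset.card_univ, Fintype.card_fin, nsmul_eq_mul,
            mul_one_div]
          gcongr
          linarith
        · refine (hsmall a).trans ?_
          gcongr
          linarith [(Nat.cast_nonneg m : (0 : ℝ) ≤ m)]
      set c₀ := g i
      set W : ℝ := ∑ a with g a = c₀, v a with hW
      have hWge : 1 / ((m : ℝ) + 1) ≤ W := hw2.trans
        (Finset.single_le_sum (f := v) (fun a _ => hw1.nonneg a)
          (Finset.mem_filter.2 ⟨Finset.mem_univ i, rfl⟩))
      set y := fun a => z a + gridPoint (Function.update f c₀ x (g a)) with hy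
      set y₀ := fun a => z a + gridPoint (Function.update f c₀ x₀ (g a)) with hy₀
      have hyy : ∀ a, y a - y₀ a = if g a = c₀ then gridPoint x - gridPoint x₀ else 0 := by
        intro a
        simp only [hy, hy₀, add_sub_add_left_eq_sub]
        split_ifs with h
        · rw [h, Function.update_self, Function.update_self]
        · rw [Function.update_of_ne h, Function.update_of_ne h, sub_self]
      have hmain : W • (gridPoint x - gridPoint x₀) =
          (∑ a, v a • y a - ∑ a, u a • y₀ a) - ∑ a, (v a - u a) • y₀ a := by
        rw [hW, Finset.sum_smul, Finset.sum_filter, ← Finset.sum_sub_distrib,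
          ← Finset.sum_sub_distrib]
        refine Finset.sum_congr rfl fun a _ => ?_
        have : v a • y a - u a • y₀ a - (v a - u a) • y₀ a = v a • (y a - y₀ a) := by
          rw [sub_smul, smul_sub]; abel
        rw [this, hyy]
        split_ifs <;> simp
      have hb1 : ‖∑ a, v a • y a - ∑ a, u a • y₀ a‖ ≤ 2 * ρ := by
        rw [← dist_eq_norm]
        calc _ ≤ dist (∑ a, v a • y a) b + dist (∑ a, u a • y₀ a) b := dist_triangle_right _ _ _
          _ ≤ 2 * ρ := by linarith
      have hb2 : ‖∑ a, (v a - u a) • y₀ a‖ ≤ (m + 1) * ((m + 1) * (κ + n)) := by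
        calc ‖∑ a, (v a - u a) • y₀ a‖ ≤ ∑ a : Fin (m + 1), (m + 1) / k * ((κ + n) * k) := by
              refine (norm_sum_le _ _).trans (Finset.sum_le_sum fun a _ => ?_)
              rw [norm_smul, Real.norm_eq_abs]
              refine mul_le_mul (hdiff a) ?_ (norm_nonneg _) (by positivity)
              refine (norm_add_le _ _).trans ?_
              rw [add_mul]
              exact add_le_add (hz a) (norm_gridPoint_le _)
          _ = (m + 1) * ((m + 1) * (κ + n)) := by
              rw [Finset.sum_const, Finset.card_univ, Fintype.card_fin, nsmul_eq_mul]
              push_cast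
              field_simp
      have hb3 : W * ‖gridPoint x - gridPoint x₀‖ ≤
          2 * ρ + (m + 1) * ((m + 1) * (κ + n)) := by
        have hW0 : 0 ≤ W := le_trans (by positivity) hWge
        rw [← abs_of_nonneg hW0, ← Real.norm_eq_abs, ← norm_smul, hmain]
        exact (norm_sub_le _ _).trans (add_le_add hb1 hb2)
      rw [dist_eq_norm]
      have hm1 : (0 : ℝ) < m + 1 := by positivity
      calc ‖gridPoint x - gridPoint x₀‖
          = (m + 1) * (1 / ((m : ℝ) + 1) * ‖gridPoint x - gridPoint x₀‖) := by field_simp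
        _ ≤ (m + 1) * (W * ‖gridPoint x - gridPoint x₀‖) := by gcongr
        _ ≤ _ := by gcongr
  refine hcard.trans ?_
  rw [Fintype.card_piFinset]
  simp only [Finset.card_range, Finset.prod_const, Finset.card_univ, Fintype.card_fin]
  rw [mul_assoc, ← mul_pow]
  exact Nat.mul_le_mul_left _ (Nat.pow_le_pow_left (by omega) m)

open Classical in
/-- Averaging over one coordinate: an event which has at most `K` favourable values of the
coordinate `c` for any values of the other coordinates has conditional probability at most `K / card
G` given an event that does not depend on the coordinate `c`. -/
theorem card_filter_and_mul_card_le {ι G : Type*} [Fintype ι] [Fintype G] (c : ι)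
    {P Q : (ι → G) → Prop} (hP : ∀ f x, P (Function.update f c x) ↔ P f) {K : ℕ}
    (hQ : ∀ f, (Finset.univ.filter fun x => Q (Function.update f c x)).card ≤ K) :
    (Finset.univ.filter fun f => P f ∧ Q f).card * Fintype.card G ≤
      K * (Finset.univ.filter P).card := by
  have hinv : Function.Involutive fun y : (ι → G) × G => (Function.update y.1 c y.2, y.1 c) := by
    rintro ⟨f, x⟩
    simp
  have hswap : ∀ F : (ι → G) → ℕ, ∑ f, ∑ x, F (Function.update f c x) =
      (∑ f, F f) * Fintype.card G := by
    intro F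
    rw [← Fintype.sum_prod_type', ← Equiv.sum_comp (hinv.toPerm _)]
    simp only [Function.Involutive.coe_toPerm, Function.update_idem, Function.update_eq_self]
    rw [Fintype.sum_prod_type, Finset.sum_mul]
    refine Finset.sum_congr rfl fun f _ => ?_
    simp [mul_comm]
  have h := hswap fun f => if P f ∧ Q f then 1 else 0
  rw [← Finset.card_filter] at h
  rw [← h, Finset.card_filter P, Finset.mul_sum]
  refine Finset.sum_le_sum fun f _ => ?_
  by_cases hf : P f
  · simp only [hP, hf, true_and, if_true, mul_one]
    rw [← Finset.card_filter]
    exact hQ f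
  · simp [hP, hf]

open Classical in
/-- In a random placement in the grid, the probability that all members of a family of pairwise
disjoint simplices meet a given ball decays like a power with exponent the size of the family. -/
theorem exists_placement_count (n m : ℕ) (κ ρ : ℝ) :
    ∃ C : ℕ, ∀ (k : ℕ), 0 < k → ∀ {ι J : Type} [Fintype ι] (g : J → Fin (m + 1) → ι)
      (z : J → Fin (m + 1) → EuclideanSpace ℝ (Fin n)), (∀ j a, ‖z j a‖ ≤ κ * k) →
      ∀ (b : EuclideanSpace ℝ (Fin n)) (S : Finset J),
        (∀ j ∈ S, ∀ j' ∈ S, j ≠ j' → ∀ a a', g j a ≠ g j' a') →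
        (Finset.univ.filter fun f : ι → Fin n → Fin k => ∀ j ∈ S,
          Hits Finset.univ ρ b fun a => z j a + gridPoint (f (g j a))).card * (k ^ n) ^ S.card ≤
        (C * k ^ m) ^ S.card * (k ^ n) ^ Fintype.card ι := by
  obtain ⟨C, hC⟩ := exists_fiber_bound n m κ ρ
  refine ⟨(m + 1) * C, fun k hk ι J _ g z hz b S => ?_⟩
  induction S using Finset.induction_on with
  | empty => intro _; simp
  | insert j S hjS ih =>
    intro hdis
    have ih' := ih fun j₁ h₁ j₂ h₂ => hdis j₁ (Finset.mem_insert_of_mem h₁) j₂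
      (Finset.mem_insert_of_mem h₂)
    set P : (ι → Fin n → Fin k) → Prop := fun f => ∀ j ∈ S,
      Hits Finset.univ ρ b fun a => z j a + gridPoint (f (g j a)) with hPdef
    set Q : Fin (m + 1) → (ι → Fin n → Fin k) → Prop := fun i f => ∃ w : Fin (m + 1) → ℝ,
      IsWeight Finset.univ w ∧ 1 / ((m : ℝ) + 1) ≤ w i ∧
      dist (∑ a, w a • (z j a + gridPoint (f (g j a)))) b ≤ ρ with hQdef
    have hstep : ∀ i, (Finset.univ.filter fun f => P f ∧ Q i f).card * k ^ n ≤
        C * k ^ m * (Finset.univ.filter P).card := by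
      intro i
      have := card_filter_and_mul_card_le (g j i) (P := P) (Q := Q i) (K := C * k ^ m)
        (fun f x => by
          have : ∀ j' ∈ S, ∀ a, Function.update f (g j i) x (g j' a) = f (g j' a) := by
            intro j' hj' a
            refine Function.update_of_ne (hdis j' (Finset.mem_insert_of_mem hj') j
              (Finset.mem_insert_self _ _) ?_ a i) _ _
            rintro rfl
            exact hjS hj'
          refine forall₂_congr fun j' hj' => ?_
          simp only [this j' hj'])
        (fun f => hC k hk (g j) (z j) (hz j) b f i)
      rw [Fintype.card_fun, Fintype.card_fin, Fintype.card_fin] at this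
      convert this using 3 <;> (ext; simp only [Finset.mem_filter])
    have hsub : (Finset.univ.filter fun f : ι → Fin n → Fin k => ∀ j' ∈ insert j S,
          Hits Finset.univ ρ b fun a => z j' a + gridPoint (f (g j' a))) ⊆
        Finset.univ.biUnion fun i => Finset.univ.filter fun f => P f ∧ Q i f := by
      intro f hf
      have hf' := (Finset.mem_filter.1 hf).2
      obtain ⟨w, hw, hwd⟩ := hf' j (Finset.mem_insert_self _ _)
      have hbig : ∃ i, 1 / ((m : ℝ) + 1) ≤ w i := by
        by_contra! hcon
        have : ∑ a, w a < ∑ _a : Fin (m + 1), 1 / ((m : ℝ) + 1) :=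
          Finset.sum_lt_sum_of_nonempty Finset.univ_nonempty fun a _ => hcon a
        rw [hw.sum_eq_one, Finset.sum_const, Finset.card_univ, Fintype.card_fin,
          nsmul_eq_mul] at this
        push_cast at this
        rw [mul_one_div_cancel (by positivity)] at this
        exact lt_irrefl _ this
      obtain ⟨i, hi⟩ := hbig
      refine Finset.mem_biUnion.2 ⟨i, Finset.mem_univ _, Finset.mem_filter.2
        ⟨Finset.mem_univ _, fun j' hj' => hf' j' (Finset.mem_insert_of_mem hj'), w, hw, hi, hwd⟩⟩
    have hcount : (Finset.univ.filter fun f : ι → Fin n → Fin k => ∀ j' ∈ insert j S,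
          Hits Finset.univ ρ b fun a => z j' a + gridPoint (f (g j' a))).card * k ^ n ≤
        (m + 1) * C * k ^ m * (Finset.univ.filter P).card := by
      calc _ ≤ (∑ i : Fin (m + 1), (Finset.univ.filter fun f => P f ∧ Q i f).card) * k ^ n :=
            Nat.mul_le_mul_right _ ((Finset.card_le_card hsub).trans Finset.card_biUnion_le)
        _ ≤ ∑ _i : Fin (m + 1), C * k ^ m * (Finset.univ.filter P).card := by
            rw [Finset.sum_mul]
            exact Finset.sum_le_sum fun i _ => hstep i
        _ = _ := by
            rw [Finset.sum_const, Finset.card_univ, Fintype.card_fin, smul_eq_mul]; ring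
    rw [Finset.card_insert_of_notMem hjS, pow_succ, pow_succ]
    calc _ = ((Finset.univ.filter fun f : ι → Fin n → Fin k => ∀ j' ∈ insert j S,
          Hits Finset.univ ρ b fun a => z j' a + gridPoint (f (g j' a))).card * k ^ n) *
          (k ^ n) ^ S.card := by ring
      _ ≤ ((m + 1) * C * k ^ m * (Finset.univ.filter P).card) * (k ^ n) ^ S.card :=
          Nat.mul_le_mul_right _ hcount
      _ = ((m + 1) * C * k ^ m) * ((Finset.univ.filter P).card * (k ^ n) ^ S.card) := by ring
      _ ≤ ((m + 1) * C * k ^ m) * (((m + 1) * C * k ^ m) ^ S.card * (k ^ n) ^ Fintype.card ι) :=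
          Nat.mul_le_mul_left _ ih'
      _ = _ := by ring

/-- If the union bound allows it, the vertices can be placed in the grid so that no `l` pairwise
disjoint simplices of a given family meet a common ball of a given finite collection. -/
theorem exists_placement (n m : ℕ) (κ ρ : ℝ) :
    ∃ C : ℕ, ∀ (k : ℕ), 0 < k → ∀ {ι J : Type} [Fintype ι] [Fintype J] (g : J → Fin (m + 1) → ι)
      (z : J → Fin (m + 1) → EuclideanSpace ℝ (Fin n)), (∀ j a, ‖z j a‖ ≤ κ * k) →
      ∀ (B : Finset (EuclideanSpace ℝ (Fin n))) (l : ℕ),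
        B.card * (Fintype.card J).choose l * (C * k ^ m) ^ l < (k ^ n) ^ l →
        ∃ f : ι → Fin n → Fin k, ∀ b ∈ B, ∀ S : Finset J,
          (∀ j ∈ S, ∀ j' ∈ S, j ≠ j' → ∀ a a', g j a ≠ g j' a') →
          (∀ j ∈ S, Hits Finset.univ ρ b fun a => z j a + gridPoint (f (g j a))) → S.card < l := by
  classical
  obtain ⟨C, hC⟩ := exists_placement_count n m κ ρ
  refine ⟨C, fun k hk ι J _ _ g z hz B l hlt => ?_⟩
  by_contra! hcon
  set bad : EuclideanSpace ℝ (Fin n) × Finset J → Finset (ι → Fin n → Fin k) := fun y =>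
    Finset.univ.filter fun f => (∀ j ∈ y.2, ∀ j' ∈ y.2, j ≠ j' → ∀ a a', g j a ≠ g j' a') ∧
      ∀ j ∈ y.2, Hits Finset.univ ρ y.1 fun a => z j a + gridPoint (f (g j a)) with hbad
  have hcover : (Finset.univ : Finset (ι → Fin n → Fin k)) ⊆
      (B ×ˢ Finset.powersetCard l Finset.univ).biUnion bad := by
    intro f _
    obtain ⟨b, hb, S, hS1, hS2, hS3⟩ := hcon f
    obtain ⟨S', hS', hcard⟩ := Finset.exists_subset_card_eq hS3
    refine Finset.mem_biUnion.2 ⟨(b, S'), Finset.mem_product.2 ⟨hb, Finset.mem_powersetCard.2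
      ⟨Finset.subset_univ _, hcard⟩⟩, Finset.mem_filter.2 ⟨Finset.mem_univ _, ?_, ?_⟩⟩
    · exact fun j hj j' hj' => hS1 j (hS' hj) j' (hS' hj')
    · exact fun j hj => hS2 j (hS' hj)
  have hone : ∀ y ∈ B ×ˢ Finset.powersetCard l (Finset.univ : Finset J),
      (bad y).card * (k ^ n) ^ l ≤ (C * k ^ m) ^ l * (k ^ n) ^ Fintype.card ι := by
    rintro ⟨b, S⟩ hy
    obtain ⟨-, hS⟩ := Finset.mem_product.1 hy
    have hScard := (Finset.mem_powersetCard.1 hS).2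
    by_cases hdis : ∀ j ∈ S, ∀ j' ∈ S, j ≠ j' → ∀ a a', g j a ≠ g j' a'
    · have := hC k hk g z hz b S hdis
      rw [← hScard]
      refine le_trans (Nat.mul_le_mul_right _ (Finset.card_le_card fun f hf => ?_)) this
      simp only [Finset.mem_filter, Finset.mem_univ, true_and]
      exact (Finset.mem_filter.1 hf).2.2
    · have : bad (b, S) = ∅ := by
        rw [hbad, Finset.filter_eq_empty_iff]
        exact fun f _ h => hdis h.1
      rw [this]; simp
  have hfinal := Finset.card_le_card hcover
  rw [Finset.card_univ, Fintype.card_fun, Fintype.card_fun, Fintype.card_fin,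
    Fintype.card_fin] at hfinal
  have hpos : 0 < (k ^ n) ^ Fintype.card ι := by positivity
  have h1 : (k ^ n) ^ Fintype.card ι * (k ^ n) ^ l ≤
      B.card * (Fintype.card J).choose l * ((C * k ^ m) ^ l * (k ^ n) ^ Fintype.card ι) := by
    calc _ ≤ (∑ y ∈ B ×ˢ Finset.powersetCard l Finset.univ, (bad y).card) * (k ^ n) ^ l :=
          Nat.mul_le_mul_right _ (hfinal.trans Finset.card_biUnion_le)
      _ ≤ ∑ y ∈ B ×ˢ Finset.powersetCard l (Finset.univ : Finset J),
          (C * k ^ m) ^ l * (k ^ n) ^ Fintype.card ι := by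
          rw [Finset.sum_mul]
          exact Finset.sum_le_sum hone
      _ = _ := by
          rw [Finset.sum_const, Finset.card_product, Finset.card_powersetCard, Finset.card_univ,
            smul_eq_mul]
  have h2 : (k ^ n) ^ Fintype.card ι * (k ^ n) ^ l < (k ^ n) ^ Fintype.card ι * (k ^ n) ^ l := by
    calc _ ≤ _ := h1
      _ = (k ^ n) ^ Fintype.card ι * (B.card * (Fintype.card J).choose l * (C * k ^ m) ^ l) := by
          ring
      _ < _ := Nat.mul_lt_mul_of_pos_left hlt hpos
  exact lt_irrefl _ h2

/-! ### Colourings and disjoint families -/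

/-- Greedy colouring. -/
theorem exists_coloring {α : Type*} {adj : α → α → Prop} (hsymm : ∀ x y, adj x y → adj y x)
    {N : ℕ} (hN : 0 < N) (S : Finset α)
    (hdeg : ∀ x ∈ S, ∃ T : Finset α, T.card < N ∧ ∀ y ∈ S, adj x y → y ≠ x → y ∈ T) :
    ∃ c : α → Fin N, ∀ x ∈ S, ∀ y ∈ S, x ≠ y → adj x y → c x ≠ c y := by
  classical
  have key : ∀ S' ⊆ S, ∃ c : α → Fin N, ∀ x ∈ S', ∀ y ∈ S', x ≠ y → adj x y → c x ≠ c y := by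
    intro S'
    induction S' using Finset.induction_on with
    | empty => exact fun _ => ⟨fun _ => ⟨0, hN⟩, by simp⟩
    | insert a S' ha ih =>
      intro hsub
      obtain ⟨c, hc⟩ := ih ((Finset.subset_insert _ _).trans hsub)
      have haS := hsub (Finset.mem_insert_self _ _)
      obtain ⟨T, hTN, hT⟩ := hdeg a haS
      obtain ⟨k, hk⟩ : ∃ k : Fin N, k ∉ T.image c := by
        by_contra! hcon
        have h1 : (Finset.univ : Finset (Fin N)) ⊆ T.image c := fun k _ => hcon k
        have h2 := (Finset.card_le_card h1).trans Finset.card_image_le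
        rw [Finset.card_univ, Fintype.card_fin] at h2
        exact absurd hTN (not_lt.2 h2)
      have hk' : ∀ y ∈ S', adj a y → c y ≠ k := by
        rintro y hy hay rfl
        refine hk (Finset.mem_image_of_mem c (hT y (hsub (Finset.mem_insert_of_mem hy)) hay ?_))
        rintro rfl
        exact ha hy
      refine ⟨Function.update c a k, fun x hx y hy hne hadj => ?_⟩
      rcases Finset.mem_insert.1 hx with rfl | hx' <;> rcases Finset.mem_insert.1 hy with rfl | hy'
      · exact absurd rfl hne
      · rw [Function.update_self, Function.update_of_ne hne.symm]
        exact (hk' y hy' hadj).symm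
      · rw [Function.update_self, Function.update_of_ne hne]
        exact hk' x hx' (hsymm _ _ hadj)
      · have h1 : x ≠ a := by rintro rfl; exact ha hx'
        have h2 : y ≠ a := by rintro rfl; exact ha hy'
        rw [Function.update_of_ne h1, Function.update_of_ne h2]
        exact hc x hx' y hy' hne hadj
  exact key S Finset.Subset.rfl

/-- A family of small sets of bounded degree without large disjoint subfamilies is small. -/
theorem card_le_of_disjoint_lt {α : Type*} {F : Finset (Finset α)} {a d l : ℕ}
    (hne : ∀ s ∈ F, s.Nonempty) (ha : ∀ s ∈ F, s.card ≤ a)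
    (hd : ∀ x, ∃ T : Finset (Finset α), T.card ≤ d ∧ ∀ s ∈ F, x ∈ s → s ∈ T)
    (hl : ∀ G ⊆ F, (∀ s ∈ G, ∀ t ∈ G, s ≠ t → Disjoint s t) → G.card ≤ l) :
    F.card ≤ l * a * d := by
  classical
  choose T hTd hT using hd
  obtain ⟨G, hG, hmax⟩ := Finset.exists_max_image
    (F.powerset.filter fun G => ∀ s ∈ G, ∀ t ∈ G, s ≠ t → Disjoint s t) Finset.card
    ⟨∅, by simp⟩
  obtain ⟨hGF, hGd⟩ := Finset.mem_filter.1 hG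
  rw [Finset.mem_powerset] at hGF
  have hmeet : ∀ s ∈ F, ∃ x ∈ G.biUnion id, x ∈ s := by
    intro s hs
    by_contra! hcon
    have hdis : ∀ t ∈ G, Disjoint s t := fun t ht => Finset.disjoint_left.2 fun x hxs hxt =>
      hcon x (Finset.mem_biUnion.2 ⟨t, ht, hxt⟩) hxs
    have hsG : s ∉ G := fun h => by
      obtain ⟨x, hx⟩ := hne s hs
      exact Finset.disjoint_left.1 (hdis s h) hx hx
    have := hmax (insert s G) (Finset.mem_filter.2 ⟨Finset.mem_powerset.2
      (Finset.insert_subset hs hGF), fun t ht u hu htu => by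
        rcases Finset.mem_insert.1 ht with rfl | ht' <;>
          rcases Finset.mem_insert.1 hu with rfl | hu'
        · exact absurd rfl htu
        · exact hdis u hu'
        · exact (hdis t ht').symm
        · exact hGd t ht' u hu' htu⟩)
    rw [Finset.card_insert_of_notMem hsG] at this
    omega
  have hsub : F ⊆ (G.biUnion id).biUnion T := by
    intro s hs
    obtain ⟨x, hx, hxs⟩ := hmeet s hs
    exact Finset.mem_biUnion.2 ⟨x, hx, hT x s hs hxs⟩
  calc F.card ≤ (G.biUnion id).card * d :=
        (Finset.card_le_card hsub).trans (Finset.card_biUnion_le_card_mul _ _ _ fun x _ => hTd x)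
    _ ≤ (G.card * a) * d := Nat.mul_le_mul_right _
        (Finset.card_biUnion_le_card_mul _ _ _ fun s hs => ha s (hGF hs))
    _ ≤ l * a * d := Nat.mul_le_mul_right _ (Nat.mul_le_mul_right _ (hl G hGF hGd))

/-! ### Points in general position -/

/-- The point with parameter `x` on the moment curve. -/
noncomputable def momentPoint (n : ℕ) (x : ℝ) : EuclideanSpace ℝ (Fin n) :=
  WithLp.toLp 2 fun j => x ^ ((j : ℕ) + 1)

/-- Points on the moment curve are affinely independent: a relation of total zero annihilates all
polynomials of degree at most `n`, in particular the Lagrange basis. -/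
theorem momentPoint_independent {n : ℕ} {s : Finset ℕ} (hs : s.card ≤ n + 1) {h : ℕ → ℝ}
    (h0 : ∑ i ∈ s, h i = 0) (h1 : ∑ i ∈ s, h i • momentPoint n (i : ℝ) = 0) :
    ∀ i ∈ s, h i = 0 := by
  classical
  have hmom : ∀ d < n + 1, ∑ i ∈ s, h i * (i : ℝ) ^ d = 0 := by
    intro d hd
    rcases d with _ | d
    · simpa using h0
    · have := congr_arg (fun y : EuclideanSpace ℝ (Fin n) => y ⟨d, by omega⟩) h1
      simpa [momentPoint] using this
  have hpoly : ∀ P : Polynomial ℝ, P.natDegree < n + 1 → ∑ i ∈ s, h i * P.eval (i : ℝ) = 0 := by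
    intro P hP
    simp only [Polynomial.eval_eq_sum_range' hP, Finset.mul_sum]
    rw [Finset.sum_comm]
    refine Finset.sum_eq_zero fun d hd => ?_
    have : ∀ i ∈ s, h i * (P.coeff d * (i : ℝ) ^ d) = P.coeff d * (h i * (i : ℝ) ^ d) :=
      fun i _ => by ring
    rw [Finset.sum_congr rfl this, ← Finset.mul_sum, hmom d (Finset.mem_range.1 hd), mul_zero]
  intro i hi
  have hinj : Set.InjOn (fun i : ℕ => (i : ℝ)) (s : Set ℕ) := fun a _ b _ hab =>
    Nat.cast_injective hab
  have hdeg : (Lagrange.basis s (fun i : ℕ => (i : ℝ)) i).natDegree < n + 1 := by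
    have := Lagrange.degree_basis hinj hi
    rw [Polynomial.natDegree_eq_of_degree_eq_some this]
    have := Finset.card_pos.2 ⟨i, hi⟩
    omega
  have := hpoly _ hdeg
  rw [Finset.sum_eq_single i] at this
  · rw [Lagrange.eval_basis_self hinj hi, mul_one] at this
    exact this
  · intro j hj hji
    rw [Lagrange.eval_basis_of_ne hji.symm hj, mul_zero]
  · exact fun h => absurd hi h

/-- There are `N` points in Euclidean space, any `n + 1` of which are affinely independent, with a
uniform quantitative estimate. -/
theorem exists_general_position (n N : ℕ) :
    ∃ (q : ℕ → EuclideanSpace ℝ (Fin n)) (c : ℝ), 0 < c ∧ (∀ i < N, ‖q i‖ ≤ 1 / 4) ∧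
      ∀ s ⊆ Finset.range N, s.card ≤ n + 1 → ∀ h : ℕ → ℝ, ∑ i ∈ s, h i = 0 → ∀ i ∈ s,
        c * |h i| ≤ ‖∑ i ∈ s, h i • q i‖ := by
  classical
  have hanti : ∀ s : Finset ℕ, ∃ K : ℝ, 0 < K ∧ (s.card ≤ n + 1 → ∀ h : ℕ → ℝ,
      ∑ i ∈ s, h i = 0 → ∀ i ∈ s, |h i| ≤ K * ‖∑ i ∈ s, h i • momentPoint n (i : ℝ)‖) := by
    intro s
    by_cases hs : s.card ≤ n + 1
    · let Φ : (s → ℝ) →ₗ[ℝ] ℝ × EuclideanSpace ℝ (Fin n) :=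
        (Fintype.linearCombination ℝ fun _ : s => (1 : ℝ)).prod
          (Fintype.linearCombination ℝ fun i : s => momentPoint n ((i : ℕ) : ℝ))
      have hΦ : ∀ h : ℕ → ℝ, Φ (fun i => h i) =
          (∑ i ∈ s, h i, ∑ i ∈ s, h i • momentPoint n (i : ℝ)) := by
        intro h
        refine Prod.ext ?_ ?_
        · change Fintype.linearCombination ℝ (fun _ : s => (1 : ℝ)) (fun i => h i) = _
          simp only [Fintype.linearCombination_apply, smul_eq_mul, mul_one]
          exact Finset.sum_coe_sort s h
        · change Fintype.linearCombination ℝ (fun i : s => momentPoint n ((i : ℕ) : ℝ))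
            (fun i => h i) = _
          rw [Fintype.linearCombination_apply]
          exact Finset.sum_coe_sort s fun i => h i • momentPoint n (i : ℝ)
      have hext : ∀ g : s → ℝ, ∃ h : ℕ → ℝ, g = fun i : s => h i := fun g =>
        ⟨fun i => if hi : i ∈ s then g ⟨i, hi⟩ else 0, by funext i; simp⟩
      have hker : LinearMap.ker Φ = ⊥ := by
        rw [LinearMap.ker_eq_bot']
        intro g hg
        obtain ⟨h, rfl⟩ := hext g
        rw [hΦ, Prod.mk_eq_zero] at hg
        funext i
        exact momentPoint_independent hs hg.1 hg.2 i i.2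
      obtain ⟨K, hK, hanti⟩ := Φ.exists_antilipschitzWith hker
      refine ⟨K, by exact_mod_cast hK, fun _ h h0 i hi => ?_⟩
      have h1 := hanti.le_mul_norm (map_zero Φ) (fun i : s => h i)
      rw [hΦ, h0] at h1
      have h2 := norm_le_pi_norm (fun i : s => h i) ⟨i, hi⟩
      rw [Real.norm_eq_abs] at h2
      refine h2.trans (h1.trans ?_)
      rw [Prod.norm_mk, norm_zero, max_eq_right (norm_nonneg _)]
    · exact ⟨1, one_pos, fun h => absurd h hs⟩
  choose K hK0 hK using hanti
  set Kt : ℝ := 1 + ∑ s ∈ (Finset.range N).powerset, K s with hKt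
  have hKle : ∀ s ⊆ Finset.range N, K s ≤ Kt := by
    intro s hs
    have := Finset.single_le_sum (f := K) (fun s _ => (hK0 s).le) (Finset.mem_powerset.2 hs)
    linarith
  have hKtpos : 0 < Kt := by
    have := Finset.sum_nonneg fun s (_ : s ∈ (Finset.range N).powerset) => (hK0 s).le
    linarith
  set P : ℝ := 1 + ∑ i ∈ Finset.range N, ‖momentPoint n (i : ℝ)‖ with hP
  have hPpos : 0 < P := by
    have := Finset.sum_nonneg fun i (_ : i ∈ Finset.range N) => norm_nonneg (momentPoint n (i : ℝ))
    linarith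
  refine ⟨fun i => (1 / (4 * P)) • momentPoint n (i : ℝ), 1 / (4 * P) / Kt, by positivity,
    fun i hi => ?_, fun s hs hsc h h0 i hi => ?_⟩
  · rw [norm_smul, Real.norm_of_nonneg (by positivity)]
    have := Finset.single_le_sum (f := fun i : ℕ => ‖momentPoint n (i : ℝ)‖)
      (fun i _ => norm_nonneg _) (Finset.mem_range.2 hi)
    calc 1 / (4 * P) * ‖momentPoint n (i : ℝ)‖ ≤ 1 / (4 * P) * P := by
          gcongr; linarith
      _ = 1 / 4 := by field_simp
  · have h1 : ∑ i ∈ s, h i • (1 / (4 * P)) • momentPoint n (i : ℝ) =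
        (1 / (4 * P)) • ∑ i ∈ s, h i • momentPoint n (i : ℝ) := by
      rw [Finset.smul_sum]
      exact Finset.sum_congr rfl fun i _ => smul_comm _ _ _
    rw [h1, norm_smul, Real.norm_of_nonneg (by positivity)]
    have h2 := hK s hsc h h0 i hi
    have h3 : |h i| ≤ Kt * ‖∑ i ∈ s, h i • momentPoint n (i : ℝ)‖ :=
      h2.trans (mul_le_mul_of_nonneg_right (hKle s hs) (norm_nonneg _))
    rw [div_mul_eq_mul_div, div_le_iff₀ hKtpos]
    calc 1 / (4 * P) * |h i| ≤ 1 / (4 * P) * (Kt * ‖∑ i ∈ s, h i • momentPoint n (i : ℝ)‖) := by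
          gcongr
      _ = _ := by ring

/-- Coefficient bounds for combinations of total zero of points in general position, indexed
injectively. -/
theorem general_position_comp {n N : ℕ} {q : ℕ → EuclideanSpace ℝ (Fin n)} {c : ℝ}
    (hq : ∀ s ⊆ Finset.range N, s.card ≤ n + 1 → ∀ h : ℕ → ℝ, ∑ i ∈ s, h i = 0 → ∀ i ∈ s,
        c * |h i| ≤ ‖∑ i ∈ s, h i • q i‖) {σ : Finset ℕ} (hσ : σ.card ≤ n + 1) {col : ℕ → ℕ}
    (hinj : Set.InjOn col (σ : Set ℕ)) (hcol : ∀ i ∈ σ, col i < N) {h : ℕ → ℝ}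
    (h0 : ∑ i ∈ σ, h i = 0) : ∀ i ∈ σ, c * |h i| ≤ ‖∑ i ∈ σ, h i • q (col i)‖ := by
  classical
  intro i₀ hi₀
  set h' : ℕ → ℝ := fun j => h (Function.invFunOn col (σ : Set ℕ) j) with hh'
  have hinv : ∀ i ∈ σ, h' (col i) = h i := fun i hi => by
    simp only [hh']
    rw [hinj.leftInvOn_invFunOn hi]
  have h1 := hq (σ.image col) (fun j hj => by
      obtain ⟨i, hi, rfl⟩ := Finset.mem_image.1 hj
      exact Finset.mem_range.2 (hcol i hi)) (Finset.card_image_le.trans hσ) h' (by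
      rw [Finset.sum_image hinj, Finset.sum_congr rfl hinv, h0]) (col i₀)
      (Finset.mem_image_of_mem _ hi₀)
  rwa [Finset.sum_image hinj, hinv i₀ hi₀,
    Finset.sum_congr rfl fun i hi => by rw [hinv i hi]] at h1

/-- A lower bound for the coefficients of linear combinations survives small perturbations of the
points. -/
theorem coeff_bound_of_perturbation {F α : Type*} [NormedAddCommGroup F] [NormedSpace ℝ F]
    {s : Finset α} {N : ℕ} (hN : s.card ≤ N) {y y' : α → F} {c η : ℝ} (hη : N * η ≤ c)
    (hy : ∀ i ∈ s, ‖y' i - y i‖ ≤ η) {h : α → ℝ}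
    (hc : ∀ i ∈ s, c * |h i| ≤ ‖∑ i ∈ s, h i • y i‖) :
    ∀ i ∈ s, (c - N * η) * |h i| ≤ ‖∑ i ∈ s, h i • y' i‖ := by
  intro i hi
  obtain ⟨i₀, hi₀, hmax⟩ := s.exists_max_image (fun i => |h i|) ⟨i, hi⟩
  have hη0 : 0 ≤ η := (norm_nonneg _).trans (hy i hi)
  have herr : ‖∑ i ∈ s, h i • (y' i - y i)‖ ≤ N * η * |h i₀| := by
    refine (norm_sum_le _ _).trans ?_
    have : ∀ i ∈ s, ‖h i • (y' i - y i)‖ ≤ |h i₀| * η := fun i hi => by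
      rw [norm_smul, Real.norm_eq_abs]
      exact mul_le_mul (hmax i hi) (hy i hi) (norm_nonneg _) (abs_nonneg _)
    refine (Finset.sum_le_sum this).trans ?_
    rw [Finset.sum_const, nsmul_eq_mul]
    have h1 : (s.card : ℝ) ≤ N := by exact_mod_cast hN
    calc (s.card : ℝ) * (|h i₀| * η) ≤ N * (|h i₀| * η) := by gcongr
      _ = N * η * |h i₀| := by ring
  have hsplit : ∑ i ∈ s, h i • y i = ∑ i ∈ s, h i • y' i - ∑ i ∈ s, h i • (y' i - y i) := by
    rw [← Finset.sum_sub_distrib]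
    exact Finset.sum_congr rfl fun i _ => by rw [← smul_sub, sub_sub_cancel]
  have h1 := hc i₀ hi₀
  rw [hsplit] at h1
  have h2 := norm_sub_le (∑ i ∈ s, h i • y' i) (∑ i ∈ s, h i • (y' i - y i))
  calc (c - N * η) * |h i| ≤ (c - N * η) * |h i₀| :=
        mul_le_mul_of_nonneg_left (hmax i hi) (by linarith)
    _ ≤ ‖∑ i ∈ s, h i • y' i‖ := by linarith

/-! ### Placing the vertices at the large scale -/

/-- The lattice point with given integer coordinates. -/
noncomputable def latticePoint {n : ℕ} (z : Fin n → ℤ) : EuclideanSpace ℝ (Fin n) :=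
  WithLp.toLp 2 fun j => (z j : ℝ)

theorem dist_latticePoint_floor_le {n : ℕ} (b : EuclideanSpace ℝ (Fin n)) :
    dist b (latticePoint fun j => ⌊b j⌋) ≤ n := by
  rw [dist_eq_norm]
  have := norm_le_of_forall_abs_le (y := b - latticePoint fun j => ⌊b j⌋) zero_le_one fun j => by
    simp only [latticePoint, PiLp.sub_apply]
    rw [abs_le]
    constructor <;> linarith [Int.floor_le (b j), Int.lt_floor_add_one (b j)]
  simpa using this

theorem exists_surjective_tuple {α : Type*} {s : Finset α} {m : ℕ} (hne : s.Nonempty)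
    (hc : s.card ≤ m + 1) :
    ∃ t : Fin (m + 1) → α, (∀ a, t a ∈ s) ∧ ∀ x ∈ s, ∃ a, t a = x := by
  obtain ⟨x₀, hx₀⟩ := hne
  refine ⟨fun a => if h : (a : ℕ) < s.card then s.equivFin.symm ⟨a, h⟩ else x₀, fun a => ?_,
    fun x hx => ?_⟩
  · dsimp only
    split_ifs
    · exact Subtype.prop _
    · exact hx₀
  · refine ⟨⟨s.equivFin ⟨x, hx⟩, (s.equivFin ⟨x, hx⟩).2.trans_le hc⟩, ?_⟩
    simp

/-- The vertices of a simplex may be listed by a tuple with repetitions. -/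
theorem Hits.comp_tuple {n m : ℕ} {α : Type*} {s : Finset α} {ρ : ℝ}
    {b : EuclideanSpace ℝ (Fin n)} {y : α → EuclideanSpace ℝ (Fin n)} (h : Hits s ρ b y)
    {t : Fin (m + 1) → α} (ht : ∀ a, t a ∈ s) (hsurj : ∀ x ∈ s, ∃ a, t a = x) :
    Hits Finset.univ ρ b (fun a => y (t a)) := by
  classical
  obtain ⟨w, hw, hd⟩ := h
  choose! r hr using hsurj
  have hsum : ∀ {β : Type} [AddCommMonoid β] (F : Fin (m + 1) → β),
      (∀ a, ¬ r (t a) = a → F a = 0) → ∑ a, F a = ∑ x ∈ s, F (r x) := by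
    intro β _ F hF
    have hinj : Set.InjOn r (s : Set α) := fun x hx y hy hxy => by
      rw [← hr x hx, ← hr y hy, hxy]
    rw [← Finset.sum_image hinj]
    refine (Finset.sum_subset (Finset.subset_univ _) fun a _ ha => hF a fun h => ha ?_).symm
    exact Finset.mem_image.2 ⟨t a, ht a, h⟩
  have hval : ∀ x ∈ s, (if r (t (r x)) = r x then w (t (r x)) else 0) = w x := fun x hx => by
    rw [hr x hx, if_pos rfl]
  refine ⟨fun a => if r (t a) = a then w (t a) else 0, ⟨fun a => ?_, by simp, ?_⟩, ?_⟩
  · split_ifs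
    · exact hw.nonneg _
    · exact le_rfl
  · rw [hsum _ fun a ha => if_neg ha, ← hw.sum_eq_one]
    exact Finset.sum_congr rfl hval
  · rw [hsum (fun a => (if r (t a) = a then w (t a) else 0) • y (t a)) fun a ha => by
        rw [if_neg ha, zero_smul],
      Finset.sum_congr rfl fun x hx => by rw [hval x hx, hr x hx]]
    exact hd

theorem Hits.mono {n : ℕ} {α : Type*} {s : Finset α} {ρ ρ' : ℝ}
    {b b' : EuclideanSpace ℝ (Fin n)} {y : α → EuclideanSpace ℝ (Fin n)} (h : Hits s ρ b y)
    (hb : dist b b' + ρ ≤ ρ') : Hits s ρ' b' y := by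
  obtain ⟨w, hw, hd⟩ := h
  exact ⟨w, hw, by linarith [dist_triangle (∑ a ∈ s, w a • y a) b b']⟩

theorem IsWeight.norm_sum_le {n : ℕ} {α : Type*} {s : Finset α} {w : α → ℝ} (hw : IsWeight s w)
    {y : α → EuclideanSpace ℝ (Fin n)} {b : EuclideanSpace ℝ (Fin n)} {r : ℝ}
    (hy : ∀ a ∈ s, dist (y a) b ≤ r) : dist (∑ a ∈ s, w a • y a) b ≤ r := by
  have := (convex_closedBall b r).sum_mem (fun a _ => hw.nonneg a) hw.sum_eq_one
    fun a ha => Metric.mem_closedBall.2 (hy a ha)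
  exact Metric.mem_closedBall.1 this

/-- The union bound at the large scale. The gain of `1 / l !` over a bound by powers makes families
of size proportional to `log V` sufficient. -/
theorem large_scale_union_bound {n m b s B C k l : ℕ} {δ V : ℝ} (hmn : m < n) (hk : 0 < k)
    (hδ : 0 < δ) (hV : 1 < V) (hVlarge : 5 ^ n * Real.exp (Real.exp 1 * (B * C / δ)) < V)
    (hb : (b : ℝ) ≤ (5 * V) ^ n) (hs : (s : ℝ) ≤ B * V) (hkV : δ * V ≤ (k : ℝ) ^ (n - m))
    (hl : (n + 1) * Real.log V ≤ l) :
    b * s.choose l * (C * k ^ m) ^ l < (k ^ n) ^ l := by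
  have hV0 : 0 < V := by linarith
  have hkR : (0 : ℝ) < k := by exact_mod_cast hk
  set Γ : ℝ := B * C / δ with hΓ
  have hΓ0 : 0 ≤ Γ := by positivity
  have hfac : (0 : ℝ) < l.factorial := by exact_mod_cast l.factorial_pos
  -- `x ^ l / l ! ≤ exp x` for `x = exp 1 * Γ`
  have h1 : Γ ^ l / l.factorial ≤ Real.exp (Real.exp 1 * Γ) * Real.exp (-l) := by
    have := Real.pow_div_factorial_le_exp (Real.exp 1 * Γ) (by positivity) l
    rw [mul_pow, ← Real.exp_nat_mul, mul_one] at this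
    rw [Real.exp_neg, ← div_eq_mul_inv, le_div_iff₀ (Real.exp_pos _)]
    calc Γ ^ l / l.factorial * Real.exp l = Real.exp l * Γ ^ l / l.factorial := by ring
      _ ≤ _ := this
  have h2 : Real.exp (-l) * V ^ n ≤ 1 / V := by
    have : V ^ (n + 1) ≤ Real.exp l := by
      calc V ^ (n + 1) = Real.exp ((n + 1 : ℕ) * Real.log V) := by
            rw [Real.exp_nat_mul, Real.exp_log hV0]
        _ ≤ Real.exp l := Real.exp_le_exp.2 (by push_cast; exact hl)
    rw [Real.exp_neg, inv_mul_le_iff₀ (Real.exp_pos _), mul_one_div, le_div_iff₀ hV0, ← pow_succ]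
    exact this
  have h3 : (5 * V) ^ n * (Γ ^ l / l.factorial) < 1 := by
    calc (5 * V) ^ n * (Γ ^ l / l.factorial)
        ≤ (5 * V) ^ n * (Real.exp (Real.exp 1 * Γ) * Real.exp (-l)) := by gcongr
      _ = 5 ^ n * Real.exp (Real.exp 1 * Γ) * (Real.exp (-l) * V ^ n) := by rw [mul_pow]; ring
      _ ≤ 5 ^ n * Real.exp (Real.exp 1 * Γ) * (1 / V) := by gcongr
      _ < 1 := by rw [mul_one_div, div_lt_one hV0]; exact hVlarge
  have h4 : ((s.choose l : ℕ) : ℝ) ≤ (B * V) ^ l / l.factorial :=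
    (Nat.choose_le_pow_div l s).trans (by gcongr)
  have h5 : (k : ℝ) ^ n = k ^ m * k ^ (n - m) := by rw [← pow_add]; congr 1; omega
  have hreal : (b : ℝ) * (s.choose l : ℕ) * (C * k ^ m) ^ l < (k ^ n) ^ l := by
    have h6 : (B * V * C : ℝ) ^ l = Γ ^ l * (δ * V) ^ l := by
      rw [← mul_pow]; congr 1; rw [hΓ]; field_simp
    calc (b : ℝ) * (s.choose l : ℕ) * (C * k ^ m) ^ l
        ≤ (5 * V) ^ n * ((B * V) ^ l / l.factorial) * (C * k ^ m) ^ l := by gcongr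
      _ = (5 * V) ^ n * ((B * V * C) ^ l / l.factorial) * (k ^ m) ^ l := by
          rw [mul_pow (C : ℝ), mul_pow (B * V : ℝ) C]; ring
      _ = ((5 * V) ^ n * (Γ ^ l / l.factorial)) * ((δ * V) ^ l * (k ^ m) ^ l) := by rw [h6]; ring
      _ < 1 * ((δ * V) ^ l * (k ^ m) ^ l) := by
          apply mul_lt_mul_of_pos_right h3; positivity
      _ ≤ 1 * (((k : ℝ) ^ (n - m)) ^ l * (k ^ m) ^ l) := by gcongr
      _ = (k ^ n) ^ l := by rw [h5, mul_pow]; ring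
  exact_mod_cast hreal

set_option maxHeartbeats 1000000 in
/-- Random placement of the vertices at scale `V ^ (1 / (n - m))`: all faces become uniformly thick
simplices, and a ball of fixed radius meets `O(log V)` faces only. Thickness is achieved by
starting from a colouring of the vertices and from points in general position, one for each colour;
each vertex is placed randomly in a small cube about the point of its colour. -/
theorem exists_large_scale_placement (m n A B : ℕ) (hmn : m < n) :
    ∃ c : ℝ, 0 < c ∧ ∀ ρ : ℝ, 0 ≤ ρ → ∃ K V₀ : ℝ, 0 ≤ K ∧ ∀ (V R₁ : ℝ) (M : ℕ)
      (F : Finset (Finset ℕ)), V₀ ≤ V → 0 ≤ R₁ → R₁ ^ (n - m) = V →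
      (∀ σ ∈ F, σ ⊆ Finset.range M ∧ σ.Nonempty ∧ σ.card ≤ m + 1) →
      (∀ i, ∃ T : Finset (Finset ℕ), T.card ≤ A ∧ ∀ σ ∈ F, i ∈ σ → σ ∈ T) →
      (∀ σ ∈ F, ∀ i ∈ σ, ∀ j ∈ σ, {i, j} ∈ F) → (F.card : ℝ) ≤ B * V →
      ∃ g : ℕ → EuclideanSpace ℝ (Fin n), (∀ σ ∈ F, ∀ i ∈ σ, ‖g i‖ ≤ R₁ / 2) ∧
        (∀ σ ∈ F, ∀ h : ℕ → ℝ, ∑ i ∈ σ, h i = 0 → ∀ i ∈ σ,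
          c * R₁ * |h i| ≤ ‖∑ i ∈ σ, h i • g i‖) ∧
        ∀ b, ∀ G ⊆ F, (∀ σ ∈ G, Hits σ ρ b g) → (G.card : ℝ) ≤ K * Real.log V := by
  classical
  obtain ⟨q, c₀, hc₀, hq, hqc⟩ := exists_general_position n (A + 1)
  -- `ε * R₁` is the side length of the cubes; perturbations within them cost at most half of the
  -- thickness `c₀`
  set ε : ℝ := min c₀ 1 / (4 * (m + 1) * (n + 1)) with hε
  have hε0 : 0 < ε := by positivity
  have hεc : (m + 1) * (n * ε) ≤ c₀ / 2 := by
    have h1 : (m + 1) * ((n + 1) * ε) = min c₀ 1 / 4 := by rw [hε]; field_simp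
    have h2 := min_le_left c₀ 1
    have h3 : ((m : ℝ) + 1) * (n * ε) ≤ (m + 1) * ((n + 1) * ε) := by gcongr; linarith
    linarith
  have hε1 : n * ε ≤ 1 / 4 := by
    have h1 : (m + 1) * ((n + 1) * ε) = min c₀ 1 / 4 := by rw [hε]; field_simp
    have h2 := min_le_right c₀ 1
    have h3 : (n : ℝ) * ε ≤ (m + 1) * ((n + 1) * ε) := by
      have : (0 : ℝ) ≤ m * ((n + 1) * ε) := by positivity
      nlinarith
    linarith
  refine ⟨c₀ / 2, by positivity, fun ρ hρ => ?_⟩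
  obtain ⟨C, hC⟩ := exists_placement n m (2 / ε) (ρ + n)
  set δ : ℝ := (ε / 2) ^ (n - m) with hδ
  have hδ0 : 0 < δ := by positivity
  refine ⟨(n + 2) * (m + 1) * A, max (max (Real.exp 1)
    (5 ^ n * Real.exp (Real.exp 1 * (B * C / δ)) + 1)) ((max (2 / ε) (2 * (ρ + 1))) ^ (n - m)),
    by positivity, fun V R₁ M F hV hR₁ hR₁V hF hdeg hdown hcard => ?_⟩
  have hVe : Real.exp 1 ≤ V := (le_max_left _ _).trans ((le_max_left _ _).trans hV)
  have hVlarge : 5 ^ n * Real.exp (Real.exp 1 * (B * C / δ)) < V := by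
    have := (le_max_right _ _).trans ((le_max_left _ _).trans hV)
    linarith
  have hV1 : 1 < V := by
    have := Real.add_one_le_exp (1 : ℝ)
    linarith
  have hnm : n - m ≠ 0 := by omega
  have hRbig : max (2 / ε) (2 * (ρ + 1)) ≤ R₁ := by
    have h1 := (le_max_right _ _).trans hV
    rw [← hR₁V] at h1
    exact (pow_le_pow_iff_left₀ (by positivity) hR₁ hnm).1 h1
  have hRε : 2 / ε ≤ R₁ := (le_max_left _ _).trans hRbig
  have hRρ : 2 * (ρ + 1) ≤ R₁ := (le_max_right _ _).trans hRbig
  have hRpos : 0 < R₁ := lt_of_lt_of_le (by positivity) hRε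
  have hεR : 2 ≤ ε * R₁ := by rw [div_le_iff₀ hε0] at hRε; linarith
  have hR1 : 1 ≤ R₁ := by linarith
  have hRV : R₁ ≤ V := by rw [← hR₁V]; exact le_self_pow₀ hR1 hnm
  set k := ⌊ε * R₁⌋₊ with hk
  have hk_le : (k : ℝ) ≤ ε * R₁ := Nat.floor_le (by positivity)
  have hk_ge : ε * R₁ / 2 ≤ k := by
    have := Nat.lt_floor_add_one (ε * R₁)
    rw [← hk] at this
    linarith
  have hkpos : 0 < k := by
    have : (0 : ℝ) < k := by linarith
    exact_mod_cast this
  -- vertices of a common face get different colours; a vertex has at most `A` neighbours, as the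
  -- edges leading to them are among the faces which contain it
  obtain ⟨col, hcol⟩ := exists_coloring (adj := fun i j => ∃ σ ∈ F, i ∈ σ ∧ j ∈ σ)
    (fun i j ⟨σ, hσ, hi, hj⟩ => ⟨σ, hσ, hj, hi⟩) (Nat.succ_pos A) (Finset.range M) (fun i _ => by
      obtain ⟨T, hTA, hT⟩ := hdeg i
      refine ⟨(Finset.range M).filter fun j => (∃ σ ∈ F, i ∈ σ ∧ j ∈ σ) ∧ j ≠ i,
        Nat.lt_succ_of_le (le_trans ?_ hTA), fun j hj h1 h2 => Finset.mem_filter.2 ⟨hj, h1, h2⟩⟩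
      refine Finset.card_le_card_of_injOn (fun j => {i, j}) (fun j hj => ?_) fun j hj j' hj' h => ?_
      · obtain ⟨-, ⟨σ, hσ, hi, hj⟩, -⟩ := Finset.mem_filter.1 hj
        exact hT _ (hdown σ hσ i hi j hj) (by simp)
      · have h1 := (Finset.mem_filter.1 (Finset.mem_coe.1 hj)).2.2
        have : j ∈ ({i, j'} : Finset ℕ) := by
          rw [← show ({i, j} : Finset ℕ) = {i, j'} from h]; simp
        simpa [h1] using this)
  have hcolinj : ∀ σ ∈ F, Set.InjOn (fun i => (col i : ℕ)) (σ : Set ℕ) := by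
    intro σ hσ i hi j hj hij
    by_contra hne
    exact hcol i ((hF σ hσ).1 hi) j ((hF σ hσ).1 hj) hne ⟨σ, hσ, hi, hj⟩ (Fin.ext hij)
  have hqnorm : ∀ i, ‖q (col i)‖ ≤ 1 / 4 := fun i => hq _ (col i).2
  -- random placement within cubes of side length `k` about the points `R₁ • q (col i)`
  have htup : ∀ σ : F, ∃ t : Fin (m + 1) → Fin M, (∀ a, ((t a : Fin M) : ℕ) ∈ (σ : Finset ℕ)) ∧
      ∀ x ∈ (σ : Finset ℕ), ∃ a, ((t a : Fin M) : ℕ) = x := by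
    intro σ
    obtain ⟨h1, h2, h3⟩ := hF σ σ.2
    obtain ⟨t, ht, hsurj⟩ := exists_surjective_tuple h2 h3
    exact ⟨fun a => ⟨t a, Finset.mem_range.1 (h1 (ht a))⟩, ht, hsurj⟩
  choose t ht htsurj using htup
  set H := ⌈R₁⌉₊ with hH
  -- the lattice points of the ball of radius `R₁`, as centres of the balls to be tested
  set Bset : Finset (EuclideanSpace ℝ (Fin n)) :=
    (Fintype.piFinset fun _ : Fin n => Finset.Icc (-(H : ℤ)) H).image latticePoint with hBset
  have hBcard : (Bset.card : ℝ) ≤ (5 * V) ^ n := by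
    have h1 : Bset.card ≤ (2 * H + 1) ^ n := by
      refine Finset.card_image_le.trans ?_
      rw [Fintype.card_piFinset]
      simp only [Int.card_Icc, Finset.prod_const, Finset.card_univ, Fintype.card_fin]
      exact Nat.pow_le_pow_left (by omega) n
    have h2 : (H : ℝ) ≤ R₁ + 1 := (Nat.ceil_lt_add_one hR₁).le
    calc (Bset.card : ℝ) ≤ ((2 * H + 1 : ℕ) : ℝ) ^ n := by exact_mod_cast h1
      _ ≤ (5 * V) ^ n := by
          gcongr
          push_cast
          linarith
  set l := ⌈(n + 1) * Real.log V⌉₊ with hl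
  have hlog1 : 1 ≤ Real.log V := by rw [Real.le_log_iff_exp_le (by linarith)]; exact hVe
  have hl_ge : (n + 1) * Real.log V ≤ l := Nat.le_ceil _
  have hl_le : (l : ℝ) ≤ (n + 2) * Real.log V := by
    have := (Nat.ceil_lt_add_one (a := (n + 1) * Real.log V) (by positivity)).le
    rw [← hl] at this
    linarith
  have hkV : δ * V ≤ (k : ℝ) ^ (n - m) := by
    rw [← hR₁V, hδ, ← mul_pow]
    exact pow_le_pow_left₀ (by positivity) (by linarith) _
  obtain ⟨f, hf⟩ := hC k hkpos (ι := Fin M) (J := F) t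
    (fun σ a => R₁ • q (col (t σ a)))
    (fun σ a => by
      rw [norm_smul, Real.norm_of_nonneg hR₁]
      have h1 : R₁ ≤ 2 / ε * k := by
        rw [div_mul_eq_mul_div, le_div_iff₀ hε0]; linarith
      nlinarith [hqnorm (t σ a)])
    Bset l (large_scale_union_bound hmn hkpos hδ0 hV1 hVlarge hBcard
      (by rw [Fintype.card_coe]; exact hcard) hkV hl_ge)
  set g : ℕ → EuclideanSpace ℝ (Fin n) := fun i => R₁ • q (col i) +
    (if h : i < M then gridPoint (f ⟨i, h⟩) else 0) with hg
  have hpert : ∀ i, ‖g i - R₁ • q (col i)‖ ≤ n * ε * R₁ := by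
    intro i
    simp only [hg, add_sub_cancel_left]
    split_ifs with h
    · refine (norm_gridPoint_le _).trans ?_
      rw [mul_assoc]
      gcongr
    · rw [norm_zero]; positivity
  have hgnorm : ∀ i, ‖g i‖ ≤ R₁ / 2 := by
    intro i
    have h1 : ‖R₁ • q (col i)‖ ≤ R₁ / 4 := by
      rw [norm_smul, Real.norm_of_nonneg hR₁]; nlinarith [hqnorm i]
    have h2 := norm_add_le (g i - R₁ • q (col i)) (R₁ • q (col i))
    rw [sub_add_cancel] at h2
    nlinarith [hpert i]
  refine ⟨g, fun σ _ i _ => hgnorm i, fun σ hσ h h0 => ?_,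
    fun b Fb hFb hFbH => ?_⟩
  · -- thickness of the faces
    obtain ⟨hσM, hσne, hσc⟩ := hF σ hσ
    have hbase : ∀ i ∈ σ, c₀ * R₁ * |h i| ≤ ‖∑ i ∈ σ, h i • (R₁ • q (col i))‖ := by
      intro i hi
      have h1 := general_position_comp hqc (by omega) (hcolinj σ hσ) (fun i _ => (col i).2) h0 i hi
      have h2 : ∑ i ∈ σ, h i • (R₁ • q (col i)) = R₁ • ∑ i ∈ σ, h i • q (col i) := by
        rw [Finset.smul_sum]
        exact Finset.sum_congr rfl fun i _ => smul_comm _ _ _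
      rw [h2, norm_smul, Real.norm_of_nonneg hR₁]
      calc c₀ * R₁ * |h i| = R₁ * (c₀ * |h i|) := by ring
        _ ≤ _ := mul_le_mul_of_nonneg_left h1 hR₁
    have hη : ((m + 1 : ℕ) : ℝ) * (n * ε * R₁) ≤ c₀ / 2 * R₁ := by
      calc ((m + 1 : ℕ) : ℝ) * (n * ε * R₁) = ((m + 1) * (n * ε)) * R₁ := by push_cast; ring
        _ ≤ _ := by gcongr
    intro i hi
    have h1 := coeff_bound_of_perturbation hσc (hη.trans (by gcongr; linarith))
      (fun i _ => hpert i) hbase i hi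
    refine le_trans ?_ h1
    gcongr
    linarith
  · -- the number of faces which meet a ball
    rcases Fb.eq_empty_or_nonempty with rfl | ⟨σ₀, hσ₀⟩
    · have : 0 ≤ Real.log V := by linarith
      simp only [Finset.card_empty, Nat.cast_zero]
      positivity
    obtain ⟨w₀, hw₀, hd₀⟩ := hFbH σ₀ hσ₀
    have hbnorm : ‖b‖ ≤ R₁ - 1 := by
      have h1 : dist (∑ i ∈ σ₀, w₀ i • g i) 0 ≤ R₁ / 2 := hw₀.norm_sum_le fun i _ => by
        rw [dist_zero_right]; exact hgnorm i
      have h2 := dist_triangle_left b 0 (∑ i ∈ σ₀, w₀ i • g i)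
      rw [dist_zero_right] at h2
      linarith
    set b' : EuclideanSpace ℝ (Fin n) := latticePoint fun j => ⌊b j⌋ with hb'
    have hb'mem : b' ∈ Bset := by
      refine Finset.mem_image_of_mem _ (Fintype.mem_piFinset.2 fun j => Finset.mem_Icc.2 ?_)
      have h1 := (abs_le.1 ((abs_apply_le_norm b j).trans hbnorm))
      have h2 : R₁ ≤ H := Nat.le_ceil _
      constructor
      · rw [Int.le_floor]
        push_cast
        linarith
      · rw [Int.floor_le_iff]
        push_cast
        linarith
    have hcount := card_le_of_disjoint_lt (F := Fb) (a := m + 1) (d := A) (l := l)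
      (fun s hs => (hF s (hFb hs)).2.1) (fun s hs => (hF s (hFb hs)).2.2)
      (fun i => by
        obtain ⟨T, hTA, hT⟩ := hdeg i
        exact ⟨T, hTA, fun s hs => hT s (hFb hs)⟩)
      (fun G hG hdis => by
        have hGF : ∀ σ ∈ G, σ ∈ F := fun σ hσ => hFb (hG hσ)
        have := hf b' hb'mem (Finset.image (fun σ : {x // x ∈ G} =>
          (⟨σ.1, hGF σ.1 σ.2⟩ : {x // x ∈ F})) G.attach) (by
          intro j hj j' hj' hne a a' heq
          obtain ⟨⟨σ, hσ⟩, -, rfl⟩ := Finset.mem_image.1 hj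
          obtain ⟨⟨σ', hσ'⟩, -, rfl⟩ := Finset.mem_image.1 hj'
          have hne' : σ ≠ σ' := fun h => hne (Subtype.ext h)
          refine Finset.disjoint_left.1 (hdis σ hσ σ' hσ' hne') (ht ⟨σ, hGF σ hσ⟩ a) ?_
          rw [heq]
          exact ht ⟨σ', hGF σ' hσ'⟩ a') (by
          intro j hj
          obtain ⟨⟨σ, hσ⟩, -, rfl⟩ := Finset.mem_image.1 hj
          have h1 : Hits σ ρ b g := hFbH σ (hG hσ)
          have h2 : Hits σ (ρ + n) b' g := h1.mono (by
            have := dist_latticePoint_floor_le b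
            linarith)
          have h3 := h2.comp_tuple (ht ⟨σ, hGF σ hσ⟩) (htsurj ⟨σ, hGF σ hσ⟩)
          refine cast (congrArg _ ?_) h3
          funext a
          simp only [hg, Fin.is_lt, dif_pos, Fin.eta])
        rw [Finset.card_image_of_injective, Finset.card_attach] at this
        · exact this.le
        · intro x y hxy
          exact Subtype.ext (congrArg (fun z : {x // x ∈ F} => z.1) hxy))
    calc (Fb.card : ℝ) ≤ ((l * (m + 1) * A : ℕ) : ℝ) := by exact_mod_cast hcount
      _ = l * ((m + 1) * A) := by push_cast; ring
      _ ≤ ((n + 2) * Real.log V) * ((m + 1) * A) := by gcongr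
      _ = _ := by ring

/-! ### Kuhn simplices under a thick affine placement -/

/-- A placement `g` of the vertices of a face `σ` in the ball of radius `R₁ / 2` such that the
simplex spanned by them has thickness at least `c * R₁`: combinations of total zero of its vertices
control their coefficients. -/
structure IsThick {n : ℕ} (c R₁ : ℝ) (σ : Finset ℕ) (g : ℕ → EuclideanSpace ℝ (Fin n)) : Prop where
  norm_le : ∀ i ∈ σ, ‖g i‖ ≤ R₁ / 2
  le_norm : ∀ h : ℕ → ℝ, ∑ i ∈ σ, h i = 0 → ∀ i ∈ σ, c * R₁ * |h i| ≤ ‖∑ i ∈ σ, h i • g i‖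

variable {n m M D : ℕ} {c R₁ : ℝ} {σ : Finset ℕ} {g : ℕ → EuclideanSpace ℝ (Fin n)}

/-- The coordinates of a difference `Y` of two paths are controlled by the distance of the two
points which they describe, as `D` is comparable to the size of the simplex. -/
theorem IsThick.abs_le (hg : IsThick c R₁ σ g) (hσ : σ ⊆ Finset.range M) (hσc : σ.card ≤ m + 1)
    (hR : 0 < R₁) (hD : 0 < D) (hDR : (D : ℝ) ≤ 2 * R₁) {Y : ℕ → ℝ} (h0 : Y 0 = 0)
    (hM : ∀ i, M ≤ i → Y i = 0) (hY : ∀ i < M, i ∉ σ → Y i = Y (i + 1)) (i : ℕ) :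
    c * |Y i| ≤ 2 * (m + 1) * ‖pathPoint M g D Y‖ := by
  have hDpos : (0 : ℝ) < D := by exact_mod_cast hD
  rcases le_or_gt M i with hi | hi
  · rw [hM i hi, abs_zero, mul_zero]; positivity
  have hinc : ∀ j ∈ σ, c * |Y (j + 1) - Y j| ≤ 2 * ‖pathPoint M g D Y‖ := by
    intro j hj
    have hs : ∑ i ∈ σ, (Y (i + 1) - Y i) / D = 0 := by
      rw [← Finset.sum_div, sum_increments hσ hY, h0, hM M le_rfl]; simp
    have := hg.le_norm _ hs j hj
    rw [← pathPoint_eq_sum hσ hY, abs_div, abs_of_pos hDpos, ← mul_div_assoc,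
      div_le_iff₀ hDpos] at this
    have h2 : ‖pathPoint M g D Y‖ * D ≤ ‖pathPoint M g D Y‖ * (2 * R₁) := by gcongr
    have h3 : R₁ * (c * |Y (j + 1) - Y j|) ≤ R₁ * (2 * ‖pathPoint M g D Y‖) := by linarith
    exact le_of_mul_le_mul_left h3 hR
  rcases le_or_gt c 0 with hc | hc
  · exact (mul_nonpos_of_nonpos_of_nonneg hc (abs_nonneg _)).trans (by positivity)
  have h1 : |Y i| ≤ ∑ j ∈ σ, |Y (j + 1) - Y j| := by
    have h2 : Y i = ∑ j ∈ Finset.range i, (Y (j + 1) - Y j) := by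
      rw [Finset.sum_range_sub, h0, sub_zero]
    rw [h2]
    refine (Finset.abs_sum_le_sum_abs _ _).trans ?_
    rw [← Finset.sum_subset (s₁ := (Finset.range i).filter (· ∈ σ)) (Finset.filter_subset _ _)]
    · exact Finset.sum_le_sum_of_subset_of_nonneg (fun j hj => (Finset.mem_filter.1 hj).2)
        fun _ _ _ => abs_nonneg _
    · intro j hj hjn
      have hjσ : j ∉ σ := fun h => hjn (Finset.mem_filter.2 ⟨hj, h⟩)
      rw [hY j ((Finset.mem_range.1 hj).trans hi) hjσ, sub_self, abs_zero]
  calc c * |Y i| ≤ c * ∑ j ∈ σ, |Y (j + 1) - Y j| := by gcongr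
    _ = ∑ j ∈ σ, c * |Y (j + 1) - Y j| := Finset.mul_sum _ _ _
    _ ≤ ∑ _j ∈ σ, 2 * ‖pathPoint M g D Y‖ := Finset.sum_le_sum hinc
    _ = σ.card * (2 * ‖pathPoint M g D Y‖) := by rw [Finset.sum_const, nsmul_eq_mul]
    _ ≤ ((m + 1 : ℕ) : ℝ) * (2 * ‖pathPoint M g D Y‖) := by gcongr
    _ = _ := by push_cast; ring

theorem pathPoint_sub (M : ℕ) (v : ℕ → EuclideanSpace ℝ (Fin n)) (D : ℝ) (Y Z : ℕ → ℝ) :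
    pathPoint M v D Y - pathPoint M v D Z = pathPoint M v D (fun i => Y i - Z i) := by
  simp only [pathPoint, ← Finset.sum_sub_distrib, ← sub_smul, ← sub_div]
  refine Finset.sum_congr rfl fun i _ => ?_
  congr 2
  ring

/-- At scale `D`, comparable to `R₁`, the Kuhn simplices of a thick simplex of size `R₁` are thick
simplices of size about one. -/
theorem IsThick.le_norm_sum (hg : IsThick c R₁ σ g) (hσ : σ ⊆ Finset.range M)
    (hσc : σ.card ≤ m + 1) (hc : 0 < c) (hR : 0 < R₁) (hD : 0 < D) (hDR : (D : ℝ) ≤ 2 * R₁)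
    {υ : Finset (ℕ → ℤ)} (hυ : IsKuhn M D σ υ) {h : (ℕ → ℤ) → ℝ} (h0 : ∑ p ∈ υ, h p = 0) :
    ∀ p ∈ υ, c / (4 * (m + 1)) * |h p| ≤ ‖∑ p ∈ υ, h p • pathPoint M g D (fun i => (p i : ℝ))‖ := by
  intro p hp
  rw [← pathPoint_sum M g D υ h fun p i => (p i : ℝ)]
  set x := pathPoint M g D (fun i => ∑ p ∈ υ, h p * (p i : ℝ)) with hx
  have h1 : ∀ i, |∑ p ∈ υ, h p * (p i : ℝ)| ≤ 2 * (m + 1) * ‖x‖ / c := by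
    intro i
    rw [le_div_iff₀ hc, mul_comm]
    refine hg.abs_le hσ hσc hR hD hDR ?_ (fun i hi => ?_) (hυ.sum_eq_of_notMem h) i
    · exact Finset.sum_eq_zero fun p hp => by rw [(hυ.isPath p hp).zero]; simp
    · rw [Finset.sum_congr rfl fun p hp => by rw [(hυ.isPath p hp).top i hi], ← Finset.sum_mul, h0,
        zero_mul]
  have h2 := hυ.chain.abs_coeff_le h0 (by positivity) h1 hp
  rw [div_mul_eq_mul_div, div_le_iff₀ (by positivity)]
  calc c * |h p| ≤ c * (2 * (2 * (m + 1) * ‖x‖ / c)) := by gcongr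
    _ = _ := by field_simp; ring

theorem IsThick.le_dist (hg : IsThick c R₁ σ g) (hσ : σ ⊆ Finset.range M)
    (hσc : σ.card ≤ m + 1) (hc : 0 < c) (hR : 0 < R₁) (hD : 0 < D) (hDR : (D : ℝ) ≤ 2 * R₁)
    {p q : ℕ → ℤ} (hp : IsPath M (D : ℤ) p) (hq : IsPath M (D : ℤ) q) (hpσ : steps M p ⊆ σ)
    (hqσ : steps M q ⊆ σ) (hpq : p ≠ q) :
    c / (2 * (m + 1)) ≤ dist (pathPoint M g D (fun i => (p i : ℝ)))
      (pathPoint M g D (fun i => (q i : ℝ))) := by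
  obtain ⟨i, hi⟩ := Function.ne_iff.1 hpq
  rw [dist_eq_norm, pathPoint_sub, div_le_iff₀ (by positivity), mul_comm]
  refine le_trans ?_ (hg.abs_le (m := m) (Y := fun i => (p i : ℝ) - q i) hσ hσc hR hD hDR ?_
    (fun i hi => ?_) (fun i hi hiσ => ?_) i)
  · have : (1 : ℝ) ≤ |(p i : ℝ) - q i| := by
      have := Int.one_le_abs (sub_ne_zero.2 hi)
      exact_mod_cast this
    nlinarith
  · simp [hp.zero, hq.zero]
  · simp [hp.top i hi, hq.top i hi]
  · rw [eq_of_notMem_steps hpσ i hi hiσ, eq_of_notMem_steps hqσ i hi hiσ]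

theorem hits_of_dist_pathPoint_le (hσ : σ ⊆ Finset.range M) (hD : 0 < D)
    {p : ℕ → ℤ} (hp : IsPath M (D : ℤ) p) (hpσ : steps M p ⊆ σ) {ρ : ℝ}
    {b : EuclideanSpace ℝ (Fin n)} (hb : dist (pathPoint M g D (fun i => (p i : ℝ))) b ≤ ρ) :
    Hits σ ρ b g := by
  have hs : steps M (fun i => (p i : ℝ)) ⊆ σ := by rw [steps_cast]; exact hpσ
  refine ⟨_, IsPath.isWeight (D := (D : ℝ)) (by exact_mod_cast hD) (by simpa using hp.cast) hσ hs,
    ?_⟩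
  rw [← pathPoint_eq_sum hσ (eq_of_notMem_steps hs)]
  exact hb

theorem IsThick.norm_pathPoint_le (hg : IsThick c R₁ σ g) (hσ : σ ⊆ Finset.range M) (hD : 0 < D)
    {p : ℕ → ℤ} (hp : IsPath M (D : ℤ) p) (hpσ : steps M p ⊆ σ) :
    ‖pathPoint M g D (fun i => (p i : ℝ))‖ ≤ R₁ / 2 := by
  have hs : steps M (fun i => (p i : ℝ)) ⊆ σ := by rw [steps_cast]; exact hpσ
  have hw := IsPath.isWeight (D := (D : ℝ)) (by exact_mod_cast hD) (by simpa using hp.cast) hσ hs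
  rw [pathPoint_eq_sum hσ (eq_of_notMem_steps hs), ← dist_zero_right]
  exact hw.norm_sum_le fun i hi => by rw [dist_zero_right]; exact hg.norm_le i hi

theorem IsThick.dist_le (hg : IsThick c R₁ σ g) (hσ : σ ⊆ Finset.range M) (hσc : σ.card ≤ m + 1)
    (hR : 0 < R₁) (hDR : R₁ ≤ D) {υ : Finset (ℕ → ℤ)} (hυ : IsKuhn M D σ υ) {p q : ℕ → ℤ}
    (hp : p ∈ υ) (hq : q ∈ υ) :
    dist (pathPoint M g D (fun i => (p i : ℝ))) (pathPoint M g D (fun i => (q i : ℝ))) ≤ m + 1 := by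
  have hDpos : (0 : ℝ) < D := hR.trans_le hDR
  rw [dist_eq_norm, pathPoint_sub, pathPoint_eq_sum hσ]
  · refine (norm_sum_le _ _).trans ?_
    have : ∀ i ∈ σ, ‖(((p (i + 1) : ℝ) - q (i + 1) - (p i - q i)) / D) • g i‖ ≤ 1 := by
      intro i hi
      have h1 : ∀ j, |(p j : ℝ) - q j| ≤ 1 := fun j => by
        have h1 := (hυ.chain p hp q hq).2 j
        have h2 := (hυ.chain q hq p hp).2 j
        rw [_root_.abs_le]
        constructor
        · have : (q j : ℝ) ≤ p j + 1 := by exact_mod_cast h1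
          linarith
        · have : (p j : ℝ) ≤ q j + 1 := by exact_mod_cast h2
          linarith
      have h2 : |(p (i + 1) : ℝ) - q (i + 1) - (p i - q i)| ≤ 2 :=
        (abs_sub _ _).trans (by linarith [h1 i, h1 (i + 1)])
      rw [norm_smul, Real.norm_eq_abs, abs_div, abs_of_pos hDpos]
      calc _ ≤ 2 / (D : ℝ) * (R₁ / 2) := by
            gcongr
            exact hg.norm_le i hi
        _ = R₁ / D := by ring
        _ ≤ 1 := (div_le_one hDpos).2 hDR
    calc _ ≤ ∑ _i ∈ σ, (1 : ℝ) := Finset.sum_le_sum this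
      _ = σ.card := by simp
      _ ≤ ((m + 1 : ℕ) : ℝ) := by gcongr
      _ = _ := by push_cast; ring
  · intro i hi hiσ
    rw [eq_of_notMem_steps (hυ.steps_subset p hp) i hi hiσ,
      eq_of_notMem_steps (hυ.steps_subset q hq) i hi hiσ]

/-- The lattice points near a given point can be counted face by face; hence they have a colouring,
with as many colours as faces may meet a ball up to a factor, such that nearby lattice points have
different colours. -/
theorem exists_coloring_near (m n : ℕ) {c : ℝ} (hc : 0 < c) (ρ : ℝ) :
    ∃ N : ℕ, ∀ {M D : ℕ} {R₁ K : ℝ} {F : Finset (Finset ℕ)} {g : ℕ → EuclideanSpace ℝ (Fin n)},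
      0 ≤ K → 0 < D → 0 < R₁ → (D : ℝ) ≤ 2 * R₁ →
      (∀ σ ∈ F, σ ⊆ Finset.range M ∧ σ.Nonempty ∧ σ.card ≤ m + 1) → (∀ σ ∈ F, IsThick c R₁ σ g) →
      (∀ b, ∀ G ⊆ F, (∀ σ ∈ G, Hits σ ρ b g) → (G.card : ℝ) ≤ K) →
      ∃ χ : (ℕ → ℤ) → Fin (⌊K⌋₊ * N + 1),
        ∀ σ ∈ F, ∀ σ' ∈ F, ∀ p q, IsPath M (D : ℤ) p → IsPath M (D : ℤ) q →
          steps M p ⊆ σ → steps M q ⊆ σ' → p ≠ q →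
          dist (pathPoint M g D (fun i => (p i : ℝ))) (pathPoint M g D (fun i => (q i : ℝ))) ≤ ρ →
          χ p ≠ χ q := by
  classical
  obtain ⟨N, hN⟩ := exists_packing_bound n ρ (c := c / (2 * (m + 1))) (by positivity)
  refine ⟨N, fun {M D R₁ K F g} hK hD hR hDR hF hg hcount => ?_⟩
  set G : (ℕ → ℤ) → EuclideanSpace ℝ (Fin n) :=
    fun p => pathPoint M g D (fun i => (p i : ℝ)) with hG
  have hpaths : ∀ σ : F, ∃ S : Finset (ℕ → ℤ), ∀ p, p ∈ S ↔ IsPath M (D : ℤ) p ∧ steps M p ⊆ σ :=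
    fun σ => by
      obtain ⟨S, hS, -⟩ := exists_finset_paths M D (hF σ σ.2).2.1
      exact ⟨S, hS⟩
  choose S hS using hpaths
  set U : Finset (ℕ → ℤ) := F.attach.biUnion S with hU
  have hUmem : ∀ p ∈ U, ∃ σ ∈ F, IsPath M (D : ℤ) p ∧ steps M p ⊆ σ := fun p hp => by
    obtain ⟨σ, -, hpσ⟩ := Finset.mem_biUnion.1 hp
    exact ⟨σ, σ.2, (hS σ p).1 hpσ⟩
  choose! φ hφ using hUmem
  obtain ⟨χ, hχ⟩ := exists_coloring (adj := fun p q => dist (G p) (G q) ≤ ρ)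
    (fun p q h => by rw [dist_comm]; exact h) (Nat.succ_pos (⌊K⌋₊ * N)) U (fun p hp => by
      refine ⟨U.filter fun q => dist (G p) (G q) ≤ ρ, ?_, fun q hq h _ =>
        Finset.mem_filter.2 ⟨hq, h⟩⟩
      rw [Nat.lt_succ_iff]
      set T := U.filter fun q => dist (G p) (G q) ≤ ρ with hT
      have h1 : (T.image φ).card ≤ ⌊K⌋₊ := by
        refine Nat.le_floor (hcount (G p) _ (fun σ hσ => ?_) fun σ hσ => ?_)
        · obtain ⟨q, hq, rfl⟩ := Finset.mem_image.1 hσ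
          exact (hφ q (Finset.mem_filter.1 hq).1).1
        · obtain ⟨q, hq, rfl⟩ := Finset.mem_image.1 hσ
          obtain ⟨hqU, hqd⟩ := Finset.mem_filter.1 hq
          obtain ⟨h1, h2, h3⟩ := hφ q hqU
          exact hits_of_dist_pathPoint_le (hF _ h1).1 hD h2 h3 (by rw [dist_comm]; exact hqd)
      have h2 : ∀ σ ∈ T.image φ, (T.filter fun q => φ q = σ).card ≤ N := by
        intro σ hσ
        refine hN _ G (G p) (fun q hq => ?_) fun q hq q' hq' hne => ?_
        · rw [dist_comm]
          exact (Finset.mem_filter.1 (Finset.mem_filter.1 hq).1).2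
        · obtain ⟨hqT, rfl⟩ := Finset.mem_filter.1 hq
          obtain ⟨hqT', hq'⟩ := Finset.mem_filter.1 hq'
          obtain ⟨h1, h2, h3⟩ := hφ q (Finset.mem_filter.1 hqT).1
          obtain ⟨-, h2', h3'⟩ := hφ q' (Finset.mem_filter.1 hqT').1
          rw [hq'] at h3'
          exact (hg _ h1).le_dist (hF _ h1).1 (hF _ h1).2.2 hc hR hD hDR h2 h2' h3 h3' hne
      calc T.card ≤ N * (T.image φ).card := Finset.card_le_mul_card_image T N h2
        _ ≤ N * ⌊K⌋₊ := Nat.mul_le_mul_left _ h1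
        _ = ⌊K⌋₊ * N := mul_comm _ _)
  refine ⟨χ, fun σ hσ σ' hσ' p q hp hq hpσ hqσ hne hd => hχ p ?_ q ?_ hne hd⟩
  · exact Finset.mem_biUnion.2 ⟨⟨σ, hσ⟩, Finset.mem_attach _ _, (hS _ _).2 ⟨hp, hpσ⟩⟩
  · exact Finset.mem_biUnion.2 ⟨⟨σ', hσ'⟩, Finset.mem_attach _ _, (hS _ _).2 ⟨hq, hqσ⟩⟩

/-! ### Placing the vertices of the fine subdivision at the small scale -/

/-- The union bound at the small scale. Since the logarithm `Λ` enters with the power `m + 1 ≤ n`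
on the left and with the power `n + 1` on the right, families of bounded size suffice. -/
theorem small_scale_union_bound {n m k Q W C l : ℕ} {Λ Γ η : ℝ} (hmn : m < n) (hΛ1 : 1 ≤ Λ)
    (hη : 0 < η) (hΓ : 1 ≤ Γ) (hQ : (Q : ℝ) ≤ Γ * Λ) (hk1 : η * Λ ^ (n + 1) ≤ k)
    (hk2 : (k : ℝ) ≤ Λ ^ (n + 1)) (hl : l = n * (n + 1) + 1)
    (hΛ : (C * (Γ ^ (m + 1) * W) / η) ^ l < Λ) :
    k ^ n * (Q ^ (m + 1) * W).choose l * (C * k ^ m) ^ l < (k ^ n) ^ l := by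
  have hΛ0 : 0 < Λ := by linarith
  have hkR : (0 : ℝ) < k := lt_of_lt_of_le (by positivity) hk1
  set X : ℝ := C * (Γ ^ (m + 1) * W) with hX
  have hX0 : 0 ≤ X := by positivity
  have hk1' : (1 : ℝ) ≤ k := by
    have : 0 < k := by exact_mod_cast hkR
    exact_mod_cast this
  have h1 : ((Q ^ (m + 1) * W : ℕ) : ℝ) * C ≤ X / η * (k / Λ) := by
    have h2 : (Q : ℝ) ^ (m + 1) ≤ Γ ^ (m + 1) * Λ ^ n := by
      calc (Q : ℝ) ^ (m + 1) ≤ (Γ * Λ) ^ (m + 1) := by gcongr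
        _ = Γ ^ (m + 1) * Λ ^ (m + 1) := mul_pow _ _ _
        _ ≤ _ := by gcongr; exact hmn
    have h3 : Λ ^ n ≤ k / Λ / η := by
      rw [le_div_iff₀ hη, le_div_iff₀ hΛ0]
      calc Λ ^ n * η * Λ = η * Λ ^ (n + 1) := by ring
        _ ≤ _ := hk1
    push_cast
    calc (Q : ℝ) ^ (m + 1) * W * C ≤ Γ ^ (m + 1) * (k / Λ / η) * W * C := by
          gcongr
          exact h2.trans (by gcongr)
      _ = _ := by rw [hX]; ring
  have h2 : (k : ℝ) ^ n * (X / η) ^ l < Λ ^ l := by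
    calc (k : ℝ) ^ n * (X / η) ^ l < k ^ n * Λ := by gcongr
      _ ≤ (Λ ^ (n + 1)) ^ n * Λ := by gcongr
      _ = Λ ^ l := by rw [← pow_mul, ← pow_succ, hl, mul_comm n]
  have h3 : (k : ℝ) * k ^ m ≤ k ^ n := by
    rw [← pow_succ']
    exact pow_le_pow_right₀ hk1' hmn
  have hreal : (k : ℝ) ^ n * ((Q ^ (m + 1) * W).choose l : ℕ) * (C * k ^ m) ^ l < (k ^ n) ^ l := by
    calc (k : ℝ) ^ n * ((Q ^ (m + 1) * W).choose l : ℕ) * (C * k ^ m) ^ l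
        ≤ (k : ℝ) ^ n * ((Q ^ (m + 1) * W : ℕ) : ℝ) ^ l * (C * k ^ m) ^ l := by
          gcongr
          exact_mod_cast Nat.choose_le_pow _ _
      _ = k ^ n * (((Q ^ (m + 1) * W : ℕ) : ℝ) * C) ^ l * (k ^ m) ^ l := by
          rw [mul_pow, mul_pow]; ring
      _ ≤ k ^ n * (X / η * (k / Λ)) ^ l * (k ^ m) ^ l := by gcongr
      _ = (k ^ n * (X / η) ^ l) * ((k * k ^ m) ^ l / Λ ^ l) := by
          rw [mul_pow, div_pow, mul_pow]; ring
      _ < Λ ^ l * ((k * k ^ m) ^ l / Λ ^ l) := by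
          apply mul_lt_mul_of_pos_right h2; positivity
      _ = (k * k ^ m) ^ l := by field_simp
      _ ≤ (k ^ n) ^ l := by gcongr
  exact_mod_cast hreal

theorem Hits.sub {n : ℕ} {α : Type*} {s : Finset α} {ρ : ℝ} {b : EuclideanSpace ℝ (Fin n)}
    {y : α → EuclideanSpace ℝ (Fin n)} (h : Hits s ρ b y) (v : EuclideanSpace ℝ (Fin n)) :
    Hits s ρ (b - v) (fun a => y a - v) := by
  obtain ⟨w, hw, hd⟩ := h
  refine ⟨w, hw, ?_⟩
  simp only [smul_sub, Finset.sum_sub_distrib]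
  rw [← Finset.sum_smul, hw.sum_eq_one, one_smul, dist_sub_right]
  exact hd

/-- The integer coordinates of the cube of side length `η` which contains the point `x`. After
magnification by `k / η`, this is a cube of side length `k`. -/
noncomputable def cell {n : ℕ} (η : ℝ) (x : EuclideanSpace ℝ (Fin n)) : Fin n → ℤ :=
  fun j => ⌊x j / η⌋

/-- Placement of a lattice point `p`, where `x p` is its position before magnification: the corner
of the magnified cell of `x p`, plus a grid vector which depends on the colour `χ p` only. -/
noncomputable def place {n Q k : ℕ} (η : ℝ) (x : (ℕ → ℤ) → EuclideanSpace ℝ (Fin n))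
    (χ : (ℕ → ℤ) → Fin Q) (f : Fin Q → Fin n → Fin k) (p : ℕ → ℤ) : EuclideanSpace ℝ (Fin n) :=
  (k : ℝ) • latticePoint (cell η (x p)) + gridPoint (f (χ p))

theorem norm_smul_latticePoint_cell_sub_le {n : ℕ} (k : ℕ) (η : ℝ) (x : EuclideanSpace ℝ (Fin n)) :
    ‖(k : ℝ) • latticePoint (cell η x) - (k / η) • x‖ ≤ n * k := by
  refine norm_le_of_forall_abs_le (Nat.cast_nonneg k) fun j => ?_
  have h1 : ((k : ℝ) • latticePoint (cell η x) - (k / η) • x) j = k * (⌊x j / η⌋ - x j / η) := by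
    simp only [latticePoint, cell, PiLp.sub_apply, PiLp.smul_apply, smul_eq_mul]
    ring
  rw [h1, abs_mul, Nat.abs_cast]
  have h2 : |(⌊x j / η⌋ : ℝ) - x j / η| ≤ 1 := by
    rw [abs_le]
    constructor <;> linarith [Int.floor_le (x j / η), Int.lt_floor_add_one (x j / η)]
  nlinarith [Nat.cast_nonneg (α := ℝ) k]

theorem norm_place_sub_le {n Q k : ℕ} (η : ℝ) (x : (ℕ → ℤ) → EuclideanSpace ℝ (Fin n))
    (χ : (ℕ → ℤ) → Fin Q) (f : Fin Q → Fin n → Fin k) (p : ℕ → ℤ) :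
    ‖place η x χ f p - (k / η) • x p‖ ≤ 2 * n * k := by
  have h1 : place η x χ f p - ((k : ℝ) / η) • x p =
      ((k : ℝ) • latticePoint (cell η (x p)) - (k / η) • x p) + gridPoint (f (χ p)) := by
    rw [place]; abel
  rw [h1]
  refine (norm_add_le _ _).trans ?_
  linarith [norm_smul_latticePoint_cell_sub_le k η (x p), norm_gridPoint_le (f (χ p))]

/-- If the union bound allows it, the grid vectors of the colours can be chosen such that fewer than
`l` members of a family of simplices meet a common ball, provided that no two members share a colour
and all vertices lie in cells close to the ball. Up to translation there are only finitely many
configurations of cells and colours, and finitely many balls, to be considered. -/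
theorem exists_place (n m : ℕ) (K₃ : ℕ) (ρ₀ : ℝ) :
    ∃ C : ℕ, ∀ {k Q l : ℕ} (η : ℝ) (x : (ℕ → ℤ) → EuclideanSpace ℝ (Fin n))
      (χ : (ℕ → ℤ) → Fin Q), 0 < k →
      k ^ n * (Q ^ (m + 1) * ((2 * K₃ + 1) ^ n) ^ (m + 1)).choose l * (C * k ^ m) ^ l <
        (k ^ n) ^ l →
      ∃ f : Fin Q → Fin n → Fin k, ∀ (b : EuclideanSpace ℝ (Fin n))
        (U : Finset (Finset (ℕ → ℤ))),
        (∀ υ ∈ U, υ.Nonempty ∧ υ.card ≤ m + 1) →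
        (∀ υ ∈ U, Hits υ ρ₀ b (place η x χ f)) →
        (∀ υ ∈ U, ∀ p ∈ υ, ∀ j, |cell η (x p) j - ⌊b j / k⌋| ≤ K₃) →
        (∀ υ ∈ U, ∀ υ' ∈ U, υ ≠ υ' → ∀ p ∈ υ, ∀ q ∈ υ', χ p ≠ χ q) → U.card < l := by
  classical
  obtain ⟨C, hC⟩ := exists_placement n m (n * K₃) (ρ₀ + n)
  refine ⟨C, fun {k Q l} η x χ hk hlt => ?_⟩
  obtain ⟨f, hf⟩ := hC k hk (ι := Fin Q)
    (J := (Fin (m + 1) → Fin Q) × (Fin (m + 1) → Fin n → Fin (2 * K₃ + 1)))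
    (fun j a => j.1 a)
    (fun j a => (k : ℝ) • latticePoint fun i => ((j.2 a i : ℕ) : ℤ) - K₃)
    (fun j a => by
      rw [norm_smul, Real.norm_of_nonneg (Nat.cast_nonneg k), mul_comm]
      gcongr
      refine norm_le_of_forall_abs_le (Nat.cast_nonneg K₃) fun i => ?_
      have h1 := (j.2 a i).2
      simp only [latticePoint]
      rw [← Int.cast_abs]
      have h2 : |((j.2 a i : ℕ) : ℤ) - K₃| ≤ K₃ := by
        rw [abs_le]
        constructor <;> omega
      exact_mod_cast h2)
    (Finset.univ.image fun y : Fin n → Fin k => gridPoint y) l (by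
      refine lt_of_le_of_lt ?_ hlt
      have h1 : (Finset.univ.image fun y : Fin n → Fin k => gridPoint y).card ≤ k ^ n := by
        refine Finset.card_image_le.trans ?_
        simp
      have h2 : Fintype.card ((Fin (m + 1) → Fin Q) × (Fin (m + 1) → Fin n → Fin (2 * K₃ + 1))) =
          Q ^ (m + 1) * ((2 * K₃ + 1) ^ n) ^ (m + 1) := by
        simp
      rw [h2]
      gcongr)
  refine ⟨f, fun b U hU hHits hcell hcol => ?_⟩
  have htup : ∀ υ : Finset (ℕ → ℤ), υ ∈ U → ∃ t : Fin (m + 1) → ℕ → ℤ, (∀ a, t a ∈ υ) ∧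
      ∀ p ∈ υ, ∃ a, t a = p := fun υ hυ => exists_surjective_tuple (hU υ hυ).1 (hU υ hυ).2
  choose! t ht htsurj using htup
  have hkR : (0 : ℝ) < k := by exact_mod_cast hk
  set z : Fin n → ℤ := fun j => ⌊b j / k⌋ with hz
  set J : Finset (ℕ → ℤ) → (Fin (m + 1) → Fin Q) × (Fin (m + 1) → Fin n → Fin (2 * K₃ + 1)) :=
    fun υ => (fun a => χ (t υ a),
      fun a i => Fin.ofNat (2 * K₃ + 1) (cell η (x (t υ a)) i - z i + K₃).toNat) with hJ
  have hJinj : Set.InjOn J U := by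
    intro υ hυ υ' hυ' h
    by_contra hne
    exact hcol υ hυ υ' hυ' hne _ (ht υ hυ 0) _ (ht υ' hυ' 0) (congr_fun (congrArg Prod.fst h) 0)
  -- translation by a multiple of `k` moves the centre of the ball to the cube of side `k` at the
  -- origin
  have hy : ∀ j, ⌊b j - k * z j⌋.toNat < k := by
    intro j
    have h1 : (z j : ℝ) ≤ b j / k := Int.floor_le _
    have h2 : b j / k < z j + 1 := Int.lt_floor_add_one _
    rw [div_lt_iff₀ hkR] at h2
    have h3 : ⌊b j - k * z j⌋ < (k : ℤ) := by
      rw [Int.floor_lt]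
      push_cast
      linarith
    omega
  set y : Fin n → Fin k := fun j => ⟨_, hy j⟩ with hydef
  have hby : dist (b - (k : ℝ) • latticePoint z) (gridPoint y) ≤ n := by
    have h1 : gridPoint y = latticePoint fun j => ⌊(b - (k : ℝ) • latticePoint z) j⌋ := by
      ext j
      have h2 : (b - (k : ℝ) • latticePoint z) j = b j - k * z j := by
        simp [latticePoint]
      have h3 : 0 ≤ ⌊b j - k * z j⌋ := by
        rw [Int.floor_nonneg]
        have h1 : (z j : ℝ) ≤ b j / k := Int.floor_le _
        rw [le_div_iff₀ hkR] at h1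
        linarith
      have h4 : ((⌊b j - k * z j⌋.toNat : ℕ) : ℤ) = ⌊b j - k * z j⌋ := Int.toNat_of_nonneg h3
      simp only [gridPoint, latticePoint, hydef] at h2 ⊢
      rw [h2]
      have h5 := congrArg (Int.cast (R := ℝ)) h4
      rw [Int.cast_natCast] at h5
      exact h5
    rw [h1]
    exact dist_latticePoint_floor_le _
  rw [← Finset.card_image_of_injOn hJinj]
  refine hf (gridPoint y) (Finset.mem_image_of_mem _ (Finset.mem_univ _)) _ ?_ ?_
  · intro j hj j' hj' hne a a'
    obtain ⟨υ, hυ, rfl⟩ := Finset.mem_image.1 hj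
    obtain ⟨υ', hυ', rfl⟩ := Finset.mem_image.1 hj'
    exact hcol υ hυ υ' hυ' (fun h => hne (by rw [h])) _ (ht υ hυ a) _ (ht υ' hυ' a')
  · intro j hj
    obtain ⟨υ, hυ, rfl⟩ := Finset.mem_image.1 hj
    have h1 := (((hHits υ hυ).sub ((k : ℝ) • latticePoint z)).mono (b' := gridPoint y)
      (ρ' := ρ₀ + n) (by linarith)).comp_tuple (ht υ hυ) (htsurj υ hυ)
    refine cast (congrArg _ ?_) h1
    funext a
    have h2 : ∀ i, (((cell η (x (t υ a)) i - z i + K₃).toNat % (2 * K₃ + 1) : ℕ) : ℤ) - K₃ =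
        cell η (x (t υ a)) i - z i := by
      intro i
      have h3 : |cell η (x (t υ a)) i - z i| ≤ K₃ := hcell υ hυ _ (ht υ hυ a) i
      rw [abs_le] at h3
      rw [Nat.mod_eq_of_lt (by omega)]
      omega
    simp only [hJ, place, Fin.val_ofNat, h2]
    have h4 : (latticePoint fun i => cell η (x (t υ a)) i - z i) =
        latticePoint (cell η (x (t υ a))) - latticePoint z := by
      ext i; simp [latticePoint]
    rw [h4, smul_sub]
    abel

set_option maxHeartbeats 1000000 in
/-- Placement of the vertices of a fine subdivision. The placement `x` by affine interpolation is
magnified by `k / η`, rounded to cells of side length `k`, and perturbed within the cells by random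
vectors which depend only on the colour of the vertex. As nearby vertices have different colours,
the simplices near a given ball are placed independently as long as they are disjoint, and there
are few of them; so all requirements can be met at once. -/
theorem exists_small_scale_placement {m n : ℕ} (hmn : m < n) {c : ℝ} (hc : 0 < c) :
    ∃ η c' : ℝ, 0 < η ∧ 0 < c' ∧ ∀ K ρ₀ : ℝ, 0 ≤ K → ∃ Λ₀ : ℝ,
      ∀ {M D k : ℕ} {R₁ Λ : ℝ} {F : Finset (Finset ℕ)} {g : ℕ → EuclideanSpace ℝ (Fin n)},
      Λ₀ ≤ Λ → 2 ≤ R₁ → R₁ ≤ D → (D : ℝ) ≤ 2 * R₁ →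
      η / 2 * Λ ^ (n + 1) ≤ k → (k : ℝ) ≤ η * Λ ^ (n + 1) →
      (∀ σ ∈ F, σ ⊆ Finset.range M ∧ σ.Nonempty ∧ σ.card ≤ m + 1) → (∀ σ ∈ F, IsThick c R₁ σ g) →
      (∀ σ ∈ F, ∀ υ, IsKuhn M D σ υ → υ.card ≤ m + 1) →
      (∀ b, ∀ G ⊆ F, (∀ σ ∈ G, Hits σ (2 * (m + 4)) b g) → (G.card : ℝ) ≤ K * Λ) →
      ∃ pos : (ℕ → ℤ) → EuclideanSpace ℝ (Fin n),
        (∀ σ ∈ F, ∀ p, IsPath M (D : ℤ) p → steps M p ⊆ σ → ‖pos p‖ ≤ k / η * R₁) ∧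
        (∀ σ ∈ F, ∀ υ, IsKuhn M D σ υ → ∀ h : (ℕ → ℤ) → ℝ, ∑ p ∈ υ, h p = 0 →
          ∀ p ∈ υ, c' * (k / η) * |h p| ≤ ‖∑ p ∈ υ, h p • pos p‖) ∧
        (∀ σ ∈ F, ∀ υ, IsKuhn M D σ υ → ∀ p ∈ υ, ∀ q ∈ υ,
          dist (pos p) (pos q) ≤ k / η * (m + 2)) ∧
        ∀ (b : EuclideanSpace ℝ (Fin n)) (U : Finset (Finset (ℕ → ℤ))),
          (∀ υ ∈ U, ∃ σ ∈ F, IsKuhn M D σ υ) → (∀ υ ∈ U, Hits υ ρ₀ b pos) →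
          (∀ υ ∈ U, ∀ υ' ∈ U, υ ≠ υ' → Disjoint υ υ') → U.card ≤ n * (n + 1) := by
  classical
  set c₁ : ℝ := c / (4 * (m + 1)) with hc₁
  have hc₁0 : 0 < c₁ := by positivity
  -- `c₁` is the thickness of the coarse simplices before magnification; rounding to cells of side
  -- length `η` costs at most half of it
  set η : ℝ := min c₁ 1 / (4 * (m + 1) * (n + 1)) with hη
  have hη0 : 0 < η := by positivity
  have hηmul : (m + 1) * ((n + 1) * η) = min c₁ 1 / 4 := by rw [hη]; field_simp
  have hηc : (m + 1) * (2 * n * η) ≤ c₁ / 2 := by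
    have h2 := min_le_left c₁ 1
    have h3 : ((m : ℝ) + 1) * (n * η) ≤ (m + 1) * ((n + 1) * η) := by gcongr; linarith
    linarith
  have hη1 : 2 * n * η ≤ 1 / 2 ∧ η ≤ 1 := by
    have h2 := min_le_right c₁ 1
    have h3 : ((n : ℝ) + 1) * η ≤ (m + 1) * ((n + 1) * η) := by
      have : (0 : ℝ) ≤ m * ((n + 1) * η) := by positivity
      linarith
    have h4 : 0 ≤ (n : ℝ) * η := by positivity
    constructor <;> linarith
  obtain ⟨N, hN⟩ := exists_coloring_near m n hc (2 * (m + 4))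
  set K₃ : ℕ := ⌈n + 1 + (m + 4) / η⌉₊ with hK₃
  refine ⟨η, c₁ / 2, hη0, by positivity, fun K ρ₀ hK => ?_⟩
  obtain ⟨C, hC⟩ := exists_place n m K₃ ρ₀
  set l := n * (n + 1) + 1 with hl
  set Γ : ℝ := K * N + 1 with hΓ
  have hΓ1 : 1 ≤ Γ := by
    have : 0 ≤ K * N := by positivity
    linarith
  set W : ℕ := ((2 * K₃ + 1) ^ n) ^ (m + 1) with hW
  refine ⟨max (max 1 (2 * ρ₀)) ((C * (Γ ^ (m + 1) * W) / (η / 2)) ^ l + 1),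
    fun {M D k R₁ Λ F g} hΛ hR hRD hDR hk1 hk2 hF hg hcard hcount => ?_⟩
  have hΛ1 : 1 ≤ Λ := (le_max_left _ _).trans ((le_max_left _ _).trans hΛ)
  have hΛρ : 2 * ρ₀ ≤ Λ := (le_max_right _ _).trans ((le_max_left _ _).trans hΛ)
  have hΛbig : (C * (Γ ^ (m + 1) * W) / (η / 2)) ^ l < Λ :=
    lt_of_lt_of_le (lt_add_one _) ((le_max_right _ _).trans hΛ)
  have hR0 : 0 < R₁ := by linarith
  have hD0 : 0 < D := by exact_mod_cast hR0.trans_le hRD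
  have hΛn : Λ ≤ Λ ^ (n + 1) := le_self_pow₀ hΛ1 (Nat.succ_ne_zero n)
  have hkR : (0 : ℝ) < k := lt_of_lt_of_le (by positivity) hk1
  have hk : 0 < k := by exact_mod_cast hkR
  set r : ℝ := k / η with hr
  have hr0 : 0 < r := by positivity
  have hkr : (k : ℝ) = η * r := by rw [hr]; field_simp
  have hrρ : ρ₀ ≤ r := by
    have : Λ ^ (n + 1) / 2 ≤ r := by
      rw [hr, le_div_iff₀ hη0]; linarith
    linarith
  obtain ⟨χ, hχ⟩ := hN (M := M) (K := K * Λ) (by positivity) hD0 hR0 hDR hF hg hcount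
  set x : (ℕ → ℤ) → EuclideanSpace ℝ (Fin n) :=
    fun p => pathPoint M g D (fun i => (p i : ℝ)) with hx
  have hQ : ((⌊K * Λ⌋₊ * N + 1 : ℕ) : ℝ) ≤ Γ * Λ := by
    have h1 : (⌊K * Λ⌋₊ : ℝ) ≤ K * Λ := Nat.floor_le (by positivity)
    have h2 : (⌊K * Λ⌋₊ : ℝ) * N ≤ K * Λ * N := by gcongr
    push_cast
    rw [hΓ]
    linarith
  obtain ⟨f, hf⟩ := hC η x χ hk (small_scale_union_bound hmn hΛ1 (half_pos hη0) hΓ1 hQ hk1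
    (hk2.trans (by nlinarith [hη1.2])) hl hΛbig)
  set pos := place η x χ f with hpos
  have hpert : ∀ p, ‖pos p - r • x p‖ ≤ 2 * n * η * r := fun p => by
    refine (norm_place_sub_le η x χ f p).trans ?_
    rw [hkr]
    linarith
  have hpert' : ∀ p, ‖pos p - r • x p‖ ≤ r / 2 := fun p =>
    (hpert p).trans (by nlinarith [hη1.1])
  have hdist : ∀ σ ∈ F, ∀ υ, IsKuhn M D σ υ → ∀ p ∈ υ, ∀ q ∈ υ,
      dist (pos p) (pos q) ≤ r * (m + 2) := by
    intro σ hσ υ hυ p hp q hq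
    obtain ⟨hσM, hσne, hσc⟩ := hF σ hσ
    have h1 : dist (r • x p) (r • x q) ≤ r * (m + 1) := by
      rw [dist_smul₀, Real.norm_of_nonneg hr0.le]
      exact mul_le_mul_of_nonneg_left ((hg σ hσ).dist_le hσM hσc hR0 hRD hυ hp hq) hr0.le
    have h2 := dist_triangle4 (pos p) (r • x p) (r • x q) (pos q)
    have h3 := hpert' p
    have h4 := hpert' q
    rw [← dist_eq_norm] at h3
    rw [← dist_eq_norm, dist_comm] at h4
    linarith
  refine ⟨pos, fun σ hσ p hp hpσ => ?_, fun σ hσ υ hυ h h0 p hp => ?_, hdist,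
    fun b U hU hHits hdis => ?_⟩
  · have h1 : ‖r • x p‖ ≤ r * (R₁ / 2) := by
      rw [norm_smul, Real.norm_of_nonneg hr0.le]
      exact mul_le_mul_of_nonneg_left ((hg σ hσ).norm_pathPoint_le (hF σ hσ).1 hD0 hp hpσ) hr0.le
    have h2 := norm_add_le (pos p - r • x p) (r • x p)
    rw [sub_add_cancel] at h2
    nlinarith [hpert' p]
  · obtain ⟨hσM, hσne, hσc⟩ := hF σ hσ
    have hbase : ∀ p ∈ υ, c₁ * r * |h p| ≤ ‖∑ p ∈ υ, h p • (r • x p)‖ := by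
      intro p hp
      have h1 := (hg σ hσ).le_norm_sum hσM hσc hc hR0 hD0 hDR hυ h0 p hp
      have h2 : ∑ p ∈ υ, h p • (r • x p) = r • ∑ p ∈ υ, h p • x p := by
        rw [Finset.smul_sum]
        exact Finset.sum_congr rfl fun p _ => smul_comm _ _ _
      rw [h2, norm_smul, Real.norm_of_nonneg hr0.le]
      calc c₁ * r * |h p| = r * (c₁ * |h p|) := by ring
        _ ≤ _ := mul_le_mul_of_nonneg_left h1 hr0.le
    have hη' : ((m + 1 : ℕ) : ℝ) * (2 * n * η * r) ≤ c₁ / 2 * r := by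
      calc ((m + 1 : ℕ) : ℝ) * (2 * n * η * r) = ((m + 1) * (2 * n * η)) * r := by push_cast; ring
        _ ≤ _ := by gcongr
    have h1 := coeff_bound_of_perturbation (hcard σ hσ υ hυ) (hη'.trans (by gcongr; linarith))
      (fun p _ => hpert p) hbase p hp
    refine le_trans ?_ h1
    gcongr
    linarith
  · -- all vertices of a simplex which meets the ball lie within distance `O(r)` from its centre
    have hnear : ∀ υ ∈ U, ∀ p ∈ υ, dist (r • x p) b ≤ r * (m + 4) := by
      intro υ hυ p hp
      obtain ⟨σ, hσ, hυK⟩ := hU υ hυ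
      obtain ⟨w, hw, hd⟩ := hHits υ hυ
      have h1 : dist (∑ q ∈ υ, w q • pos q) (pos p) ≤ r * (m + 2) :=
        hw.norm_sum_le fun q hq => hdist σ hσ υ hυK q hq p hp
      have h2 := dist_triangle4 (r • x p) (pos p) (∑ q ∈ υ, w q • pos q) b
      have h3 := hpert' p
      rw [← dist_eq_norm, dist_comm] at h3
      rw [dist_comm (pos p)] at h2
      linarith
    refine Nat.lt_succ_iff.1 (hf b U (fun υ hυ => ?_) hHits (fun υ hυ p hp j => ?_)
      fun υ hυ υ' hυ' hne p hp q hq => ?_)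
    · obtain ⟨σ, hσ, hυK⟩ := hU υ hυ
      exact ⟨hυK.nonempty, hcard σ hσ υ hυK⟩
    · have h1 : |(k : ℝ) * cell η (x p) j - b j| ≤ k * (n + (m + 4) / η) := by
        have h2 := abs_apply_le_norm ((k : ℝ) • latticePoint (cell η (x p)) - b) j
        have h3 := norm_smul_latticePoint_cell_sub_le k η (x p)
        have h4 := hnear υ hυ p hp
        rw [dist_eq_norm] at h4
        have h5 := norm_add_le ((k : ℝ) • latticePoint (cell η (x p)) - r • x p) (r • x p - b)
        rw [sub_add_sub_cancel] at h5
        have h6 : (k : ℝ) * (n + (m + 4) / η) = n * k + r * (m + 4) := by rw [hr]; ring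
        rw [h6]
        have h7 : ((k : ℝ) • latticePoint (cell η (x p)) - b) j = k * cell η (x p) j - b j := by
          simp [latticePoint]
        rw [h7] at h2
        linarith
      have h2 : |(cell η (x p) j : ℝ) - b j / k| ≤ n + (m + 4) / η := by
        have h3 : (k : ℝ) * cell η (x p) j - b j = k * (cell η (x p) j - b j / k) := by
          field_simp
        rw [h3, abs_mul, Nat.abs_cast] at h1
        exact le_of_mul_le_mul_left h1 hkR
      have h3 : (n : ℝ) + 1 + (m + 4) / η ≤ K₃ := Nat.le_ceil _
      have h4 : |((cell η (x p) j - ⌊b j / k⌋ : ℤ) : ℝ)| ≤ K₃ := by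
        rw [abs_le] at h2 ⊢
        push_cast
        constructor <;> linarith [Int.floor_le (b j / k), Int.lt_floor_add_one (b j / k)]
      exact_mod_cast h4
    · obtain ⟨σ, hσ, hυK⟩ := hU υ hυ
      obtain ⟨σ', hσ', hυK'⟩ := hU υ' hυ'
      refine hχ σ hσ σ' hσ' p q (hυK.isPath p hp) (hυK'.isPath q hq) (hυK.steps_subset p hp)
        (hυK'.steps_subset q hq) (fun h => ?_) ?_
      · exact Finset.disjoint_left.1 (hdis υ hυ υ' hυ' hne) hp (h ▸ hq)
      · have h1 := dist_triangle_right (r • x p) (r • x q) b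
        rw [dist_smul₀, Real.norm_of_nonneg hr0.le] at h1
        have h2 : r * dist (x p) (x q) ≤ r * (2 * (m + 4)) := by
          linarith [hnear υ hυ p hp, hnear υ' hυ' q hq]
        exact le_of_mul_le_mul_left h2 hr0

theorem VertexEnum.card_faces_le {E : Type*} [AddCommGroup E] [Module ℝ E]
    {X : SimplicialComplex ℝ E} (hX : X.faces.Finite) {e : VertexEnum X} :
    e.faces_finite.toFinset.card ≤ X.faces.ncard := by
  classical
  rw [Set.ncard_eq_toFinset_card _ hX]
  refine Finset.card_le_card_of_injOn (fun σ => σ.image e.v) (fun σ hσ => ?_) fun σ hσ σ' hσ' h =>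
    ?_
  · exact hX.mem_toFinset.2 (e.faces_finite.mem_toFinset.1 hσ).2
  · have h1 := (e.faces_finite.mem_toFinset.1 hσ).1
    have h2 := (e.faces_finite.mem_toFinset.1 hσ').1
    have key : ∀ {α β : Finset ℕ}, α ⊆ Finset.range e.M → β ⊆ Finset.range e.M →
        α.image e.v = β.image e.v → α ⊆ β := by
      intro α β hα hβ h i hi
      have : e.v i ∈ β.image e.v := h ▸ Finset.mem_image_of_mem _ hi
      obtain ⟨j, hj, hji⟩ := Finset.mem_image.1 this
      rwa [← e.inj (Set.mem_Iio.2 (Finset.mem_range.1 (hβ hj)))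
        (Set.mem_Iio.2 (Finset.mem_range.1 (hα hi))) hji]
    exact Finset.Subset.antisymm (key h1 h2 h) (key h2 h1 h.symm)

/-- A placement of the lattice points of height `D` under which every Kuhn simplex becomes a simplex
of thickness at least `c * r` and diameter at most `r * (m + 2)`. -/
structure VertexEnum.IsThickPlacement {E : Type*} [AddCommGroup E] [Module ℝ E]
    {X : SimplicialComplex ℝ E} (e : VertexEnum X) {n : ℕ} (D m : ℕ) (c r : ℝ)
    (pos : (ℕ → ℤ) → EuclideanSpace ℝ (Fin n)) : Prop where
  le_norm : ∀ σ ∈ e.faces, ∀ υ, IsKuhn e.M D σ υ → ∀ h : (ℕ → ℤ) → ℝ, ∑ p ∈ υ, h p = 0 →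
    ∀ p ∈ υ, c * r * |h p| ≤ ‖∑ p ∈ υ, h p • pos p‖
  dist_le : ∀ σ ∈ e.faces, ∀ υ, IsKuhn e.M D σ υ → ∀ p ∈ υ, ∀ q ∈ υ,
    dist (pos p) (pos q) ≤ r * (m + 2)

/-- Combination of the two scales: a subdivision at scale `R₁ = V ^ (1 / (n - m))` can be placed in
the ball of radius `R₁ * (log V) ^ (n + 1)` with simplices of size about `(log V) ^ (n + 1)`, so
that each ball of fixed radius meets a bounded number of them. -/
theorem exists_thick_placement (m n A B : ℕ) (hmn : m < n) :
    ∃ c : ℝ, 0 < c ∧ ∀ ρ₀ : ℝ, ∃ V₀ : ℝ, ∀ {E : Type*} [AddCommGroup E] [Module ℝ E]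
      {X : SimplicialComplex ℝ E} (e : VertexEnum X) (V : ℝ), V₀ ≤ V → DimLE X m → DegreeLE X A →
      X.faces.Finite → (X.faces.ncard : ℝ) ≤ B * V →
      ∃ (D : ℕ) (R₁ s r : ℝ) (pos : (ℕ → ℤ) → EuclideanSpace ℝ (Fin n)),
        radius m n V = R₁ * s ∧ m + 1 ≤ R₁ ∧ R₁ ≤ D ∧ D ≤ 2 * R₁ ∧ 1 ≤ s ∧ s / 2 ≤ r ∧ r ≤ s ∧
        e.IsThickPlacement D m c r pos ∧
        (∀ σ ∈ e.faces, ∀ p, IsPath e.M (D : ℤ) p → steps e.M p ⊆ σ → ‖pos p‖ ≤ r * R₁) ∧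
        ∀ (b : EuclideanSpace ℝ (Fin n)) (U : Finset (Finset (ℕ → ℤ))),
          (∀ υ ∈ U, ∃ σ ∈ e.faces, IsKuhn e.M D σ υ) → (∀ υ ∈ U, Hits υ ρ₀ b pos) →
          U.card ≤ n * (n + 1) * (m + 1) * (A * 2 ^ 5 ^ (m + 1)) := by
  obtain ⟨c, hc, hlarge⟩ := exists_large_scale_placement m n A B hmn
  obtain ⟨K, V₁, hK, hlarge⟩ := hlarge (2 * (m + 4)) (by positivity)
  obtain ⟨η, c', hη, hc', hsmall⟩ := exists_small_scale_placement hmn hc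
  refine ⟨c', hc', fun ρ₀ => ?_⟩
  obtain ⟨Λ₀, hsmall⟩ := hsmall K ρ₀ hK
  refine ⟨max (max V₁ (((m : ℝ) + 2) ^ (n - m))) (Real.exp (max (max 1 Λ₀) (2 / η))),
    fun {E} _ _ {X} e V hV hm hA hX hcard => ?_⟩
  have hVV₁ : V₁ ≤ V := (le_max_left _ _).trans ((le_max_left _ _).trans hV)
  have hVm : ((m : ℝ) + 2) ^ (n - m) ≤ V := (le_max_right _ _).trans ((le_max_left _ _).trans hV)
  have hVexp := (le_max_right _ _).trans hV
  have hV0 : 0 < V := lt_of_lt_of_le (by positivity) hVm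
  rw [← Real.le_log_iff_exp_le hV0] at hVexp
  set Λ := Real.log V with hΛ
  have hΛ1 : 1 ≤ Λ := (le_max_left _ _).trans ((le_max_left _ _).trans hVexp)
  have hΛ₀ : Λ₀ ≤ Λ := (le_max_right _ _).trans ((le_max_left _ _).trans hVexp)
  have hΛη : 2 / η ≤ Λ := (le_max_right _ _).trans hVexp
  set R₁ : ℝ := V ^ (1 / ((n : ℝ) - m)) with hR₁
  have hR0 : 0 ≤ R₁ := by positivity
  have hnm : n - m ≠ 0 := by omega
  have hR₁V : R₁ ^ (n - m) = V := by
    rw [hR₁, ← Real.rpow_natCast, ← Real.rpow_mul hV0.le, Nat.cast_sub hmn.le, one_div,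
      inv_mul_cancel₀, Real.rpow_one]
    have : (m : ℝ) < n := by exact_mod_cast hmn
    linarith
  have hRm : (m : ℝ) + 2 ≤ R₁ := by
    rw [← hR₁V] at hVm
    exact le_of_pow_le_pow_left₀ hnm hR0 hVm
  have hm0 : (0 : ℝ) ≤ m := Nat.cast_nonneg m
  set F := e.faces_finite.toFinset with hF
  have hFmem : ∀ σ, σ ∈ F ↔ σ ∈ e.faces := fun σ => e.faces_finite.mem_toFinset
  have hFp : ∀ σ ∈ F, σ ⊆ Finset.range e.M ∧ σ.Nonempty ∧ σ.card ≤ m + 1 := fun σ hσ =>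
    ⟨((hFmem σ).1 hσ).1, e.face_nonempty ((hFmem σ).1 hσ), e.card_le_of_dimLE hm ((hFmem σ).1 hσ)⟩
  obtain ⟨g, hg1, hg2, hg3⟩ := hlarge V R₁ e.M F hVV₁ hR0 hR₁V hFp
    (fun i => by
      obtain ⟨S, hS, hSc⟩ := e.exists_finset_faces_mem hA (i := i)
      exact ⟨S, hSc, fun σ hσ hi => (hS σ).2 ⟨(hFmem σ).1 hσ, hi⟩⟩)
    (fun σ hσ i hi j hj => by
      refine (hFmem _).2 (e.down_closed ((hFmem σ).1 hσ) (fun x hx => ?_) ⟨i, by simp⟩)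
      rcases Finset.mem_insert.1 hx with rfl | hx
      · exact hi
      · rw [Finset.mem_singleton.1 hx]; exact hj)
    (le_trans (by exact_mod_cast e.card_faces_le hX) hcard)
  set s : ℝ := Λ ^ (n + 1) with hs
  have hs1 : Λ ≤ s := le_self_pow₀ hΛ1 (Nat.succ_ne_zero n)
  set k := ⌊η * s⌋₊ with hk
  have hks : 2 ≤ η * s := by
    rw [div_le_iff₀ hη] at hΛη
    nlinarith
  have hk_le : (k : ℝ) ≤ η * s := Nat.floor_le (by linarith)
  have hk_ge : η / 2 * s ≤ k := by
    have := Nat.lt_floor_add_one (η * s)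
    rw [← hk] at this
    linarith
  set D := ⌈R₁⌉₊ with hD
  have hD1 : R₁ ≤ D := Nat.le_ceil _
  have hD2 : (D : ℝ) ≤ 2 * R₁ := by
    have := Nat.ceil_lt_add_one hR0
    rw [← hD] at this
    linarith
  have hD0 : 0 < D := by
    have : (0 : ℝ) < D := by linarith
    exact_mod_cast this
  obtain ⟨pos, h1, h2, h3, h4⟩ := hsmall (M := e.M) (F := F) (g := g) hΛ₀ (by linarith : 2 ≤ R₁)
    hD1 hD2 hk_ge hk_le hFp (fun σ hσ => ⟨hg1 σ hσ, hg2 σ hσ⟩)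
    (fun σ hσ υ hυ => (e.card_le_of_isKuhn hD0 ((hFmem σ).1 hσ) hυ).trans (hFp σ hσ).2.2) hg3
  refine ⟨D, R₁, s, k / η, pos, rfl, by linarith, hD1, hD2, by linarith, ?_, ?_,
    ⟨fun σ hσ => h2 σ ((hFmem σ).2 hσ), fun σ hσ => h3 σ ((hFmem σ).2 hσ)⟩,
    fun σ hσ => h1 σ ((hFmem σ).2 hσ), fun b U hU hHits => ?_⟩
  · rw [le_div_iff₀ hη]; linarith
  · rw [div_le_iff₀ hη]; linarith
  · refine card_le_of_disjoint_lt (fun υ hυ => ?_) (fun υ hυ => ?_) (fun p => ?_)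
      fun G hG hdis => ?_
    · obtain ⟨σ, hσ, h⟩ := hU υ hυ
      exact h.nonempty
    · obtain ⟨σ, hσ, h⟩ := hU υ hυ
      exact (e.card_le_of_isKuhn hD0 hσ h).trans (e.card_le_of_dimLE hm hσ)
    · obtain ⟨S, hS, hSc⟩ := e.exists_finset_isKuhn_mem_face hD0 hm hA p
      refine ⟨S, hSc, fun υ hυ hp => ?_⟩
      obtain ⟨σ, hσ, h⟩ := hU υ hυ
      exact hS σ hσ υ h hp
    · refine h4 b G (fun υ hυ => ?_) (fun υ hυ => hHits υ (hG hυ)) hdis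
      obtain ⟨σ, hσ, h⟩ := hU υ (hG hυ)
      exact ⟨σ, (hFmem σ).2 hσ, h⟩

/-! ### The map defined by a placement -/

/-- Each simplex of a finer Kuhn subdivision lies in a simplex of the coarser one; linear relations
among its vertices and their images in terms of the vertices of the latter control each other. -/
theorem IsKuhn.exists_coarsening {M D₁ D₂ : ℕ} (hD₂ : 0 < D₂) {σ : Finset ℕ}
    {τ : Finset (ℕ → ℤ)} (hτ : IsKuhn M (D₁ * D₂) σ τ) :
    ∃ υ, IsKuhn M D₁ σ υ ∧ ∃ w : (ℕ → ℤ) → (ℕ → ℤ) → ℝ, (∀ p ∈ τ, IsWeight υ (w p)) ∧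
      (∀ p ∈ τ, ∀ i, D₂ * ∑ P ∈ υ, w p P * (P i : ℝ) = p i) ∧
      ∀ h : (ℕ → ℤ) → ℝ, ∑ p ∈ τ, h p = 0 →
        (∀ P ∈ υ, |∑ p ∈ τ, h p * w p P| ≤ 2 / D₂ * ∑ p ∈ τ, |h p|) ∧
        ∀ p ∈ τ, |h p| ≤ 2 * D₂ * ∑ P ∈ υ, |∑ p ∈ τ, h p * w p P| := by
  obtain ⟨υ, hne, hchain, hυ, w, hw⟩ := IsChainOne.exists_refinement (D₁ := (D₁ : ℤ)) hD₂ hτ.chain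
    hτ.nonempty (fun p hp => by simpa using hτ.isPath p hp) hτ.steps_subset
  have hDR : (0 : ℝ) < D₂ := by exact_mod_cast hD₂
  refine ⟨υ, ⟨hne, fun P hP => (hυ P hP).1, hchain, fun P hP => (hυ P hP).2⟩, w,
    fun p hp => ⟨(hw p hp).1, (hw p hp).2.1, (hw p hp).2.2.1⟩, fun p hp => (hw p hp).2.2.2,
    fun h h0 => ?_⟩
  have hk0 : ∑ P ∈ υ, ∑ p ∈ τ, h p * w p P = 0 := by
    rw [Finset.sum_comm, ← h0]
    refine Finset.sum_congr rfl fun p hp => ?_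
    rw [← Finset.mul_sum, (hw p hp).2.2.1, mul_one]
  have hki : ∀ i, D₂ * ∑ P ∈ υ, (∑ p ∈ τ, h p * w p P) * (P i : ℝ) = ∑ p ∈ τ, h p * (p i : ℝ) := by
    intro i
    simp only [Finset.sum_mul]
    rw [Finset.sum_comm, Finset.mul_sum]
    refine Finset.sum_congr rfl fun p hp => ?_
    rw [← (hw p hp).2.2.2 i, Finset.mul_sum, Finset.mul_sum, Finset.mul_sum]
    exact Finset.sum_congr rfl fun P _ => by ring
  constructor
  · intro P hP
    have h1 : ∀ i, |∑ P ∈ υ, (∑ p ∈ τ, h p * w p P) * (P i : ℝ)| ≤ 1 / D₂ * ∑ p ∈ τ, |h p| := by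
      intro i
      have h2 := hτ.chain.abs_sum_le h0 i
      rw [← hki, abs_mul, abs_of_pos hDR] at h2
      rw [one_div, inv_mul_eq_div, le_div_iff₀ hDR, mul_comm]
      exact h2
    have h2 := hchain.abs_coeff_le hk0
      (mul_nonneg (by positivity) (Finset.sum_nonneg fun p _ => abs_nonneg (h p))) h1 hP
    refine h2.trans (le_of_eq ?_)
    ring
  · intro p hp
    have h1 : ∀ i, |∑ p ∈ τ, h p * (p i : ℝ)| ≤ D₂ * ∑ P ∈ υ, |∑ p ∈ τ, h p * w p P| := by
      intro i
      rw [← hki, abs_mul, abs_of_pos hDR]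
      exact mul_le_mul_of_nonneg_left (hchain.abs_sum_le hk0 i) hDR.le
    have h2 := hτ.chain.abs_coeff_le h0
      (mul_nonneg hDR.le (Finset.sum_nonneg fun P _ => abs_nonneg _)) h1 hp
    linarith

namespace VertexEnum
variable {E : Type*} [AddCommGroup E] [Module ℝ E] {X : SimplicialComplex ℝ E} {e : VertexEnum X}
  {n m : ℕ}

open Classical in
variable (e) in
/-- The map which extends a placement of the lattice points of height `D` linearly over each simplex
of the Kuhn subdivision; it takes the value `0` outside the underlying space. -/
noncomputable def extend (D : ℕ) (pos : (ℕ → ℤ) → EuclideanSpace ℝ (Fin n)) (x : E) :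
    EuclideanSpace ℝ (Fin n) :=
  if h : ∃ y : Finset (ℕ → ℤ) × ((ℕ → ℤ) → ℝ), (∃ σ ∈ e.faces, IsKuhn e.M D σ y.1) ∧
    IsWeight y.1 y.2 ∧ ∑ p ∈ y.1, y.2 p • e.point D p = x
  then ∑ p ∈ h.choose.1, h.choose.2 p • pos p else 0

theorem extend_sum {D : ℕ} (hD : 0 < D) (pos : (ℕ → ℤ) → EuclideanSpace ℝ (Fin n)) {σ : Finset ℕ}
    (hσ : σ ∈ e.faces) {υ : Finset (ℕ → ℤ)} (hυ : IsKuhn e.M D σ υ) {w : (ℕ → ℤ) → ℝ}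
    (hw : IsWeight υ w) :
    e.extend D pos (∑ p ∈ υ, w p • e.point D p) = ∑ p ∈ υ, w p • pos p := by
  classical
  have h : ∃ y : Finset (ℕ → ℤ) × ((ℕ → ℤ) → ℝ), (∃ σ ∈ e.faces, IsKuhn e.M D σ y.1) ∧
      IsWeight y.1 y.2 ∧ ∑ p ∈ y.1, y.2 p • e.point D p = ∑ p ∈ υ, w p • e.point D p :=
    ⟨(υ, w), ⟨σ, hσ, hυ⟩, hw, rfl⟩
  rw [extend, dif_pos h]
  obtain ⟨⟨σ', hσ', hυ'⟩, hw', heq⟩ := h.choose_spec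
  have hww := kuhn_weights_unique hD hσ' hσ hυ' hυ hw' hw heq
  rw [hww] at hw' ⊢
  have h1 : ∀ p ∈ h.choose.1 ∪ υ, p ∉ h.choose.1 → w p • pos p = 0 := fun p _ hp => by
    rw [hw'.eq_zero p hp, zero_smul]
  have h2 : ∀ p ∈ h.choose.1 ∪ υ, p ∉ υ → w p • pos p = 0 := fun p _ hp => by
    rw [hw.eq_zero p hp, zero_smul]
  rw [Finset.sum_subset Finset.subset_union_left h1, Finset.sum_subset Finset.subset_union_right h2]

theorem point_mul {D₁ D₂ : ℕ} (hD₂ : 0 < D₂) {υ : Finset (ℕ → ℤ)} {w : (ℕ → ℤ) → ℝ} {p : ℕ → ℤ}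
    (hp : ∀ i, D₂ * ∑ P ∈ υ, w P * (P i : ℝ) = p i) :
    e.point (D₁ * D₂) p = ∑ P ∈ υ, w P • e.point D₁ P := by
  rw [sum_smul_point, point, ← pathPoint_mul e.M e.v D₁ (c := (D₂ : ℝ)) (by positivity)]
  simp only [hp, Nat.cast_mul]

/-- The value of the map at a point of a fine simplex, in terms of the vertices of the coarse
simplex containing it. -/
theorem extend_fine {D₁ D₂ : ℕ} (hD₁ : 0 < D₁) (hD₂ : 0 < D₂)
    (pos : (ℕ → ℤ) → EuclideanSpace ℝ (Fin n)) {σ : Finset ℕ} (hσ : σ ∈ e.faces)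
    {υ τ : Finset (ℕ → ℤ)} (hυ : IsKuhn e.M D₁ σ υ) {w : (ℕ → ℤ) → (ℕ → ℤ) → ℝ}
    (hw : ∀ p ∈ τ, IsWeight υ (w p)) (hwp : ∀ p ∈ τ, ∀ i, D₂ * ∑ P ∈ υ, w p P * (P i : ℝ) = p i)
    {u : (ℕ → ℤ) → ℝ} (hu : IsWeight τ u) :
    IsWeight υ (fun P => ∑ p ∈ τ, u p * w p P) ∧
    e.extend D₁ pos (∑ p ∈ τ, u p • e.point (D₁ * D₂) p) =
      ∑ P ∈ υ, (∑ p ∈ τ, u p * w p P) • pos P := by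
  have hW : IsWeight υ (fun P => ∑ p ∈ τ, u p * w p P) := by
    refine ⟨fun P => Finset.sum_nonneg fun p hp => mul_nonneg (hu.nonneg p) ((hw p hp).nonneg P),
      fun P hP => Finset.sum_eq_zero fun p hp => by rw [(hw p hp).eq_zero P hP, mul_zero], ?_⟩
    rw [Finset.sum_comm, ← hu.sum_eq_one]
    refine Finset.sum_congr rfl fun p hp => ?_
    rw [← Finset.mul_sum, (hw p hp).sum_eq_one, mul_one]
  refine ⟨hW, ?_⟩
  rw [← extend_sum hD₁ pos hσ hυ hW]
  congr 1
  rw [Finset.sum_congr rfl fun p hp => by rw [point_mul hD₂ (hwp p hp)]]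
  simp only [Finset.smul_sum, Finset.sum_smul, smul_smul]
  rw [Finset.sum_comm]

end VertexEnum

theorem abs_sub_le_unitSimplexDist {E : Type*} {s : Finset E} {w w' : E → ℝ} {x : E} (hx : x ∈ s) :
    |w x - w' x| ≤ 2 * unitSimplexDist s w w' := by
  unfold unitSimplexDist
  have h1 : (w x - w' x) ^ 2 ≤ ∑ v ∈ s, (w v - w' v) ^ 2 :=
    Finset.single_le_sum (f := fun v => (w v - w' v) ^ 2) (fun v _ => sq_nonneg _) hx
  have h2 := Real.sq_sqrt (show 0 ≤ (∑ v ∈ s, (w v - w' v) ^ 2) / 2 by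
    have := sq_nonneg (w x - w' x)
    linarith)
  refine abs_le_of_sq_le_sq ?_ (by positivity)
  nlinarith [sq_nonneg (w x - w' x)]

theorem unitSimplexDist_le_of_forall_abs_le {E : Type*} {s : Finset E} {w w' : E → ℝ} {m : ℕ}
    (hs : s.card ≤ m + 1) {y : ℝ} (hy : 0 ≤ y) (h : ∀ x ∈ s, |w x - w' x| ≤ y) :
    unitSimplexDist s w w' ≤ (m + 1) * y := by
  unfold unitSimplexDist
  rw [Real.sqrt_le_left (by positivity)]
  have h1 : ∑ v ∈ s, (w v - w' v) ^ 2 ≤ ∑ _v ∈ s, y ^ 2 := Finset.sum_le_sum fun v hv => by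
    rw [← sq_abs]
    exact pow_le_pow_left₀ (abs_nonneg _) (h v hv) 2
  rw [Finset.sum_const, nsmul_eq_mul] at h1
  have h2 : (s.card : ℝ) ≤ m + 1 := by exact_mod_cast hs
  have h3 : (s.card : ℝ) * y ^ 2 ≤ (m + 1) * y ^ 2 := by gcongr
  have h4 : ((m : ℝ) + 1) * y ^ 2 ≤ (m + 1) ^ 2 * y ^ 2 := by
    gcongr
    have : (0 : ℝ) ≤ m := Nat.cast_nonneg m
    nlinarith
  have : 0 ≤ ((m : ℝ) + 1) * y ^ 2 := by positivity
  rw [mul_pow]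
  linarith

/-! ### Bilipschitz and coarseness bounds -/

namespace VertexEnum
variable {E : Type*} [AddCommGroup E] [Module ℝ E] {X : SimplicialComplex ℝ E} {e : VertexEnum X}
  {n m : ℕ}

theorem IsThickPlacement.norm_sum_le {D : ℕ} {c r : ℝ} {pos : (ℕ → ℤ) → EuclideanSpace ℝ (Fin n)}
    (hpos : e.IsThickPlacement D m c r pos) {σ : Finset ℕ} (hσ : σ ∈ e.faces)
    {υ : Finset (ℕ → ℤ)} (hυ : IsKuhn e.M D σ υ) {k : (ℕ → ℤ) → ℝ} (hk : ∑ P ∈ υ, k P = 0) :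
    ‖∑ P ∈ υ, k P • pos P‖ ≤ (∑ P ∈ υ, |k P|) * (r * (m + 2)) := by
  obtain ⟨P₀, hP₀⟩ := hυ.nonempty
  have h1 : ∑ P ∈ υ, k P • pos P = ∑ P ∈ υ, k P • (pos P - pos P₀) := by
    simp only [smul_sub, Finset.sum_sub_distrib]
    rw [← Finset.sum_smul, hk, zero_smul, sub_zero]
  rw [h1, Finset.sum_mul]
  refine (_root_.norm_sum_le _ _).trans (Finset.sum_le_sum fun P hP => ?_)
  rw [norm_smul, Real.norm_eq_abs, ← dist_eq_norm]
  exact mul_le_mul_of_nonneg_left (hpos.dist_le σ hσ υ hυ P hP P₀ hP₀) (abs_nonneg _)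

theorem IsThickPlacement.sum_abs_le {D : ℕ} (hD : 0 < D) {c r : ℝ} (hc : 0 < c)
    (hm : DimLE X m) {pos : (ℕ → ℤ) → EuclideanSpace ℝ (Fin n)}
    (hpos : e.IsThickPlacement D m c r pos) {σ : Finset ℕ} (hσ : σ ∈ e.faces)
    {υ : Finset (ℕ → ℤ)} (hυ : IsKuhn e.M D σ υ) {k : (ℕ → ℤ) → ℝ} (hk : ∑ P ∈ υ, k P = 0) :
    r * ∑ P ∈ υ, |k P| ≤ (m + 1) / c * ‖∑ P ∈ υ, k P • pos P‖ := by
  have hcard : (υ.card : ℝ) ≤ m + 1 := by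
    exact_mod_cast (card_le_of_isKuhn hD hσ hυ).trans (card_le_of_dimLE hm hσ)
  rw [Finset.mul_sum]
  calc ∑ P ∈ υ, r * |k P| ≤ ∑ _P ∈ υ, ‖∑ P ∈ υ, k P • pos P‖ / c := by
        refine Finset.sum_le_sum fun P hP => ?_
        rw [le_div_iff₀ hc]
        have := hpos.le_norm σ hσ υ hυ k hk P hP
        linarith
    _ = υ.card * (‖∑ P ∈ υ, k P • pos P‖ / c) := by rw [Finset.sum_const, nsmul_eq_mul]
    _ ≤ (m + 1) * (‖∑ P ∈ υ, k P • pos P‖ / c) := by gcongr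
    _ = _ := by ring

/-- The bilipschitz constant of the map on the simplices of the fine subdivision. -/
noncomputable def bilipConst (m : ℕ) (c : ℝ) : ℝ :=
  4 * (m + 1) ^ 2 * (m + 2) + 8 * (m + 1) ^ 2 / c

theorem bilipConst_nonneg (m : ℕ) {c : ℝ} (hc : 0 < c) : 0 ≤ bilipConst m c := by
  unfold bilipConst
  positivity

/-- If the second subdivision has as many steps as the size of the simplices of a thick placement,
the map is bilipschitz on each simplex of the result. -/
theorem bilipschitzOnSimplex_extend {D₁ D₂ : ℕ} (hD₁ : 0 < D₁) (hD₂ : 0 < D₂) {c r : ℝ}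
    (hc : 0 < c) (hr : 0 < r) (hr1 : r ≤ D₂) (hr2 : D₂ ≤ 4 * r) (hm : DimLE X m)
    {pos : (ℕ → ℤ) → EuclideanSpace ℝ (Fin n)} (hpos : e.IsThickPlacement D₁ m c r pos)
    {t : Finset E} (ht : t ∈ (e.subdivision (D₁ * D₂) (Nat.mul_pos hD₁ hD₂)).faces) :
    BilipschitzOnSimplex (bilipConst m c) (e.extend D₁ pos) t := by
  classical
  have hD := Nat.mul_pos hD₁ hD₂
  have hDR : (0 : ℝ) < D₂ := by exact_mod_cast hD₂
  obtain ⟨σ, hσ, τ, hτ, rfl⟩ := mem_subdivision_faces.1 ht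
  intro w w' hw hw'
  have hinj := injOn_point hD hσ hτ
  obtain ⟨υ, hυ, q, hq, hqp, hbound⟩ := hτ.exists_coarsening hD₂
  have hweight : ∀ {w : E → ℝ}, IsBarycentric (τ.image (e.point (D₁ * D₂))) w →
      IsWeight τ (fun p => if p ∈ τ then w (e.point (D₁ * D₂) p) else 0) ∧
      ∑ v ∈ τ.image (e.point (D₁ * D₂)), w v • v =
        ∑ p ∈ τ, (if p ∈ τ then w (e.point (D₁ * D₂) p) else 0) • e.point (D₁ * D₂) p := by
    intro w hw
    refine ⟨⟨fun p => ?_, fun p hp => if_neg hp, ?_⟩, ?_⟩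
    · split_ifs with h
      · exact hw.1 _ (Finset.mem_image_of_mem _ h)
      · exact le_rfl
    · rw [← hw.2, Finset.sum_image hinj]
      exact Finset.sum_congr rfl fun p hp => if_pos hp
    · rw [Finset.sum_image hinj]
      exact Finset.sum_congr rfl fun p hp => by rw [if_pos hp]
  obtain ⟨hu, hus⟩ := hweight hw
  obtain ⟨hu', hus'⟩ := hweight hw'
  rw [hus, hus', (extend_fine hD₁ hD₂ pos hσ hυ hq hqp hu).2,
    (extend_fine hD₁ hD₂ pos hσ hυ hq hqp hu').2]
  set u : (ℕ → ℤ) → ℝ := fun p => if p ∈ τ then w (e.point (D₁ * D₂) p) else 0 with hudef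
  set u' : (ℕ → ℤ) → ℝ := fun p => if p ∈ τ then w' (e.point (D₁ * D₂) p) else 0 with hudef'
  set d := unitSimplexDist (τ.image (e.point (D₁ * D₂))) w w' with hd
  have hd0 : 0 ≤ d := unitSimplexDist_nonneg _ _ _
  have hτcard : τ.card ≤ m + 1 := (card_le_of_isKuhn hD hσ hτ).trans (card_le_of_dimLE hm hσ)
  have hυcard : υ.card ≤ m + 1 := (card_le_of_isKuhn hD₁ hσ hυ).trans (card_le_of_dimLE hm hσ)
  have h0 : ∑ p ∈ τ, (u p - u' p) = 0 := by
    rw [Finset.sum_sub_distrib, hu.sum_eq_one, hu'.sum_eq_one, sub_self]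
  obtain ⟨hb1, hb2⟩ := hbound (fun p => u p - u' p) h0
  set k : (ℕ → ℤ) → ℝ := fun P => ∑ p ∈ τ, (u p - u' p) * q p P with hk
  have hk0 : ∑ P ∈ υ, k P = 0 := by
    simp only [hk]
    rw [Finset.sum_comm, ← h0]
    refine Finset.sum_congr rfl fun p hp => ?_
    rw [← Finset.mul_sum, (hq p hp).sum_eq_one, mul_one]
  have hdist : dist (∑ P ∈ υ, (∑ p ∈ τ, u p * q p P) • pos P)
      (∑ P ∈ υ, (∑ p ∈ τ, u' p * q p P) • pos P) = ‖∑ P ∈ υ, k P • pos P‖ := by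
    rw [dist_eq_norm, ← Finset.sum_sub_distrib]
    congr 1
    refine Finset.sum_congr rfl fun P _ => ?_
    rw [← sub_smul, ← Finset.sum_sub_distrib]
    simp only [hk, sub_mul]
  rw [hdist]
  set x := ‖∑ P ∈ υ, k P • pos P‖ with hx
  have hx0 : 0 ≤ x := norm_nonneg _
  have hm0 : (0 : ℝ) ≤ m := Nat.cast_nonneg m
  constructor
  · have h1 : ∑ p ∈ τ, |u p - u' p| ≤ (m + 1) * (2 * d) := by
      calc ∑ p ∈ τ, |u p - u' p| ≤ ∑ _p ∈ τ, 2 * d := Finset.sum_le_sum fun p hp => by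
            simp only [hudef, hudef', if_pos hp]
            exact abs_sub_le_unitSimplexDist (Finset.mem_image_of_mem _ hp)
        _ = τ.card * (2 * d) := by rw [Finset.sum_const, nsmul_eq_mul]
        _ ≤ ((m + 1 : ℕ) : ℝ) * (2 * d) := by gcongr
        _ = _ := by push_cast; ring
    have h2 : ∑ P ∈ υ, |k P| ≤ (m + 1) * (2 / D₂ * ((m + 1) * (2 * d))) := by
      calc ∑ P ∈ υ, |k P| ≤ ∑ _P ∈ υ, 2 / (D₂ : ℝ) * ((m + 1) * (2 * d)) :=
            Finset.sum_le_sum fun P hP => (hb1 P hP).trans (by gcongr)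
        _ = υ.card * (2 / D₂ * ((m + 1) * (2 * d))) := by rw [Finset.sum_const, nsmul_eq_mul]
        _ ≤ ((m + 1 : ℕ) : ℝ) * (2 / D₂ * ((m + 1) * (2 * d))) := by gcongr
        _ = _ := by push_cast; ring
    calc x ≤ (∑ P ∈ υ, |k P|) * (r * (m + 2)) := hpos.norm_sum_le hσ hυ hk0
      _ ≤ ((m + 1) * (2 / D₂ * ((m + 1) * (2 * d)))) * (D₂ * (m + 2)) := by gcongr
      _ = 4 * (m + 1) ^ 2 * (m + 2) * d := by field_simp; ring
      _ ≤ bilipConst m c * d := by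
          refine mul_le_mul_of_nonneg_right ?_ hd0
          have : 0 ≤ 8 * ((m : ℝ) + 1) ^ 2 / c := by positivity
          unfold bilipConst
          linarith
  · have h1 := hpos.sum_abs_le hD₁ hc hm hσ hυ hk0
    have h2 : ∀ p ∈ τ, |u p - u' p| ≤ 8 * ((m + 1) / c * x) := by
      intro p hp
      refine (hb2 p hp).trans ?_
      have h3 : 0 ≤ ∑ P ∈ υ, |k P| := Finset.sum_nonneg fun P _ => abs_nonneg _
      calc 2 * (D₂ : ℝ) * ∑ P ∈ υ, |k P| ≤ 2 * (4 * r) * ∑ P ∈ υ, |k P| := by gcongr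
        _ = 8 * (r * ∑ P ∈ υ, |k P|) := by ring
        _ ≤ _ := by gcongr
    have h4 : d ≤ (m + 1) * (8 * ((m + 1) / c * x)) := by
      refine unitSimplexDist_le_of_forall_abs_le (Finset.card_image_le.trans hτcard)
        (by positivity) fun v hv => ?_
      obtain ⟨p, hp, rfl⟩ := Finset.mem_image.1 hv
      have := h2 p hp
      simpa only [hudef, hudef', if_pos hp] using this
    calc d ≤ (m + 1) * (8 * ((m + 1) / c * x)) := h4
      _ = 8 * (m + 1) ^ 2 / c * x := by ring
      _ ≤ bilipConst m c * x := by
          refine mul_le_mul_of_nonneg_right ?_ hx0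
          have : 0 ≤ 4 * ((m : ℝ) + 1) ^ 2 * (m + 2) := by positivity
          unfold bilipConst
          linarith

theorem extend_mem_closedBall {D₁ D₂ : ℕ} (hD₁ : 0 < D₁) (hD₂ : 0 < D₂)
    {pos : (ℕ → ℤ) → EuclideanSpace ℝ (Fin n)} {R : ℝ}
    (hpos : ∀ σ ∈ e.faces, ∀ p, IsPath e.M (D₁ : ℤ) p → steps e.M p ⊆ σ → ‖pos p‖ ≤ R) {x : E}
    (hx : x ∈ (e.subdivision (D₁ * D₂) (Nat.mul_pos hD₁ hD₂)).space) :
    e.extend D₁ pos x ∈ Metric.closedBall 0 R := by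
  classical
  obtain ⟨t, ht, hxt⟩ := SimplicialComplex.mem_space_iff.1 hx
  obtain ⟨σ, hσ, τ, hτ, rfl⟩ := mem_subdivision_faces.1 ht
  obtain ⟨υ, hυ, q, hq, hqp, -⟩ := hτ.exists_coarsening hD₂
  obtain ⟨u, hu, rfl⟩ := (mem_convexHull_image_point (Nat.mul_pos hD₁ hD₂) hσ hτ).1 hxt
  obtain ⟨h1, h2⟩ := extend_fine hD₁ hD₂ pos hσ hυ hq hqp hu
  rw [h2]
  exact Metric.mem_closedBall.2 (h1.norm_sum_le fun P hP => by
    rw [dist_zero_right]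
    exact hpos σ hσ P (hυ.isPath P hP) (hυ.steps_subset P hP))

/-- The images of different vertices of the fine subdivision which lie in a common coarse simplex
are separated. -/
theorem le_dist_extend_point {D₁ D₂ : ℕ} (hD₁ : 0 < D₁) (hD₂ : 0 < D₂) {c r : ℝ}
    (hc : 0 < c) (hr : 0 < r) (hr2 : D₂ ≤ 4 * r) (hm : DimLE X m)
    {pos : (ℕ → ℤ) → EuclideanSpace ℝ (Fin n)} (hpos : e.IsThickPlacement D₁ m c r pos)
    {σ : Finset ℕ} (hσ : σ ∈ e.faces) {υ : Finset (ℕ → ℤ)} (hυ : IsKuhn e.M D₁ σ υ)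
    {p p' : ℕ → ℤ} {W W' : (ℕ → ℤ) → ℝ} (hW : IsWeight υ W) (hW' : IsWeight υ W')
    (hp : ∀ i, D₂ * ∑ P ∈ υ, W P * (P i : ℝ) = p i)
    (hp' : ∀ i, D₂ * ∑ P ∈ υ, W' P * (P i : ℝ) = p' i) (hne : p ≠ p') :
    c / (4 * (m + 1)) ≤
      dist (e.extend D₁ pos (e.point (D₁ * D₂) p)) (e.extend D₁ pos (e.point (D₁ * D₂) p')) := by
  have hDR : (0 : ℝ) < D₂ := by exact_mod_cast hD₂
  rw [point_mul hD₂ hp, point_mul hD₂ hp', extend_sum hD₁ pos hσ hυ hW,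
    extend_sum hD₁ pos hσ hυ hW', dist_eq_norm, ← Finset.sum_sub_distrib,
    Finset.sum_congr rfl fun P _ => (sub_smul (W P) (W' P) (pos P)).symm]
  have h0 : ∑ P ∈ υ, (W P - W' P) = 0 := by
    rw [Finset.sum_sub_distrib, hW.sum_eq_one, hW'.sum_eq_one, sub_self]
  obtain ⟨i, hi⟩ := Function.ne_iff.1 hne
  have h1 : (1 : ℝ) ≤ |(p i : ℝ) - p' i| := by
    have := Int.one_le_abs (sub_ne_zero.2 hi)
    exact_mod_cast this
  have h2 := hυ.chain.abs_sum_le h0 i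
  have h3 : (p i : ℝ) - p' i = D₂ * ∑ P ∈ υ, (W P - W' P) * (P i : ℝ) := by
    rw [← hp, ← hp', ← mul_sub, ← Finset.sum_sub_distrib]
    simp only [sub_mul]
  rw [h3, abs_mul, abs_of_pos hDR] at h1
  have h4 := hpos.sum_abs_le hD₁ hc hm hσ hυ h0
  set x := ‖∑ P ∈ υ, (W P - W' P) • pos P‖ with hx
  have h5 : (D₂ : ℝ) * |∑ P ∈ υ, (W P - W' P) * (P i : ℝ)| ≤
      4 * r * ∑ P ∈ υ, |W P - W' P| := by gcongr
  have h6 : 1 ≤ 4 * ((m + 1) / c * x) := by linarith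
  rw [div_le_iff₀ (by positivity)]
  calc c = c * 1 := (mul_one c).symm
    _ ≤ c * (4 * ((m + 1) / c * x)) := by gcongr
    _ = _ := by field_simp

end VertexEnum

namespace VertexEnum

/-- If a ball meets at most `N₀` images of coarse simplices, a bounded number of fine simplices meet
the preimage of the ball: the vertices of such a fine simplex have separated images close to the
ball. -/
theorem exists_preimage_bound (n m N₀ : ℕ) {c : ℝ} (hc : 0 < c) (ρ : ℝ) :
    ∃ N : ℕ, ∀ {E : Type*} [AddCommGroup E] [Module ℝ E] {X : SimplicialComplex ℝ E}
      {e : VertexEnum X} {D₁ D₂ : ℕ} (hD₁ : 0 < D₁) (hD₂ : 0 < D₂) {r : ℝ},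
      0 < r → r ≤ D₂ → D₂ ≤ 4 * r → DimLE X m →
      ∀ {pos : (ℕ → ℤ) → EuclideanSpace ℝ (Fin n)}, e.IsThickPlacement D₁ m c r pos →
      (∀ (b : EuclideanSpace ℝ (Fin n)) (U : Finset (Finset (ℕ → ℤ))),
        (∀ υ ∈ U, ∃ σ ∈ e.faces, IsKuhn e.M D₁ σ υ) → (∀ υ ∈ U, Hits υ ρ b pos) → U.card ≤ N₀) →
      ∀ (b : EuclideanSpace ℝ (Fin n)) (S : Set (EuclideanSpace ℝ (Fin n))),
        S ⊆ Metric.closedBall b ρ →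
        (meeting (e.subdivision (D₁ * D₂) (Nat.mul_pos hD₁ hD₂))
          {x ∈ (e.subdivision (D₁ * D₂) (Nat.mul_pos hD₁ hD₂)).space |
            e.extend D₁ pos x ∈ S}).encard ≤ N := by
  classical
  obtain ⟨N, hN⟩ := exists_packing_bound n (ρ + bilipConst m c) (c := c / (4 * (m + 1)))
    (by positivity)
  refine ⟨2 ^ N * N₀, fun {E} _ _ {X e D₁ D₂} hD₁ hD₂ {r} hr hr1 hr2 hm {pos} hpos hcount b S hS =>
    encard_le_of_forall_finset fun T hT => ?_⟩
  have hD := Nat.mul_pos hD₁ hD₂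
  have hdata : ∀ t ∈ T, ∃ (σ : Finset ℕ) (τ υ : Finset (ℕ → ℤ)), σ ∈ e.faces ∧
      IsKuhn e.M D₁ σ υ ∧ τ.image (e.point (D₁ * D₂)) = t ∧ Hits υ ρ b pos ∧
      ∀ p ∈ τ, (∃ W, IsWeight υ W ∧ ∀ i, D₂ * ∑ P ∈ υ, W P * (P i : ℝ) = p i) ∧
        dist (e.extend D₁ pos (e.point (D₁ * D₂) p)) b ≤ ρ + bilipConst m c := by
    intro t ht
    obtain ⟨htf, x, hxt, -, hxS⟩ := hT ht
    have hbil := bilipschitzOnSimplex_extend hD₁ hD₂ hc hr hr1 hr2 hm hpos htf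
    obtain ⟨σ, hσ, τ, hτ, rfl⟩ := mem_subdivision_faces.1 htf
    obtain ⟨υ, hυ, q, hq, hqp, -⟩ := hτ.exists_coarsening hD₂
    obtain ⟨u, hu, hux⟩ := (mem_convexHull_image_point hD hσ hτ).1 hxt
    obtain ⟨h1, h2⟩ := extend_fine hD₁ hD₂ pos hσ hυ hq hqp hu
    have hxb := Metric.mem_closedBall.1 (hS hxS)
    refine ⟨σ, τ, υ, hσ, hυ, rfl, ⟨_, h1, ?_⟩, fun p hp => ⟨⟨q p, hq p hp, hqp p hp⟩, ?_⟩⟩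
    · rw [← h2, hux]
      exact hxb
    · have h3 := hbil.dist_le (bilipConst_nonneg m hc)
        (subset_convexHull ℝ _ (Finset.mem_coe.2 (Finset.mem_image_of_mem _ hp))) hxt
      linarith [dist_triangle (e.extend D₁ pos (e.point (D₁ * D₂) p)) (e.extend D₁ pos x) b]
  choose! σ τ υ hσ hυ hτ hH hp using hdata
  have hU : (T.image υ).card ≤ N₀ := by
    refine hcount b _ (fun υ' hυ' => ?_) fun υ' hυ' => ?_
    · obtain ⟨t, ht, rfl⟩ := Finset.mem_image.1 hυ'
      exact ⟨σ t, hσ t ht, hυ t ht⟩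
    · obtain ⟨t, ht, rfl⟩ := Finset.mem_image.1 hυ'
      exact hH t ht
  have hfib : ∀ υ' ∈ T.image υ, (T.filter fun t => υ t = υ').card ≤ 2 ^ N := by
    intro υ' hυ'
    obtain ⟨t₀, ht₀, rfl⟩ := Finset.mem_image.1 hυ'
    set Q := (T.filter fun t => υ t = υ t₀).biUnion τ with hQ
    have hQmem : ∀ p ∈ Q, (∃ W, IsWeight (υ t₀) W ∧ ∀ i, D₂ * ∑ P ∈ υ t₀, W P * (P i : ℝ) = p i) ∧
        dist (e.extend D₁ pos (e.point (D₁ * D₂) p)) b ≤ ρ + bilipConst m c := by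
      intro p hpQ
      obtain ⟨t, ht, hpt⟩ := Finset.mem_biUnion.1 hpQ
      obtain ⟨ht, hteq⟩ := Finset.mem_filter.1 ht
      rw [← hteq]
      exact hp t ht p hpt
    have hQc : Q.card ≤ N := by
      refine hN Q (fun p => e.extend D₁ pos (e.point (D₁ * D₂) p)) b (fun p hpQ => (hQmem p hpQ).2)
        fun p hpQ p' hpQ' hne => ?_
      obtain ⟨⟨W, hW, hWp⟩, -⟩ := hQmem p hpQ
      obtain ⟨⟨W', hW', hWp'⟩, -⟩ := hQmem p' hpQ'
      exact le_dist_extend_point hD₁ hD₂ hc hr hr2 hm hpos (hσ t₀ ht₀) (hυ t₀ ht₀) hW hW' hWp hWp'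
        hne
    calc (T.filter fun t => υ t = υ t₀).card ≤ Q.powerset.card := by
          refine Finset.card_le_card_of_injOn τ (fun t ht => ?_) fun t ht t' ht' h => ?_
          · exact Finset.mem_coe.2 (Finset.mem_powerset.2 (Finset.subset_biUnion_of_mem τ ht))
          · rw [← hτ t (Finset.mem_filter.1 ht).1, ← hτ t' (Finset.mem_filter.1 ht').1, h]
      _ = 2 ^ Q.card := Finset.card_powerset Q
      _ ≤ 2 ^ N := Nat.pow_le_pow_right (by norm_num) hQc
  calc T.card ≤ 2 ^ N * (T.image υ).card := Finset.card_le_mul_card_image T _ hfib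
    _ ≤ 2 ^ N * N₀ := Nat.mul_le_mul_left _ hU

variable {E : Type*} [AddCommGroup E] [Module ℝ E] {X : SimplicialComplex ℝ E} {e : VertexEnum X}
  {n m : ℕ}

theorem pow_le_mul_ncard_pieces {D : ℕ} (hD : 0 < D) {R : ℝ} (hR : 0 ≤ R) (hRD : R ≤ D)
    (hmD : m + 1 ≤ D) {s : Finset E} (hs : s ∈ X.faces) {m' : ℕ} (hm' : m' ≤ m)
    (hsc : s.card = m' + 1) :
    R ^ m' ≤ ((2 * (m + 1)) ^ m : ℕ) * ((pieces (e.subdivision D hD) s).ncard : ℝ) := by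
  classical
  obtain ⟨σ, hσ, rfl⟩ := exists_face (e := e) hs
  rw [card_image hσ] at hsc
  have hk : 0 < D / (m + 1) := Nat.div_pos hmD (Nat.succ_pos m)
  have h1 := le_ncard_pieces hD hk hσ (by
    rw [hsc]
    exact (Nat.mul_le_mul_left _ (by omega)).trans (Nat.div_mul_le_self D (m + 1)))
  rw [hsc, Nat.add_sub_cancel] at h1
  have h2 : D ≤ 2 * (m + 1) * (D / (m + 1)) := by
    have h3 := Nat.div_add_mod D (m + 1)
    have h4 : D % (m + 1) < m + 1 := Nat.mod_lt D (by omega)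
    have h5 : (m + 1) * 1 ≤ (m + 1) * (D / (m + 1)) := Nat.mul_le_mul_left _ hk
    rw [mul_assoc]
    omega
  calc R ^ m' ≤ (D : ℝ) ^ m' := by gcongr
    _ ≤ ((2 * (m + 1) * (D / (m + 1)) : ℕ) : ℝ) ^ m' := by gcongr
    _ = ((2 * (m + 1)) ^ m' : ℕ) * ((D / (m + 1)) ^ m' : ℕ) := by
        rw [Nat.cast_mul, mul_pow, Nat.cast_pow, Nat.cast_pow]
    _ ≤ ((2 * (m + 1)) ^ m : ℕ) * _ := by
        gcongr
        omega

theorem ncard_pieces_le_mul_pow {D : ℕ} (hD : 0 < D) {R : ℝ} (hR : 1 ≤ R) (hRD : D ≤ 4 * R)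
    {s : Finset E} (hs : s ∈ X.faces) {m' : ℕ} (hm' : m' ≤ m) (hsc : s.card = m' + 1) :
    ((pieces (e.subdivision D hD) s).ncard : ℝ) ≤ (5 ^ m * 2 ^ 5 ^ (m + 1) : ℕ) * R ^ m' := by
  classical
  obtain ⟨σ, hσ, rfl⟩ := exists_face (e := e) hs
  rw [card_image hσ] at hsc
  have h1 := ncard_pieces_le hD hσ
  rw [hsc, Nat.add_sub_cancel] at h1
  calc ((pieces (e.subdivision D hD) (σ.image e.v)).ncard : ℝ)
      ≤ (((D + 1) ^ m' * 2 ^ 5 ^ (m' + 1) : ℕ) : ℝ) := by exact_mod_cast h1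
    _ = ((D : ℝ) + 1) ^ m' * 2 ^ 5 ^ (m' + 1) := by push_cast; ring
    _ ≤ (5 * R) ^ m' * 2 ^ 5 ^ (m + 1) := by
        gcongr
        · linarith
        · norm_num
        · norm_num
    _ = 5 ^ m' * R ^ m' * 2 ^ 5 ^ (m + 1) := by rw [mul_pow]
    _ ≤ 5 ^ m * R ^ m' * 2 ^ 5 ^ (m + 1) := by
        gcongr
        norm_num
    _ = _ := by push_cast; ring

end VertexEnum

end ThickEmbedding

theorem mainTheorem4 (m n A B : ℕ) (L : ℝ) (hmn : m < n) :
    ∃ (C : ℕ) (V₀ : ℝ), ∀ (E : Type*) [AddCommGroup E] [Module ℝ E]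
      (X : Geometry.SimplicialComplex ℝ E) (V : ℝ), V₀ ≤ V →
      ThickEmbedding.DimLE X m → ThickEmbedding.DegreeLE X A →
      X.faces.Finite → (X.faces.ncard : ℝ) ≤ B * V →
      ∃ (X' : Geometry.SimplicialComplex ℝ E) (I : E → EuclideanSpace ℝ (Fin n)),
        ThickEmbedding.IsSubdivision X' X ∧
        X'.faces.Finite ∧
        ThickEmbedding.DegreeLE X' C ∧
        (∀ s ∈ X.faces, ∀ m' : ℕ, s.card = m' + 1 →
          ThickEmbedding.radius m n V ^ m' ≤ C * ((ThickEmbedding.pieces X' s).ncard : ℝ) ∧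
          ((ThickEmbedding.pieces X' s).ncard : ℝ) ≤ C * ThickEmbedding.radius m n V ^ m') ∧
        Set.MapsTo I X'.space (Metric.closedBall 0 (ThickEmbedding.radius m n V)) ∧
        (∀ T : Geometry.SimplicialComplex ℝ (EuclideanSpace ℝ (Fin n)),
          ThickEmbedding.IsUnitTriangulation n L T → ThickEmbedding.IsCoarse C X' T I) ∧
        (∀ s ∈ X'.faces, ThickEmbedding.BilipschitzOnSimplex (C : ℝ) I s) := by
  classical
  obtain ⟨c, hc, hplace⟩ := ThickEmbedding.exists_thick_placement m n A B hmn
  obtain ⟨V₀, hplace⟩ := hplace (max L 1)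
  obtain ⟨N₁, hN₁⟩ := ThickEmbedding.exists_meeting_bound n L
    (ThickEmbedding.VertexEnum.bilipConst m c)
  obtain ⟨N₂, hN₂⟩ := ThickEmbedding.VertexEnum.exists_preimage_bound n m
    (n * (n + 1) * (m + 1) * (A * 2 ^ 5 ^ (m + 1))) hc (max L 1)
  set K := ThickEmbedding.VertexEnum.bilipConst m c with hK
  have hK0 : 0 ≤ K := ThickEmbedding.VertexEnum.bilipConst_nonneg m hc
  obtain ⟨C, hC1, hC2, hC3, hC4, hC5, hC6⟩ : ∃ C : ℕ, A * 2 ^ 5 ^ (m + 1) ≤ C ∧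
      (2 * (m + 1)) ^ m ≤ C ∧ 5 ^ m * 2 ^ 5 ^ (m + 1) ≤ C ∧ N₁ ≤ C ∧ N₂ ≤ C ∧ ⌈K⌉₊ ≤ C :=
    ⟨A * 2 ^ 5 ^ (m + 1) + (2 * (m + 1)) ^ m + 5 ^ m * 2 ^ 5 ^ (m + 1) + N₁ + N₂ + ⌈K⌉₊,
      by omega, by omega, by omega, by omega, by omega, by omega⟩
  have hKC : K ≤ C := (Nat.le_ceil K).trans (by exact_mod_cast hC6)
  refine ⟨C, V₀, fun E _ _ X V hV hm hA hX hcard => ?_⟩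
  obtain ⟨e⟩ := ThickEmbedding.exists_vertexEnum hX
  obtain ⟨D₁, R₁, s, r, pos, hRad, hmR, hRD, hDR, hs1, hsr, hrs, hpos, hnorm, hcount⟩ :=
    hplace e V hV hm hA hX hcard
  have hm0 : (0 : ℝ) ≤ m := Nat.cast_nonneg m
  have hR1 : 1 ≤ R₁ := by linarith
  have hr : 0 < r := by linarith
  have hD₁ : 0 < D₁ := by
    have : (0 : ℝ) < D₁ := by linarith
    exact_mod_cast this
  -- after the second subdivision the edges have length about one
  set D₂ := ⌈s⌉₊ with hD₂def
  have hsD : s ≤ D₂ := Nat.le_ceil s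
  have hD₂s : (D₂ : ℝ) ≤ 2 * s := by
    have := Nat.ceil_lt_add_one (a := s) (by linarith)
    rw [← hD₂def] at this
    linarith
  have hD₂ : 0 < D₂ := by
    have : (0 : ℝ) < D₂ := by linarith
    exact_mod_cast this
  have hD := Nat.mul_pos hD₁ hD₂
  have hRR : ThickEmbedding.radius m n V ≤ ((D₁ * D₂ : ℕ) : ℝ) := by
    rw [hRad]; push_cast; gcongr
  have hRR' : ((D₁ * D₂ : ℕ) : ℝ) ≤ 4 * ThickEmbedding.radius m n V := by
    rw [hRad]; push_cast
    calc (D₁ : ℝ) * D₂ ≤ (2 * R₁) * (2 * s) := by gcongr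
      _ = _ := by ring
  have hRad1 : 1 ≤ ThickEmbedding.radius m n V := by
    rw [hRad]; nlinarith
  have hmD : m + 1 ≤ D₁ * D₂ := by
    have h1 : m + 1 ≤ D₁ := by exact_mod_cast hmR.trans hRD
    exact h1.trans (Nat.le_mul_of_pos_right _ hD₂)
  have hbil : ∀ t ∈ (e.subdivision (D₁ * D₂) hD).faces,
      ThickEmbedding.BilipschitzOnSimplex K (e.extend D₁ pos) t := fun t ht =>
    ThickEmbedding.VertexEnum.bilipschitzOnSimplex_extend hD₁ hD₂ hc hr (by linarith) (by linarith)
      hm hpos ht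
  refine ⟨e.subdivision (D₁ * D₂) hD, e.extend D₁ pos,
    ThickEmbedding.VertexEnum.isSubdivision_subdivision hD,
    ThickEmbedding.VertexEnum.subdivision_faces_finite hD, fun v hv => ?_,
    fun t ht m' htc => ⟨?_, ?_⟩, fun x hx => ?_, fun T hT => ⟨?_, fun t ht => ?_, fun t ht => ?_⟩,
    fun t ht => (hbil t ht).mono hKC⟩
  · exact (ThickEmbedding.VertexEnum.degreeLE_subdivision hD hm hA v hv).trans
      (by exact_mod_cast hC1)
  · have hm' : m' ≤ m := by
      have := hm t ht
      omega
    refine (ThickEmbedding.VertexEnum.pow_le_mul_ncard_pieces (e := e) hD (by linarith) hRR hmD ht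
      hm' htc).trans ?_
    gcongr
  · have hm' : m' ≤ m := by
      have := hm t ht
      omega
    refine (ThickEmbedding.VertexEnum.ncard_pieces_le_mul_pow (e := e) hD hRad1 hRR' ht
      hm' htc).trans ?_
    gcongr
  · refine ThickEmbedding.VertexEnum.extend_mem_closedBall hD₁ hD₂ (fun σ hσ p hp hps => ?_) hx
    refine (hnorm σ hσ p hp hps).trans ?_
    rw [hRad, mul_comm R₁]
    gcongr
  · rw [hT.space_eq]
    exact Set.mapsTo_univ _ _
  · obtain ⟨x₀, hx₀⟩ := Geometry.SimplicialComplex.nonempty_of_mem_faces ht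
    refine (hN₁ T hT (e.extend D₁ pos x₀) _ ?_).trans (by exact_mod_cast hC4)
    rintro _ ⟨x, hx, rfl⟩
    exact Metric.mem_closedBall.2 ((hbil t ht).dist_le hK0 hx
      (subset_convexHull ℝ _ (Finset.mem_coe.2 hx₀)))
  · obtain ⟨b, hb⟩ := hT.convexHull_subset_closedBall ht
    exact (hN₂ hD₁ hD₂ hr (by linarith) (by linarith) hm hpos hcount b _ hb).trans
      (by exact_mod_cast hC5)
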